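/- For $n\in\mathbb N$ let $\mathbf{CubCat}_n$ be the category of (small, strict) cubical $n$-categories with connections in the sense of Al-Agl, Brown and Steiner, truncated at dimension $n$: sets $C_k$ ($0\le k\le n$) with faces $\partial_i^\alpha:C_k\to C_{k-1}$, degeneracies $\epsilon_i:C_{k-1}\to C_k$ $(1\le i\le k)$, connections $\Gamma_i^\alpha:C_{k-1}\to C_k$ $(1\le i<k)$, $\alpha\in\{-,+\}$, and compositions $a\circ_i b$ defined when $\partial_i^+a=\partial_i^-b$, satisfying the usual axioms; morphisms preserve all the operations. An $n$-square in $C$ is a family $(S_i^\alpha)_{1\le i\le n+1}$ of $n$-cells satisfying the cubical relations $\partial_i^\alpha S_j^\beta=\partial_{j-1}^\beta S_i^\alpha$ for $i<j$. A cubical extension of $C\in\mathbf{CubCat}_n$ is a set $X$ with a map $\partial$ from $X$ to the $n$-squares in $C$. Pairs $(C,X)$ form a category $\mathbf{CubCat}_n^+$, a morphism $(C,X)\to(D,Y)$ being a functor $C\to D$ with a map $X\to Y$ compatible with faces. Let $W_n:\mathbf{CubCat}_{n+1}\to\mathbf{CubCat}_n^+$ send $D$ to its $n$-truncation $D_{\le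 n}$ together with the set $D_{n+1}$ and its faces. (1) For every $n\ge 0$ the functor $W_n$ has a left adjoint $L_n$. Moreover $D=L_n(C,X)$ has the following syntactic description. The unit identifies $C$ with $D_{\le n}$. Consider the expressions built from constants $\mathbf c_x$ ($x\in X$), $\mathbf e_{i,c}$ ($c\in C_n$, $1\le i\le n+1$), $\mathbf g_{i,c}^\alpha$ ($c\in C_n$, $1\le i\le n$) by binary symbols $\circ_i$ ($1\le i\le n+1$). Their types are the $n$-squares given as follows: $\mathbf c_x$ has type $\partial x$; $\mathbf e_{i,c}$ and $\mathbf g_{i,c}^\alpha$ have as types the families of faces prescribed for $\epsilon_ic$ and $\Gamma_i^\alpha c$ by the cubical axioms; if $A:S$ and $B:T$ with $S_i^+=T_i^-$ ($A$ and $B$ are $\circ_i$-composable), then $A\circ_iB$ has as type the family of faces prescribed for a composite. Let $\cong$ be the smallest congruence on typable expressions containing the instances of associativity, interchange and unit laws, and of the axioms for degeneracies of composites and of degeneracies, for connections of composites, of degeneracies and of connections, and for composites of opposite connections ($\mathbf g^+_{i,c}\circ_i\mathbf g^-_{i,c}\cong\mathbf e_{i+1,c}$, $\mathbf g^+_{i,c}\circ_{i+1}\mathbf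 g^-_{i,c}\cong\mathbf e_{i,c}$). Then the $(n+1)$-cells of $D$ are the classes $[A]$ of typable expressions modulo $\cong$, with $\partial_i^\alpha[A]=S_i^\alpha$ for $A:S$, $\epsilon_ic=[\mathbf e_{i,c}]$, $\Gamma_i^\alpha c=[\mathbf g_{i,c}^\alpha]$, $[A]\circ_i[B]=[A\circ_iB]$ for composable $A$ and $B$, and the unit sends $x\in X$ to $[\mathbf c_x]$. (2) Define the category of cubical $n$-polygraphs and a functor $F_n$ from it to $\mathbf{CubCat}_n$ recursively: cubical $0$-polygraphs are sets, and $F_0$ views a set as a cubical $0$-category; a cubical $(n+1)$-polygraph is a cubical $n$-polygraph $X$ with a cubical extension $X_{n+1}$ of $F_n(X)$, and $F_{n+1}(X,X_{n+1})=L_n(F_n(X),X_{n+1})$. Then $F_{n+1}(X,X_{n+1})$ is free on $X_{n+1}$ over $F_n(X)$: its $n$-truncation is $F_n(X)$ (through the unit), and for every cubical $(n+1)$-category $D$, every morphism $(F_n(X),X_{n+1})\to W_n(D)$ extends uniquely to a functor $F_{n+1}(X,X_{n+1})\to D$. (3) Let $p\in\mathbb N$. A $k$-cell $a$ is $R_i$-invertible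 if there is a $k$-cell $b$ with $a\circ_ib=\epsilon_i\partial_i^-a$ and $b\circ_ia=\epsilon_i\partial_i^+a$; it has an $R_i$-invertible shell if $\partial_j^\alpha a$ is $R_{i-1}$-invertible for $j<i$ and $R_i$-invertible for $j>i$. A cubical $(n,p)$-category is a cubical $n$-category in which, for $k>p$, every $k$-cell with an $R_i$-invertible shell is $R_i$-invertible (a cubical $n$-groupoid if $p=0$). For every $n$, the forgetful functor from cubical $(n+1,p)$-categories to cubical $(n,p)$-categories equipped with a cubical extension has a left adjoint as well, whose unit is an isomorphism on the underlying $(n,p)$-categories; and the cubical $(n+1,p)$-categories generated by cubical $(n+1,p)$-polygraphs, defined as in (2) with these left adjoints, are free in the sense of (2) among cubical $(n+1,p)$-categories. In particular, this yields free cubical groupoids on cubical polygraphs. -/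

import Mathlib

open CategoryTheory

universe u

namespace Cub

/-! Conventions. Directions are numbered from `0`, so the `k`-cells have faces in the directions
`0, …, k - 1`. Signs are Booleans: `false` is the lower sign `-`, `true` is the upper sign `+`.
Dimensions carry the bound `k ≤ n`, since a cubical `n`-category has cells of dimension at most
`n` only. -/

/-- The underlying data of a cubical `n`-category with connections. -/
structure CubData (n : ℕ) where
  /-- The set of `k`-cells, for `k ≤ n`. -/
  cell : (k : ℕ) → k ≤ n → Type u
  /-- The face maps `∂_i^α`. -/
  face : ∀ {k : ℕ} {hk : k + 1 ≤ n} (i : ℕ) (_ : Bool) (_ : cell (k + 1) hk)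
    (_ : i ≤ k := by omega), cell k (Nat.le_of_succ_le hk)
  /-- The degeneracy maps `ε_i`. -/
  deg : ∀ {k : ℕ} (hk : k + 1 ≤ n) (i : ℕ) (_ : cell k (Nat.le_of_succ_le hk))
    (_ : i ≤ k := by omega), cell (k + 1) hk
  /-- The composition `a ∘_i b`, defined if `∂_i^+ a = ∂_i^- b`. -/
  comp : ∀ {k : ℕ} {hk : k + 1 ≤ n} (i : ℕ) (hi : i ≤ k) (a b : cell (k + 1) hk)
    (_ : face i true a hi = face i false b hi), cell (k + 1) hk
  /-- The connection maps `Γ_i^α`. -/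
  conn : ∀ {k : ℕ} (hk : k + 2 ≤ n) (i : ℕ) (_ : Bool)
    (_ : cell (k + 1) (Nat.le_of_succ_le hk)) (_ : i ≤ k := by omega), cell (k + 2) hk

/-- A cubical `n`-category (with connections). In the laws, the proofs that composites are
defined are universally quantified; they always exist, by the preceding laws. -/
structure CubCat (n : ℕ) extends CubData.{u} n where
  face_face : ∀ {k : ℕ} {hk : k + 2 ≤ n} (i j : ℕ) (_ : i ≤ j) (_ : j ≤ k) (α β : Bool)
    (x : cell (k + 2) hk), face i α (face (j + 1) β x) = face j β (face i α x)
  -- faces of degeneracies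
  face_deg_lt : ∀ {k : ℕ} (hk : k + 2 ≤ n) (i j : ℕ) (_ : i ≤ j) (_ : j ≤ k) (α : Bool)
    (x : cell (k + 1) (Nat.le_of_succ_le hk)),
    face i α (deg hk (j + 1) x) = deg (Nat.le_of_succ_le hk) j (face i α x)
  face_deg_eq : ∀ {k : ℕ} (hk : k + 1 ≤ n) (i : ℕ) (_ : i ≤ k) (α : Bool)
    (x : cell k (Nat.le_of_succ_le hk)), face i α (deg hk i x) = x
  face_deg_gt : ∀ {k : ℕ} (hk : k + 2 ≤ n) (i j : ℕ) (_ : j ≤ i) (_ : i ≤ k) (α : Bool)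
    (x : cell (k + 1) (Nat.le_of_succ_le hk)),
    face (i + 1) α (deg hk j x) = deg (Nat.le_of_succ_le hk) j (face i α x)
  deg_deg : ∀ {k : ℕ} (hk : k + 2 ≤ n) (i j : ℕ) (_ : i ≤ j) (_ : j ≤ k)
    (x : cell k (Nat.le_of_succ_le (Nat.le_of_succ_le hk))),
    deg hk i (deg (Nat.le_of_succ_le hk) j x) = deg hk (j + 1) (deg (Nat.le_of_succ_le hk) i x)
  -- faces of composites
  face_comp_lt : ∀ {k : ℕ} {hk : k + 2 ≤ n} (i j : ℕ) (_ : i ≤ j) (_ : j ≤ k) (α : Bool)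
    (a b : cell (k + 2) hk) (h : face (j + 1) true a = face (j + 1) false b)
    (h' : face j true (face i α a) = face j false (face i α b)),
    face i α (comp (j + 1) _ a b h) = comp j _ (face i α a) (face i α b) h'
  face_comp_lower : ∀ {k : ℕ} {hk : k + 1 ≤ n} (i : ℕ) (_ : i ≤ k)
    (a b : cell (k + 1) hk) (h : face i true a = face i false b),
    face i false (comp i _ a b h) = face i false a
  face_comp_upper : ∀ {k : ℕ} {hk : k + 1 ≤ n} (i : ℕ) (_ : i ≤ k)
    (a b : cell (k + 1) hk) (h : face i true a = face i false b),
    face i true (comp i _ a b h) = face i true b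
  face_comp_gt : ∀ {k : ℕ} {hk : k + 2 ≤ n} (i j : ℕ) (_ : j ≤ i) (_ : i ≤ k) (α : Bool)
    (a b : cell (k + 2) hk) (h : face j true a = face j false b)
    (h' : face j true (face (i + 1) α a) = face j false (face (i + 1) α b)),
    face (i + 1) α (comp j _ a b h) = comp j _ (face (i + 1) α a) (face (i + 1) α b) h'
  -- associativity, interchange and units
  comp_assoc : ∀ {k : ℕ} {hk : k + 1 ≤ n} (i : ℕ) (_ : i ≤ k) (a b c : cell (k + 1) hk)
    (hab : face i true a = face i false b) (hbc : face i true b = face i false c)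
    (h : face i true a = face i false (comp i _ b c hbc))
    (h' : face i true (comp i _ a b hab) = face i false c),
    comp i _ a (comp i _ b c hbc) h = comp i _ (comp i _ a b hab) c h'
  interchange : ∀ {k : ℕ} {hk : k + 1 ≤ n} (i j : ℕ) (_ : i ≠ j) (_ : i ≤ k) (_ : j ≤ k)
    (a b c d : cell (k + 1) hk)
    (hab : face i true a = face i false b) (hcd : face i true c = face i false d)
    (hac : face j true a = face j false c) (hbd : face j true b = face j false d)
    (h : face j true (comp i _ a b hab) = face j false (comp i _ c d hcd))
    (h' : face i true (comp j _ a c hac) = face i false (comp j _ b d hbd)),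
    comp j _ (comp i _ a b hab) (comp i _ c d hcd) h =
      comp i _ (comp j _ a c hac) (comp j _ b d hbd) h'
  comp_deg : ∀ {k : ℕ} {hk : k + 1 ≤ n} (i : ℕ) (_ : i ≤ k) (a : cell (k + 1) hk)
    (h : face i true a = face i false (deg hk i (face i true a))),
    comp i _ a (deg hk i (face i true a)) h = a
  deg_comp_self : ∀ {k : ℕ} {hk : k + 1 ≤ n} (i : ℕ) (_ : i ≤ k) (a : cell (k + 1) hk)
    (h : face i true (deg hk i (face i false a)) = face i false a),
    comp i _ (deg hk i (face i false a)) a h = a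
  -- degeneracies of composites
  deg_comp_le : ∀ {k : ℕ} (hk : k + 2 ≤ n) (i j : ℕ) (_ : i ≤ j) (_ : j ≤ k)
    (a b : cell (k + 1) (Nat.le_of_succ_le hk)) (h : face j true a = face j false b)
    (h' : face (j + 1) true (deg hk i a) = face (j + 1) false (deg hk i b)),
    deg hk i (comp j _ a b h) = comp (j + 1) _ (deg hk i a) (deg hk i b) h'
  deg_comp_gt : ∀ {k : ℕ} (hk : k + 2 ≤ n) (i j : ℕ) (_ : j < i) (_ : i ≤ k + 1)
    (a b : cell (k + 1) (Nat.le_of_succ_le hk)) (h : face j true a = face j false b)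
    (h' : face j true (deg hk i a) = face j false (deg hk i b)),
    deg hk i (comp j _ a b h) = comp j _ (deg hk i a) (deg hk i b) h'
  -- faces of connections
  face_conn_lt : ∀ {k : ℕ} (hk : k + 3 ≤ n) (i j : ℕ) (_ : i ≤ j) (_ : j ≤ k) (α β : Bool)
    (x : cell (k + 2) (Nat.le_of_succ_le hk)),
    face i α (conn hk (j + 1) β x) = conn (Nat.le_of_succ_le hk) j β (face i α x)
  face_conn_same : ∀ {k : ℕ} (hk : k + 2 ≤ n) (i j : ℕ) (_ : i = j ∨ i = j + 1) (_ : j ≤ k)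
    (α : Bool) (x : cell (k + 1) (Nat.le_of_succ_le hk)),
    face i α (conn hk j α x) = x
  face_conn_opp : ∀ {k : ℕ} (hk : k + 2 ≤ n) (i j : ℕ) (_ : i = j ∨ i = j + 1) (_ : j ≤ k)
    (α : Bool) (x : cell (k + 1) (Nat.le_of_succ_le hk)),
    face i α (conn hk j (!α) x) = deg (Nat.le_of_succ_le hk) j (face j α x)
  face_conn_gt : ∀ {k : ℕ} (hk : k + 3 ≤ n) (i j : ℕ) (_ : j < i) (_ : i ≤ k + 1) (α β : Bool)
    (x : cell (k + 2) (Nat.le_of_succ_le hk)),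
    face (i + 1) α (conn hk j β x) = conn (Nat.le_of_succ_le hk) j β (face i α x)
  -- connections of degeneracies and of connections
  conn_deg_lt : ∀ {k : ℕ} (hk : k + 3 ≤ n) (i j : ℕ) (_ : i < j) (_ : j ≤ k + 1) (α : Bool)
    (x : cell (k + 1) (Nat.le_of_succ_le (Nat.le_of_succ_le hk))),
    conn hk i α (deg (Nat.le_of_succ_le hk) j x) =
      deg hk (j + 1) (conn (Nat.le_of_succ_le hk) i α x)
  conn_deg_eq : ∀ {k : ℕ} (hk : k + 2 ≤ n) (i : ℕ) (_ : i ≤ k) (α : Bool)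
    (x : cell k (Nat.le_of_succ_le (Nat.le_of_succ_le hk))),
    conn hk i α (deg (Nat.le_of_succ_le hk) i x) = deg hk i (deg (Nat.le_of_succ_le hk) i x)
  conn_deg_gt : ∀ {k : ℕ} (hk : k + 3 ≤ n) (i j : ℕ) (_ : j ≤ i) (_ : i ≤ k) (α : Bool)
    (x : cell (k + 1) (Nat.le_of_succ_le (Nat.le_of_succ_le hk))),
    conn hk (i + 1) α (deg (Nat.le_of_succ_le hk) j x) =
      deg hk j (conn (Nat.le_of_succ_le hk) i α x)
  conn_conn_lt : ∀ {k : ℕ} (hk : k + 3 ≤ n) (i j : ℕ) (_ : i < j) (_ : j ≤ k) (α β : Bool)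
    (x : cell (k + 1) (Nat.le_of_succ_le (Nat.le_of_succ_le hk))),
    conn hk i α (conn (Nat.le_of_succ_le hk) j β x) =
      conn hk (j + 1) β (conn (Nat.le_of_succ_le hk) i α x)
  conn_conn_eq : ∀ {k : ℕ} (hk : k + 3 ≤ n) (i : ℕ) (_ : i ≤ k) (α : Bool)
    (x : cell (k + 1) (Nat.le_of_succ_le (Nat.le_of_succ_le hk))),
    conn hk i α (conn (Nat.le_of_succ_le hk) i α x) =
      conn hk (i + 1) α (conn (Nat.le_of_succ_le hk) i α x)
  -- composites of opposite connections
  conn_comp_conn : ∀ {k : ℕ} (hk : k + 2 ≤ n) (i : ℕ) (_ : i ≤ k)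
    (x : cell (k + 1) (Nat.le_of_succ_le hk))
    (h : face i true (conn hk i true x) = face i false (conn hk i false x)),
    comp i _ (conn hk i true x) (conn hk i false x) h = deg hk (i + 1) x
  conn_comp_conn_succ : ∀ {k : ℕ} (hk : k + 2 ≤ n) (i : ℕ) (_ : i ≤ k)
    (x : cell (k + 1) (Nat.le_of_succ_le hk))
    (h : face (i + 1) true (conn hk i true x) = face (i + 1) false (conn hk i false x)),
    comp (i + 1) _ (conn hk i true x) (conn hk i false x) h = deg hk i x
  -- connections of composites
  conn_comp_lt : ∀ {k : ℕ} (hk : k + 2 ≤ n) (i j : ℕ) (_ : i < j) (_ : j ≤ k) (α : Bool)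
    (a b : cell (k + 1) (Nat.le_of_succ_le hk)) (h : face j true a = face j false b)
    (h' : face (j + 1) true (conn hk i α a) = face (j + 1) false (conn hk i α b)),
    conn hk i α (comp j _ a b h) = comp (j + 1) _ (conn hk i α a) (conn hk i α b) h'
  conn_comp_lower : ∀ {k : ℕ} (hk : k + 2 ≤ n) (i : ℕ) (_ : i ≤ k)
    (a b : cell (k + 1) (Nat.le_of_succ_le hk)) (h : face i true a = face i false b)
    (h₁ : face i true (conn hk i false a) = face i false (deg hk (i + 1) b))
    (h₂ : face i true (deg hk i b) = face i false (conn hk i false b))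
    (h₃ : face (i + 1) true (comp i _ (conn hk i false a) (deg hk (i + 1) b) h₁) =
      face (i + 1) false (comp i _ (deg hk i b) (conn hk i false b) h₂)),
    conn hk i false (comp i _ a b h) =
      comp (i + 1) _ (comp i _ (conn hk i false a) (deg hk (i + 1) b) h₁)
        (comp i _ (deg hk i b) (conn hk i false b) h₂) h₃
  conn_comp_upper : ∀ {k : ℕ} (hk : k + 2 ≤ n) (i : ℕ) (_ : i ≤ k)
    (a b : cell (k + 1) (Nat.le_of_succ_le hk)) (h : face i true a = face i false b)
    (h₁ : face i true (conn hk i true a) = face i false (deg hk i a))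
    (h₂ : face i true (deg hk (i + 1) a) = face i false (conn hk i true b))
    (h₃ : face (i + 1) true (comp i _ (conn hk i true a) (deg hk i a) h₁) =
      face (i + 1) false (comp i _ (deg hk (i + 1) a) (conn hk i true b) h₂)),
    conn hk i true (comp i _ a b h) =
      comp (i + 1) _ (comp i _ (conn hk i true a) (deg hk i a) h₁)
        (comp i _ (deg hk (i + 1) a) (conn hk i true b) h₂) h₃
  conn_comp_gt : ∀ {k : ℕ} (hk : k + 2 ≤ n) (i j : ℕ) (_ : j < i) (_ : i ≤ k) (α : Bool)
    (a b : cell (k + 1) (Nat.le_of_succ_le hk)) (h : face j true a = face j false b)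
    (h' : face j true (conn hk i α a) = face j false (conn hk i α b)),
    conn hk i α (comp j _ a b h) = comp j _ (conn hk i α a) (conn hk i α b) h'

/-- Functors of cubical `n`-categories. -/
@[ext]
structure CubFunctor {n : ℕ} (C D : CubCat.{u} n) where
  map : ∀ {k : ℕ} {hk : k ≤ n}, C.cell k hk → D.cell k hk
  map_face : ∀ {k : ℕ} {hk : k + 1 ≤ n} (i : ℕ) (_ : i ≤ k) (α : Bool) (x : C.cell (k + 1) hk),
    map (C.face i α x) = D.face i α (map x)
  map_deg : ∀ {k : ℕ} (hk : k + 1 ≤ n) (i : ℕ) (_ : i ≤ k)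
    (x : C.cell k (Nat.le_of_succ_le hk)), map (C.deg hk i x) = D.deg hk i (map x)
  map_comp : ∀ {k : ℕ} {hk : k + 1 ≤ n} (i : ℕ) (_ : i ≤ k) (a b : C.cell (k + 1) hk)
    (h : C.face i true a = C.face i false b)
    (h' : D.face i true (map a) = D.face i false (map b)),
    map (C.comp i _ a b h) = D.comp i _ (map a) (map b) h'
  map_conn : ∀ {k : ℕ} (hk : k + 2 ≤ n) (i : ℕ) (_ : i ≤ k) (α : Bool)
    (x : C.cell (k + 1) (Nat.le_of_succ_le hk)), map (C.conn hk i α x) = D.conn hk i α (map x)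

instance {n : ℕ} : Category.{u} (CubCat.{u} n) where
  Hom C D := CubFunctor C D
  id C :=
    { map := fun x => x
      map_face := by intros; rfl
      map_deg := by intros; rfl
      map_comp := by intros; rfl
      map_conn := by intros; rfl }
  comp F G :=
    { map := fun x => G.map (F.map x)
      map_face := by intros; rw [F.map_face, G.map_face]
      map_deg := by intros; rw [F.map_deg, G.map_deg]
      map_comp := by
        intro k hk i hi a b h h'
        have h₁ := by simpa only [F.map_face] using congrArg F.map h
        rw [F.map_comp i hi a b h h₁, G.map_comp i hi _ _ h₁ h']
      map_conn := by intros; rw [F.map_conn, G.map_conn] }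

/-- The truncation functor, forgetting the `(n + 1)`-cells. -/
@[reducible] def trunc (n : ℕ) : CubCat.{u} (n + 1) ⥤ CubCat.{u} n where
  obj D :=
    { cell := fun k hk => D.cell k (Nat.le_succ_of_le hk)
      face := fun i α x hi => D.face i α x hi
      deg := fun hk i x hi => D.deg (Nat.le_succ_of_le hk) i x hi
      comp := fun i hi a b h => D.comp i hi a b h
      conn := fun hk i α x hi => D.conn (Nat.le_succ_of_le hk) i α x hi
      face_face := D.face_face
      face_deg_lt := fun hk => D.face_deg_lt (Nat.le_succ_of_le hk)
      face_deg_eq := fun hk => D.face_deg_eq (Nat.le_succ_of_le hk)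
      face_deg_gt := fun hk => D.face_deg_gt (Nat.le_succ_of_le hk)
      deg_deg := fun hk => D.deg_deg (Nat.le_succ_of_le hk)
      face_comp_lt := D.face_comp_lt
      face_comp_lower := D.face_comp_lower
      face_comp_upper := D.face_comp_upper
      face_comp_gt := D.face_comp_gt
      comp_assoc := D.comp_assoc
      interchange := D.interchange
      comp_deg := D.comp_deg
      deg_comp_self := D.deg_comp_self
      deg_comp_le := fun hk => D.deg_comp_le (Nat.le_succ_of_le hk)
      deg_comp_gt := fun hk => D.deg_comp_gt (Nat.le_succ_of_le hk)
      face_conn_lt := fun hk => D.face_conn_lt (Nat.le_succ_of_le hk)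
      face_conn_same := fun hk => D.face_conn_same (Nat.le_succ_of_le hk)
      face_conn_opp := fun hk => D.face_conn_opp (Nat.le_succ_of_le hk)
      face_conn_gt := fun hk => D.face_conn_gt (Nat.le_succ_of_le hk)
      conn_deg_lt := fun hk => D.conn_deg_lt (Nat.le_succ_of_le hk)
      conn_deg_eq := fun hk => D.conn_deg_eq (Nat.le_succ_of_le hk)
      conn_deg_gt := fun hk => D.conn_deg_gt (Nat.le_succ_of_le hk)
      conn_conn_lt := fun hk => D.conn_conn_lt (Nat.le_succ_of_le hk)
      conn_conn_eq := fun hk => D.conn_conn_eq (Nat.le_succ_of_le hk)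
      conn_comp_conn := fun hk => D.conn_comp_conn (Nat.le_succ_of_le hk)
      conn_comp_conn_succ := fun hk => D.conn_comp_conn_succ (Nat.le_succ_of_le hk)
      conn_comp_lt := fun hk => D.conn_comp_lt (Nat.le_succ_of_le hk)
      conn_comp_lower := fun hk => D.conn_comp_lower (Nat.le_succ_of_le hk)
      conn_comp_upper := fun hk => D.conn_comp_upper (Nat.le_succ_of_le hk)
      conn_comp_gt := fun hk => D.conn_comp_gt (Nat.le_succ_of_le hk) }
  map F :=
    { map := F.map
      map_face := F.map_face
      map_deg := fun hk => F.map_deg (Nat.le_succ_of_le hk)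
      map_comp := F.map_comp
      map_conn := fun hk => F.map_conn (Nat.le_succ_of_le hk) }

/-- A shell: a family of `2 (k + 1)` cells of dimension `k`, the candidate faces of a
`(k + 1)`-cell. -/
abbrev CubData.Shell {n : ℕ} (C : CubData.{u} n) (k : ℕ) (hk : k ≤ n) : Type u :=
  (i : ℕ) → i ≤ k → Bool → C.cell k hk

/-- A `k`-square: a shell satisfying the cubical relations `∂_i^α S_{j+1}^β = ∂_j^β S_i^α` for
`i ≤ j` (no condition if `k = 0`). -/
def CubData.IsSquare {n : ℕ} (C : CubData.{u} n) : ∀ {k : ℕ} {hk : k ≤ n}, C.Shell k hk → Prop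
  | 0, _, _ => True
  | k + 1, _, S => ∀ (i j : ℕ) (hij : i ≤ j) (hj : j ≤ k) (α β : Bool),
      C.face i α (S (j + 1) (by omega) β) = C.face j β (S i (by omega) α)

/-- A cubical extension of a cubical `n`-category: a set of `(n + 1)`-generators, with faces in
the `n`-cells that satisfy the cubical relations. -/
structure Extension {n : ℕ} (C : CubCat.{u} n) where
  gen : Type u
  bd : gen → C.Shell n le_rfl
  bd_square : ∀ x, C.IsSquare (bd x)

/-- Cubical `n`-categories equipped with a cubical extension. -/
structure CubExt (n : ℕ) where
  base : CubCat.{u} n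
  ext : Extension base

/-- Morphisms of cubical extensions. -/
@[ext]
structure CubExtHom {n : ℕ} (E E' : CubExt.{u} n) where
  base : E.base ⟶ E'.base
  gen : E.ext.gen → E'.ext.gen
  bd_gen : ∀ x i hi α, E'.ext.bd (gen x) i hi α = base.map (E.ext.bd x i hi α)

instance {n : ℕ} : Category.{u} (CubExt.{u} n) where
  Hom E E' := CubExtHom E E'
  id E := ⟨𝟙 E.base, fun x => x, by intros; rfl⟩
  comp F G := ⟨F.base ≫ G.base, fun x => G.gen (F.gen x), by
    intro x i hi α
    rw [G.bd_gen, F.bd_gen]; rfl⟩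

/-- The forgetful functor `W_n`, sending a cubical `(n + 1)`-category to its underlying cubical
`n`-category together with its `(n + 1)`-cells, viewed as a cubical extension. -/
@[reducible] def W (n : ℕ) : CubCat.{u} (n + 1) ⥤ CubExt.{u} n where
  obj D :=
    { base := (trunc n).obj D
      ext :=
        { gen := D.cell (n + 1) le_rfl
          bd := fun x i hi α => D.face i α x hi
          bd_square := by
            intro x
            cases n with
            | zero => trivial
            | succ k =>
              intro i j hij hj α β
              exact D.face_face i j hij hj α β x } }
  map F := ⟨(trunc n).map F, fun x => F.map x, fun x i hi α => (F.map_face i hi α x).symm⟩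

/-! ### The syntax of typed expressions -/

/-- The family of faces that `ε_i c` has to have. -/
def CubData.degShell {n : ℕ} (C : CubData.{u} n) :
    ∀ {k : ℕ} {hk : k ≤ n} (i : ℕ) (_ : i ≤ k) (_ : C.cell k hk), C.Shell k hk
  | 0, _, _, _, c => fun _ _ _ => c
  | _ + 1, hk, i, _, c => fun j _ α =>
      if _ : i < j then C.deg hk i (C.face (j - 1) α c)
      else if _ : j < i then C.deg hk (i - 1) (C.face j α c)
      else c

/-- The family of faces that `Γ_i^α c` has to have. -/
def CubData.connShell {n : ℕ} (C : CubData.{u} n) :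
    ∀ {k : ℕ} {hk : k ≤ n} (i : ℕ) (_ : i < k) (_ : Bool) (_ : C.cell k hk), C.Shell k hk
  | 0, _, _, _, _, c => fun _ _ _ => c
  | 1, hk, i, _, α, c => fun _ _ β => if α = β then c else C.deg hk i (C.face i β c)
  | _ + 2, hk, i, _, α, c => fun j _ β =>
      if _ : i + 1 < j then C.conn hk i α (C.face (j - 1) β c)
      else if _ : j < i then C.conn hk (i - 1) α (C.face j β c)
      else if α = β then c else C.deg hk i (C.face i β c)

/-- `C.IsCompShell i S T U`: the shell `U` is the family of faces that the `∘_i`-composite of two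
cells with shells `S` and `T` has to have. -/
def CubData.IsCompShell {n : ℕ} (C : CubData.{u} n) :
    ∀ {k : ℕ} {hk : k ≤ n} (i : ℕ) (_ : i ≤ k) (_ _ _ : C.Shell k hk), Prop
  | 0, _, i, hi, S, T, U => U i hi false = S i hi false ∧ U i hi true = T i hi true
  | k + 1, _, i, hi, S, T, U => U i hi false = S i hi false ∧ U i hi true = T i hi true ∧
      ∀ (j : ℕ) (hj : j ≤ k + 1) (α : Bool),
        (∀ _ : i < j, ∃ h : C.face i true (S j hj α) = C.face i false (T j hj α),
          C.comp i _ (S j hj α) (T j hj α) h = U j hj α) ∧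
        (∀ _ : j < i, ∃ h : C.face (i - 1) true (S j hj α) = C.face (i - 1) false (T j hj α),
          C.comp (i - 1) _ (S j hj α) (T j hj α) h = U j hj α)

/-- Identification of `k`-cells and `l`-cells if `k = l`. -/
def CubData.cast {n : ℕ} (C : CubData.{u} n) {k l : ℕ} {hk : k ≤ n} {hl : l ≤ n} (e : k = l)
    (c : C.cell k hk) : C.cell l hl :=
  e ▸ c

section Expressions

variable {n : ℕ} (E : CubExt.{u} n)

/-- Formal expressions: constants `c_x`, `e_{i,c}`, `g_{i,c}^α` and binary symbols `∘_i`. -/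
inductive Expr : Type u
  | gen (x : E.ext.gen) : Expr
  | deg (i : ℕ) (hi : i ≤ n) (c : E.base.cell n le_rfl) : Expr
  | conn (i : ℕ) (hi : i < n) (α : Bool) (c : E.base.cell n le_rfl) : Expr
  | comp (i : ℕ) (hi : i ≤ n) (A B : Expr) : Expr

variable {E}

/-- The typing judgement `A : S`. -/
inductive HasType : Expr E → E.base.Shell n le_rfl → Prop
  | gen (x : E.ext.gen) : HasType (.gen x) (E.ext.bd x)
  | deg (i : ℕ) (hi : i ≤ n) (c : E.base.cell n le_rfl) :
      HasType (.deg i hi c) (E.base.degShell i hi c)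
  | conn (i : ℕ) (hi : i < n) (α : Bool) (c : E.base.cell n le_rfl) :
      HasType (.conn i hi α c) (E.base.connShell i hi α c)
  | comp (i : ℕ) (hi : i ≤ n) {A B : Expr E} {S T U : E.base.Shell n le_rfl}
      (hA : HasType A S) (hB : HasType B T) (hST : S i hi true = T i hi false)
      (hU : E.base.IsCompShell i hi S T U) : HasType (.comp i hi A B) U

/-- Typable expressions. -/
def Typable (A : Expr E) : Prop := ∃ S, HasType A S

/-- The relation of being `∘_i`-composable, for typable expressions. -/
def Composable (i : ℕ) (hi : i ≤ n) (A B : Expr E) : Prop :=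
  ∃ S T, HasType A S ∧ HasType B T ∧ S i hi true = T i hi false

/-- The congruence on typable expressions generated by the axioms of cubical categories. -/
inductive Cong : Expr E → Expr E → Prop
  -- closure under the rules of a congruence
  | refl {A : Expr E} (hA : Typable A) : Cong A A
  | symm {A B : Expr E} (h : Cong A B) : Cong B A
  | trans {A B C : Expr E} (h : Cong A B) (h' : Cong B C) : Cong A C
  | comp (i : ℕ) (hi : i ≤ n) {A A' B B' : Expr E} (hA : Cong A A') (hB : Cong B B')
      (h : Composable i hi A B) (h' : Composable i hi A' B') :
      Cong (.comp i hi A B) (.comp i hi A' B')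
  -- associativity, interchange and units
  | assoc (i : ℕ) (hi : i ≤ n) {A B C : Expr E} (h : Composable i hi A B)
      (h' : Composable i hi B C) :
      Cong (.comp i hi A (.comp i hi B C)) (.comp i hi (.comp i hi A B) C)
  | interchange (i j : ℕ) (hij : i < j) (hj : j ≤ n) {A B C D : Expr E}
      (hAB : Composable i (by omega) A B) (hCD : Composable i (by omega) C D)
      (hAC : Composable j hj A C) (hBD : Composable j hj B D) :
      Cong (.comp j hj (.comp i (by omega) A B) (.comp i (by omega) C D))
        (.comp i (by omega) (.comp j hj A C) (.comp j hj B D))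
  | deg_comp_self (i : ℕ) (hi : i ≤ n) {A : Expr E} {S : E.base.Shell n le_rfl}
      (hA : HasType A S) : Cong (.comp i hi (.deg i hi (S i hi false)) A) A
  | comp_deg (i : ℕ) (hi : i ≤ n) {A : Expr E} {S : E.base.Shell n le_rfl}
      (hA : HasType A S) : Cong (.comp i hi A (.deg i hi (S i hi true))) A
  -- degeneracies of composites and of degeneracies
  | deg_comp_le (i j : ℕ) (hij : i ≤ j) {m : ℕ} (e : m + 1 = n) (hj : j ≤ m)
      (c d : E.base.cell (m + 1) e.le) (h : E.base.face j true c = E.base.face j false d) :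
      Cong (.deg i (by omega) (E.base.cast e (E.base.comp j hj c d h)))
        (.comp (j + 1) (by omega) (.deg i (by omega) (E.base.cast e c))
          (.deg i (by omega) (E.base.cast e d)))
  | deg_comp_gt (i j : ℕ) (hij : j < i) (hi : i ≤ n) {m : ℕ} (e : m + 1 = n) (hj : j ≤ m)
      (c d : E.base.cell (m + 1) e.le) (h : E.base.face j true c = E.base.face j false d) :
      Cong (.deg i hi (E.base.cast e (E.base.comp j hj c d h)))
        (.comp j (by omega) (.deg i hi (E.base.cast e c)) (.deg i hi (E.base.cast e d)))
  | deg_deg (i j : ℕ) (hij : i ≤ j) {m : ℕ} (e : m + 1 = n) (hj : j ≤ m)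
      (c : E.base.cell m (by omega)) :
      Cong (.deg i (by omega) (E.base.cast e (E.base.deg e.le j c)))
        (.deg (j + 1) (by omega) (E.base.cast e (E.base.deg e.le i c)))
  -- connections of composites
  | conn_comp_lt (i j : ℕ) (hij : i < j) (α : Bool) {m : ℕ} (e : m + 1 = n) (hj : j ≤ m)
      (c d : E.base.cell (m + 1) e.le) (h : E.base.face j true c = E.base.face j false d) :
      Cong (.conn i (by omega) α (E.base.cast e (E.base.comp j hj c d h)))
        (.comp (j + 1) (by omega) (.conn i (by omega) α (E.base.cast e c))
          (.conn i (by omega) α (E.base.cast e d)))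
  | conn_comp_lower (i : ℕ) {m : ℕ} (e : m + 1 = n) (hi : i ≤ m)
      (c d : E.base.cell (m + 1) e.le) (h : E.base.face i true c = E.base.face i false d) :
      Cong (.conn i (by omega) false (E.base.cast e (E.base.comp i hi c d h)))
        (.comp (i + 1) (by omega)
          (.comp i (by omega) (.conn i (by omega) false (E.base.cast e c))
            (.deg (i + 1) (by omega) (E.base.cast e d)))
          (.comp i (by omega) (.deg i (by omega) (E.base.cast e d))
            (.conn i (by omega) false (E.base.cast e d))))
  | conn_comp_upper (i : ℕ) {m : ℕ} (e : m + 1 = n) (hi : i ≤ m)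
      (c d : E.base.cell (m + 1) e.le) (h : E.base.face i true c = E.base.face i false d) :
      Cong (.conn i (by omega) true (E.base.cast e (E.base.comp i hi c d h)))
        (.comp (i + 1) (by omega)
          (.comp i (by omega) (.conn i (by omega) true (E.base.cast e c))
            (.deg i (by omega) (E.base.cast e c)))
          (.comp i (by omega) (.deg (i + 1) (by omega) (E.base.cast e c))
            (.conn i (by omega) true (E.base.cast e d))))
  | conn_comp_gt (i j : ℕ) (hij : j < i) {m : ℕ} (e : m + 1 = n) (hi : i ≤ m) (α : Bool)
      (c d : E.base.cell (m + 1) e.le) (h : E.base.face j true c = E.base.face j false d) :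
      Cong (.conn i (by omega) α (E.base.cast e (E.base.comp j (by omega) c d h)))
        (.comp j (by omega) (.conn i (by omega) α (E.base.cast e c))
          (.conn i (by omega) α (E.base.cast e d)))
  -- composites of opposite connections
  | conn_comp_conn (i : ℕ) (hi : i < n) (c : E.base.cell n le_rfl) :
      Cong (.comp i (by omega) (.conn i hi true c) (.conn i hi false c))
        (.deg (i + 1) (by omega) c)
  | conn_comp_conn_succ (i : ℕ) (hi : i < n) (c : E.base.cell n le_rfl) :
      Cong (.comp (i + 1) (by omega) (.conn i hi true c) (.conn i hi false c))
        (.deg i (by omega) c)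
  -- connections of degeneracies and of connections
  | conn_deg_lt (i j : ℕ) (hij : i < j) (α : Bool) {m : ℕ} (e : m + 2 = n) (hj : j ≤ m + 1)
      (c : E.base.cell (m + 1) (by omega)) :
      Cong (.conn i (by omega) α (E.base.cast e (E.base.deg e.le j c)))
        (.deg (j + 1) (by omega) (E.base.cast e (E.base.conn e.le i α c)))
  | conn_deg_eq (i : ℕ) (α : Bool) {m : ℕ} (e : m + 1 = n) (hi : i ≤ m)
      (c : E.base.cell m (by omega)) :
      Cong (.conn i (by omega) α (E.base.cast e (E.base.deg e.le i c)))
        (.deg i (by omega) (E.base.cast e (E.base.deg e.le i c)))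
  | conn_deg_gt (i j : ℕ) (hij : j < i) (α : Bool) {m : ℕ} (e : m + 2 = n) (hi : i ≤ m + 1)
      (c : E.base.cell (m + 1) (by omega)) :
      Cong (.conn i (by omega) α (E.base.cast e (E.base.deg e.le j c)))
        (.deg j (by omega) (E.base.cast e (E.base.conn e.le (i - 1) α c)))
  | conn_conn_lt (i j : ℕ) (hij : i < j) (α β : Bool) {m : ℕ} (e : m + 2 = n) (hj : j ≤ m)
      (c : E.base.cell (m + 1) (by omega)) :
      Cong (.conn i (by omega) α (E.base.cast e (E.base.conn e.le j β c)))
        (.conn (j + 1) (by omega) β (E.base.cast e (E.base.conn e.le i α c)))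
  | conn_conn_eq (i : ℕ) (α : Bool) {m : ℕ} (e : m + 2 = n) (hi : i ≤ m)
      (c : E.base.cell (m + 1) (by omega)) :
      Cong (.conn i (by omega) α (E.base.cast e (E.base.conn e.le i α c)))
        (.conn (i + 1) (by omega) α (E.base.cast e (E.base.conn e.le i α c)))

variable (E)

/-- Typable expressions modulo the congruence. -/
def FreeCell : Type u := Quot fun A B : {A : Expr E // Typable A} => Cong A.1 B.1

variable {E}

/-- The class of a typable expression. -/
def FreeCell.mk (A : Expr E) (hA : Typable A) : FreeCell E := Quot.mk _ ⟨A, hA⟩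

/-- The cubical `(n + 1)`-category `D`, with the morphism `η` from `E` to the cubical extension
underlying `D`, is the syntactic one: the `k`-cells of `D` are those of the base of `E` for
`k ≤ n`, the `(n + 1)`-cells of `D` are the typable expressions modulo the congruence, and their
faces, degeneracies, connections and composites are induced by the types and by the formal
symbols. -/
def IsSyntactic (E : CubExt.{u} n) (D : CubCat.{u} (n + 1)) (η : E ⟶ (W n).obj D) : Prop :=
  IsIso η.base ∧
  ∃ Φ : FreeCell E ≃ D.cell (n + 1) le_rfl,
    (∀ (A : Expr E) (S : E.base.Shell n le_rfl) (hA : HasType A S) (i : ℕ) (hi : i ≤ n)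
      (α : Bool), D.face i α (Φ (.mk A ⟨S, hA⟩)) = η.base.map (S i hi α)) ∧
    (∀ x : E.ext.gen, Φ (.mk (.gen x) ⟨_, .gen x⟩) = η.gen x) ∧
    (∀ (i : ℕ) (hi : i ≤ n) (c : E.base.cell n le_rfl),
      Φ (.mk (.deg i hi c) ⟨_, .deg i hi c⟩) = D.deg le_rfl i (η.base.map c)) ∧
    (∀ (i m : ℕ) (e : m + 1 = n) (hi : i ≤ m) (α : Bool) (c : E.base.cell (m + 1) e.le),
      Φ (.mk (.conn i (by omega) α (E.base.cast e c)) ⟨_, .conn i (by omega) α _⟩) =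
        D.cast (by omega) (D.conn (by omega) i α (η.base.map c))) ∧
    (∀ (i : ℕ) (hi : i ≤ n) (A B : Expr E) (hA : Typable A) (hB : Typable B),
      Composable i hi A B → ∃ (hAB : Typable (.comp i hi A B))
        (h : D.face i true (Φ (.mk A hA)) = D.face i false (Φ (.mk B hB))),
        Φ (.mk (.comp i hi A B) hAB) = D.comp i hi (Φ (.mk A hA)) (Φ (.mk B hB)) h)

end Expressions

/-! ### Cubical `(n, p)`-categories -/

/-- `R_i`-invertible cells. -/
def CubData.IsRInvertible {n : ℕ} (C : CubData.{u} n) {k : ℕ} {hk : k + 1 ≤ n} (i : ℕ)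
    (hi : i ≤ k) (a : C.cell (k + 1) hk) : Prop :=
  ∃ b h h', C.comp i hi a b h = C.deg hk i (C.face i false a) ∧
    C.comp i hi b a h' = C.deg hk i (C.face i true a)

/-- Cells with an `R_i`-invertible shell: the faces in the other directions are invertible (no
condition for a `1`-cell). -/
def CubData.HasRInvertibleShell {n : ℕ} (C : CubData.{u} n) :
    ∀ {k : ℕ} {hk : k + 1 ≤ n} (i : ℕ) (_ : i ≤ k) (_ : C.cell (k + 1) hk), Prop
  | 0, _, _, _, _ => True
  | k + 1, _, i, _, a => ∀ (j : ℕ) (hj : j ≤ k + 1) (α : Bool),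
      (∀ _ : j < i, C.IsRInvertible (i - 1) (by omega) (C.face j α a)) ∧
      (∀ _ : i < j, C.IsRInvertible i (by omega) (C.face j α a))

/-- Cubical `(n, p)`-categories: for `k > p`, every `k`-cell with an `R_i`-invertible shell is
`R_i`-invertible. The cubical `n`-groupoids are the case `p = 0`. -/
def isNP (n p : ℕ) : ObjectProperty (CubCat.{u} n) := fun C =>
  ∀ (k : ℕ) (hk : k + 1 ≤ n), p < k + 1 → ∀ (i : ℕ) (hi : i ≤ k) (a : C.cell (k + 1) hk),
    C.HasRInvertibleShell i hi a → C.IsRInvertible i hi a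

/-- The category of cubical `(n, p)`-categories. -/
abbrev CubNPCat (n p : ℕ) := (isNP.{u} n p).FullSubcategory

/-- The property that the base of a cubical extension is a cubical `(n, p)`-category. -/
def isNPExt (n p : ℕ) : ObjectProperty (CubExt.{u} n) := fun E => isNP n p E.base

/-- Cubical `(n, p)`-categories equipped with a cubical extension. -/
abbrev CubNPExt (n p : ℕ) := (isNPExt.{u} n p).FullSubcategory

lemma isNP_trunc {n p : ℕ} {D : CubCat.{u} (n + 1)} (hD : isNP (n + 1) p D) :
    isNP n p ((trunc n).obj D) := by
  intro k hk hp i hi a ha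
  refine hD k (Nat.le_succ_of_le hk) hp i hi a ?_
  cases k with
  | zero => trivial
  | succ k => exact ha

/-- The forgetful functor `W_{(n,p)}`. -/
@[reducible] def WNP (n p : ℕ) : CubNPCat.{u} (n + 1) p ⥤ CubNPExt.{u} n p :=
  (isNPExt n p).lift ((isNP (n + 1) p).ι ⋙ W n) fun D => isNP_trunc D.property

/-! ### Cubical polygraphs -/

/-- Pairs of an object `X` of `P` and a cubical extension of `F X`: the pullback of `F` and of the
functor sending a cubical extension to its base. -/
structure PolStep {n : ℕ} {P : Type (u + 1)} [Category.{u} P] (F : P ⥤ CubCat.{u} n) where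
  base : P
  ext : Extension (F.obj base)

/-- Morphisms of such pairs. -/
@[ext]
structure PolStepHom {n : ℕ} {P : Type (u + 1)} [Category.{u} P] {F : P ⥤ CubCat.{u} n}
    (X Y : PolStep F) where
  base : X.base ⟶ Y.base
  gen : X.ext.gen → Y.ext.gen
  bd_gen : ∀ x i hi α, Y.ext.bd (gen x) i hi α = (F.map base).map (X.ext.bd x i hi α)

instance {n : ℕ} {P : Type (u + 1)} [Category.{u} P] (F : P ⥤ CubCat.{u} n) :
    Category.{u} (PolStep F) where
  Hom X Y := PolStepHom X Y
  id X := ⟨𝟙 X.base, fun x => x, by intros; rw [F.map_id]; rfl⟩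
  comp f g := ⟨f.base ≫ g.base, fun x => g.gen (f.gen x), by
    intro x i hi α
    rw [g.bd_gen, f.bd_gen, F.map_comp]; rfl⟩

/-- The projection of the pullback to cubical extensions. -/
@[reducible] def PolStep.toExt {n : ℕ} {P : Type (u + 1)} [Category.{u} P] (F : P ⥤ CubCat.{u} n) :
    PolStep F ⥤ CubExt.{u} n where
  obj X := ⟨F.obj X.base, X.ext⟩
  map f := ⟨F.map f.base, f.gen, f.bd_gen⟩
  map_id X := CubExtHom.ext (F.map_id X.base) rfl
  map_comp f g := CubExtHom.ext (F.map_comp f.base g.base) rfl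

/-- The projection of the pullback to cubical extensions of cubical `(n, p)`-categories. -/
@[reducible] def PolStep.toNPExt {n p : ℕ} {P : Type (u + 1)} [Category.{u} P] (F : P ⥤ CubNPCat.{u} n p) :
    PolStep (F ⋙ (isNP n p).ι) ⥤ CubNPExt.{u} n p :=
  (isNPExt n p).lift (PolStep.toExt (F ⋙ (isNP n p).ι)) fun X => (F.obj X.base).property

/-- A set, viewed as a cubical `0`-category. -/
@[reducible] def ofSet : Type u ⥤ CubCat.{u} 0 where
  obj S :=
    { cell := fun _ _ => S
      face := by intro k hk; omega
      deg := by intro k hk; omega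
      comp := by intro k hk; omega
      conn := by intro k hk; omega
      face_face := by intro k hk; omega
      face_deg_lt := by intro k hk; omega
      face_deg_eq := by intro k hk; omega
      face_deg_gt := by intro k hk; omega
      deg_deg := by intro k hk; omega
      face_comp_lt := by intro k hk; omega
      face_comp_lower := by intro k hk; omega
      face_comp_upper := by intro k hk; omega
      face_comp_gt := by intro k hk; omega
      comp_assoc := by intro k hk; omega
      interchange := by intro k hk; omega
      comp_deg := by intro k hk; omega
      deg_comp_self := by intro k hk; omega
      deg_comp_le := by intro k hk; omega
      deg_comp_gt := by intro k hk; omega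
      face_conn_lt := by intro k hk; omega
      face_conn_same := by intro k hk; omega
      face_conn_opp := by intro k hk; omega
      face_conn_gt := by intro k hk; omega
      conn_deg_lt := by intro k hk; omega
      conn_deg_eq := by intro k hk; omega
      conn_deg_gt := by intro k hk; omega
      conn_conn_lt := by intro k hk; omega
      conn_conn_eq := by intro k hk; omega
      conn_comp_conn := by intro k hk; omega
      conn_comp_conn_succ := by intro k hk; omega
      conn_comp_lt := by intro k hk; omega
      conn_comp_lower := by intro k hk; omega
      conn_comp_upper := by intro k hk; omega
      conn_comp_gt := by intro k hk; omega }
  map f :=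
    { map := f
      map_face := by intro k hk; omega
      map_deg := by intro k hk; omega
      map_comp := by intro k hk; omega
      map_conn := by intro k hk; omega }

/-- A category with a functor to `B`. -/
structure CatOver (B : Type (u + 1)) [Category.{u} B] where
  P : Type (u + 1)
  [cat : Category.{u} P]
  F : P ⥤ B

attribute [instance] CatOver.cat

/-- The category of cubical `n`-polygraphs, with the functor sending a cubical `n`-polygraph to the
cubical `n`-category it generates, relative to given functors `L n`. -/
def polygraphs (L : ∀ n, CubExt.{u} n ⥤ CubCat.{u} (n + 1)) : ∀ n, CatOver (CubCat.{u} n)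
  | 0 => { P := Type u, F := ofSet }
  | n + 1 =>
    { P := PolStep (polygraphs L n).F
      F := PolStep.toExt (polygraphs L n).F ⋙ L n }

/-- The category of cubical `(n, p)`-polygraphs, with the functor sending a cubical
`(n, p)`-polygraph to the cubical `(n, p)`-category it generates, relative to given functors
`L n`. -/
def polygraphsNP (p : ℕ) (L : ∀ n, CubNPExt.{u} n p ⥤ CubNPCat.{u} (n + 1) p) :
    ∀ n, CatOver (CubNPCat.{u} n p)
  | 0 => { P := Type u, F := (isNP 0 p).lift ofSet (by intro S k hk; omega) }
  | n + 1 =>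
    { P := PolStep ((polygraphsNP p L n).F ⋙ (isNP n p).ι)
      F := PolStep.toNPExt (polygraphsNP p L n).F ⋙ L n }

/-- `D` is freely generated by the cubical extension `E` among the cubical `(n + 1)`-categories with
property `Q`, through `η`: the `n`-truncation of `D` is the base of `E`, and every morphism from `E`
to the cubical extension underlying some `D'` with property `Q` extends uniquely to a functor from
`D` to `D'`. -/
def IsFreelyGenerated {n : ℕ} (Q : ObjectProperty (CubCat.{u} (n + 1))) (E : CubExt.{u} n)
    (D : CubCat.{u} (n + 1)) (η : E ⟶ (W n).obj D) : Prop :=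
  IsIso η.base ∧ Q D ∧
    ∀ D' : CubCat.{u} (n + 1), Q D' → ∀ φ : E ⟶ (W n).obj D',
      ∃! f : D ⟶ D', η ≫ (W n).map f = φ

end Cub

namespace Cub

namespace CubCat

variable {n : ℕ} (C : CubCat.{u} n)

/-! ### The laws, with flexible indices -/

/-! Adding cells in dimension `n + 1` leaves a cubical `n`-category `C` untouched: what is added is
a set with a boundary map to the `n`-squares of `C`, with degeneracies, connections and composites
of prescribed boundary, subject to the axioms. Such a `Layer` over `C` amounts to a cubical `(n +
1)`-category with truncation `C` (`Layer.toCubCat`, `topLayer`). The left adjoint therefore reduces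
to a free layer on the generators, and its truncation is correct by construction
(`isFreelyGenerated_of_layer`).

The main computation is that the `n`-squares of `C` themselves form a layer, `cosk C`. Every axiom
for `(n + 1)`-cells has to be checked on boundaries: each face of its two sides agrees by an axiom
of `C` in lower dimension or by unit laws. Consequently typing an expression is evaluating it in
`cosk C`; types are unique, and congruent expressions have equal types.

A typable expression also has a value in every layer receiving a morphism from the extension
(`HasType.exists_eval`), and the congruence is sound for these values (`Cong.exists_eval`). The
classes of typable expressions form a layer because each law is one of the generating congruences;
evaluation is a morphism out of it, and the only one, since an expression evaluates in the free
layer to its own class (`eval_freeModel`).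

For `(n, p)`-categories formal inverses are added to the terms. Which inverses may be formed depends
on the boundary of the term, so there is no inductive typing: a term is admitted if it has a value
in all models whose layer inverts the cells with invertible shell (when `p < n + 1`), and terms are
identified if all these values agree. The laws then hold because they hold in the models. The
squares are such a model (`cosk_invertsShells`): an invertible shell is inverted by exchanging its
two faces in the given direction and inverting the others. This model supplies the boundaries. A
term with invertible shell is invertible in every model, so its formal inverse is admitted and does
invert it (`npLayer_invertsShells`).

Universal arrows assemble to left adjoints, and freeness of the categories generated by polygraphs
is the case of extensions that come from polygraphs. -/

theorem face_face_of_lt {k : ℕ} {hk : k + 2 ≤ n} {i j : ℕ} (hij : i < j) (hj : j ≤ k + 1)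
    (α β : Bool) (x : C.cell (k + 2) hk) :
    C.face i α (C.face j β x) = C.face (j - 1) β (C.face i α x) := by
  obtain ⟨j, rfl⟩ : ∃ l, j = l + 1 := ⟨j - 1, by omega⟩
  exact C.face_face i j (by omega) (by omega) α β x

/-- An inequality as side condition, instead of an index of the form `j + 1`, lets `simp (disch :=
omega)` apply the law to arbitrary indices; the price is the truncated subtraction `j - 1`. -/
theorem face_deg_of_lt {k : ℕ} (hk : k + 2 ≤ n) {i j : ℕ} (hij : i < j) (hj : j ≤ k + 1)
    (α : Bool) (x : C.cell (k + 1) (Nat.le_of_succ_le hk)) :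
    C.face i α (C.deg hk j x) = C.deg (Nat.le_of_succ_le hk) (j - 1) (C.face i α x) := by
  obtain ⟨j, rfl⟩ : ∃ l, j = l + 1 := ⟨j - 1, by omega⟩
  exact C.face_deg_lt hk i j (by omega) (by omega) α x

theorem face_deg_of_gt {k : ℕ} (hk : k + 2 ≤ n) {i j : ℕ} (hij : j < i) (hi : i ≤ k + 1)
    (α : Bool) (x : C.cell (k + 1) (Nat.le_of_succ_le hk)) :
    C.face i α (C.deg hk j x) = C.deg (Nat.le_of_succ_le hk) j (C.face (i - 1) α x) := by
  obtain ⟨i, rfl⟩ : ∃ l, i = l + 1 := ⟨i - 1, by omega⟩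
  exact C.face_deg_gt hk i j (by omega) (by omega) α x

theorem face_conn_of_lt {k : ℕ} (hk : k + 3 ≤ n) {i j : ℕ} (hij : i < j) (hj : j ≤ k + 1)
    (α β : Bool) (x : C.cell (k + 2) (Nat.le_of_succ_le hk)) :
    C.face i α (C.conn hk j β x) = C.conn (Nat.le_of_succ_le hk) (j - 1) β (C.face i α x) := by
  obtain ⟨j, rfl⟩ : ∃ l, j = l + 1 := ⟨j - 1, by omega⟩
  exact C.face_conn_lt hk i j (by omega) (by omega) α β x

theorem face_conn_of_gt {k : ℕ} (hk : k + 3 ≤ n) {i j : ℕ} (hij : j + 1 < i) (hi : i ≤ k + 2)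
    (α β : Bool) (x : C.cell (k + 2) (Nat.le_of_succ_le hk)) :
    C.face i α (C.conn hk j β x) = C.conn (Nat.le_of_succ_le hk) j β (C.face (i - 1) α x) := by
  obtain ⟨i, rfl⟩ : ∃ l, i = l + 1 := ⟨i - 1, by omega⟩
  exact C.face_conn_gt hk i j (by omega) (by omega) α β x

theorem face_conn_mid {k : ℕ} (hk : k + 2 ≤ n) {i j : ℕ} (hij : j ≤ i) (hij' : i ≤ j + 1)
    (hj : j ≤ k) (α β : Bool) (x : C.cell (k + 1) (Nat.le_of_succ_le hk)) :
    C.face i α (C.conn hk j β x) =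
      if β = α then x else C.deg (Nat.le_of_succ_le hk) j (C.face j α x) := by
  split_ifs with h
  · subst h; exact C.face_conn_same hk i j (by omega) hj β x
  · obtain rfl : β = !α := by cases α <;> cases β <;> simp_all
    exact C.face_conn_opp hk i j (by omega) hj α x

theorem deg_deg_of_le {k : ℕ} (hk : k + 2 ≤ n) {i j : ℕ} (hij : i ≤ j) (hj : j ≤ k)
    (x : C.cell k (Nat.le_of_succ_le (Nat.le_of_succ_le hk))) :
    C.deg hk i (C.deg (Nat.le_of_succ_le hk) j x) =
      C.deg hk (j + 1) (C.deg (Nat.le_of_succ_le hk) i x) :=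
  C.deg_deg hk i j hij hj x

theorem conn_deg_of_gt {k : ℕ} (hk : k + 3 ≤ n) {i j : ℕ} (hij : j < i) (hi : i ≤ k + 1)
    (α : Bool) (x : C.cell (k + 1) (Nat.le_of_succ_le (Nat.le_of_succ_le hk))) :
    C.conn hk i α (C.deg (Nat.le_of_succ_le hk) j x) =
      C.deg hk j (C.conn (Nat.le_of_succ_le hk) (i - 1) α x) := by
  obtain ⟨i, rfl⟩ : ∃ l, i = l + 1 := ⟨i - 1, by omega⟩
  exact C.conn_deg_gt hk i j (by omega) (by omega) α x

/-! ### Composition as a relation -/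

/-- The cells `a` and `b` are `∘_i`-composable with composite `c`. -/
def Rel {k : ℕ} {hk : k + 1 ≤ n} (i : ℕ) (a b c : C.cell (k + 1) hk) : Prop :=
  ∃ (hi : i ≤ k) (h : C.face i true a = C.face i false b), C.comp i hi a b h = c

variable {C}

namespace Rel

section

variable {k : ℕ} {hk : k + 1 ≤ n} {i j : ℕ} {a b c : C.cell (k + 1) hk}

theorem composable (h : C.Rel i a b c) (_ : i ≤ k) : C.face i true a = C.face i false b := h.2.1

theorem mk' (hi : i ≤ k) (h : C.face i true a = C.face i false b) :
    C.Rel i a b (C.comp i hi a b h) := ⟨hi, h, rfl⟩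

/-- Composition is a partial function. Equality of two composites is thus obtained from two
relations with the same operands, without transporting proofs of composability. -/
theorem unique {c' : C.cell (k + 1) hk} (h : C.Rel i a b c) (h' : C.Rel i a b c') : c = c' := by
  obtain ⟨_, _, rfl⟩ := h
  obtain ⟨_, _, rfl⟩ := h'
  rfl

theorem lower (h : C.Rel i a b c) (hi : i ≤ k) : C.face i false c = C.face i false a := by
  obtain ⟨_, _, rfl⟩ := h
  exact C.face_comp_lower _ _ _ _ _

theorem upper (h : C.Rel i a b c) (hi : i ≤ k) : C.face i true c = C.face i true b := by
  obtain ⟨_, _, rfl⟩ := h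
  exact C.face_comp_upper _ _ _ _ _

theorem assoc {d bc x y : C.cell (k + 1) hk} (hab : C.Rel i a b c) (hbc : C.Rel i b d bc)
    (hx : C.Rel i a bc x) (hy : C.Rel i c d y) : x = y := by
  obtain ⟨_, _, rfl⟩ := hab
  obtain ⟨_, _, rfl⟩ := hbc
  obtain ⟨_, _, rfl⟩ := hx
  obtain ⟨_, _, rfl⟩ := hy
  exact C.comp_assoc ..

theorem interchange (hij : i ≠ j) {d x y z w u v : C.cell (k + 1) hk} (hab : C.Rel i a b x)
    (hcd : C.Rel i c d y) (hac : C.Rel j a c z) (hbd : C.Rel j b d w) (hu : C.Rel j x y u)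
    (hv : C.Rel i z w v) : u = v := by
  obtain ⟨_, _, rfl⟩ := hab
  obtain ⟨_, _, rfl⟩ := hcd
  obtain ⟨_, _, rfl⟩ := hac
  obtain ⟨_, _, rfl⟩ := hbd
  obtain ⟨_, _, rfl⟩ := hu
  obtain ⟨_, _, rfl⟩ := hv
  exact C.interchange _ _ hij ..

theorem deg_left (hi : i ≤ k) (a : C.cell (k + 1) hk) :
    C.Rel i (C.deg hk i (C.face i false a)) a a :=
  ⟨hi, C.face_deg_eq hk i hi _ _, C.deg_comp_self i hi a _⟩

theorem deg_right (hi : i ≤ k) (a : C.cell (k + 1) hk) :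
    C.Rel i a (C.deg hk i (C.face i true a)) a :=
  ⟨hi, (C.face_deg_eq hk i hi _ _).symm, C.comp_deg i hi a _⟩

theorem deg_left' (hi : i ≤ k) {x : C.cell k (Nat.le_of_succ_le hk)} {a : C.cell (k + 1) hk}
    (h : C.face i false a = x) : C.Rel i (C.deg hk i x) a a := h ▸ deg_left hi a

theorem deg_right' (hi : i ≤ k) {x : C.cell k (Nat.le_of_succ_le hk)} {a : C.cell (k + 1) hk}
    (h : C.face i true a = x) : C.Rel i a (C.deg hk i x) a := h ▸ deg_right hi a

end

section

variable {k : ℕ} {hk : k + 2 ≤ n} {i j : ℕ} {a b c : C.cell (k + 2) hk}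

/-- The cubical relations carry composability to the faces. Removing a direction below `j` renumbers
`j` as `j - 1`. -/
theorem face_lt (h : C.Rel j a b c) (hij : i < j) (hi : i ≤ k + 1) (α : Bool) :
    C.Rel (j - 1) (C.face i α a) (C.face i α b) (C.face i α c) := by
  obtain ⟨hj, h, rfl⟩ := h
  obtain ⟨j, rfl⟩ : ∃ l, j = l + 1 := ⟨j - 1, by omega⟩
  have h' : C.face j true (C.face i α a) = C.face j false (C.face i α b) := by
    rw [← C.face_face i j (by omega) (by omega), h, C.face_face i j (by omega) (by omega)]
  exact ⟨by omega, h', (C.face_comp_lt i j (by omega) (by omega) α a b h h').symm⟩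

theorem face_gt (h : C.Rel j a b c) (hij : j < i) (hi : i ≤ k + 1) (α : Bool) :
    C.Rel j (C.face i α a) (C.face i α b) (C.face i α c) := by
  obtain ⟨hj, h, rfl⟩ := h
  obtain ⟨i, rfl⟩ : ∃ l, i = l + 1 := ⟨i - 1, by omega⟩
  have h' : C.face j true (C.face (i + 1) α a) = C.face j false (C.face (i + 1) α b) := by
    rw [C.face_face j i (by omega) (by omega), h, C.face_face j i (by omega) (by omega)]
  exact ⟨by omega, h', (C.face_comp_gt i j (by omega) (by omega) α a b h h').symm⟩

end

section

variable {k : ℕ} {hk : k + 2 ≤ n} {i j : ℕ} {a b c : C.cell (k + 1) (Nat.le_of_succ_le hk)}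

theorem deg_le (h : C.Rel j a b c) (hij : i ≤ j) (hi : i ≤ k + 1) :
    C.Rel (j + 1) (C.deg hk i a) (C.deg hk i b) (C.deg hk i c) := by
  obtain ⟨hj, h, rfl⟩ := h
  have h' : C.face (j + 1) true (C.deg hk i a) = C.face (j + 1) false (C.deg hk i b) := by
    rw [C.face_deg_gt hk j i hij hj, h, C.face_deg_gt hk j i hij hj]
  exact ⟨by omega, h', (C.deg_comp_le hk i j hij hj a b h h').symm⟩

theorem deg_gt (h : C.Rel j a b c) (hij : j < i) (hi : i ≤ k + 1) :
    C.Rel j (C.deg hk i a) (C.deg hk i b) (C.deg hk i c) := by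
  obtain ⟨hj, h, rfl⟩ := h
  have h' : C.face j true (C.deg hk i a) = C.face j false (C.deg hk i b) := by
    rw [C.face_deg_of_lt hk hij hi, h, C.face_deg_of_lt hk hij hi]
  exact ⟨by omega, h', (C.deg_comp_gt hk i j hij hi a b h h').symm⟩

theorem conn_lt (h : C.Rel j a b c) (hij : i < j) (hi : i ≤ k) (α : Bool) :
    C.Rel (j + 1) (C.conn hk i α a) (C.conn hk i α b) (C.conn hk i α c) := by
  obtain ⟨hj, h, rfl⟩ := h
  obtain ⟨k, rfl⟩ : ∃ l, k = l + 1 := ⟨k - 1, by omega⟩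
  have h' : C.face (j + 1) true (C.conn hk i α a) = C.face (j + 1) false (C.conn hk i α b) := by
    rw [C.face_conn_gt hk j i hij hj, h, C.face_conn_gt hk j i hij hj]
  exact ⟨by omega, h', (C.conn_comp_lt hk i j hij hj α a b h h').symm⟩

theorem conn_gt (h : C.Rel j a b c) (hij : j < i) (hi : i ≤ k) (α : Bool) :
    C.Rel j (C.conn hk i α a) (C.conn hk i α b) (C.conn hk i α c) := by
  obtain ⟨hj, h, rfl⟩ := h
  obtain ⟨k, rfl⟩ : ∃ l, k = l + 1 := ⟨k - 1, by omega⟩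
  have h' : C.face j true (C.conn hk i α a) = C.face j false (C.conn hk i α b) := by
    rw [C.face_conn_of_lt hk hij hi, h, C.face_conn_of_lt hk hij hi]
  exact ⟨by omega, h', (C.conn_comp_gt hk i j hij hi α a b h h').symm⟩

/-- The law expresses a connection of a composite as a two by two grid. Naming the rows `x` and `y`
replaces its nested composability proofs by independent relations. -/
theorem conn_lower (h : C.Rel i a b c) (hi : i ≤ k) {x y z : C.cell (k + 2) hk}
    (hx : C.Rel i (C.conn hk i false a) (C.deg hk (i + 1) b) x)
    (hy : C.Rel i (C.deg hk i b) (C.conn hk i false b) y) (hz : C.Rel (i + 1) x y z) :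
    C.conn hk i false c = z := by
  obtain ⟨_, _, rfl⟩ := h
  obtain ⟨_, _, rfl⟩ := hx
  obtain ⟨_, _, rfl⟩ := hy
  obtain ⟨_, _, rfl⟩ := hz
  exact C.conn_comp_lower ..

theorem conn_upper (h : C.Rel i a b c) (hi : i ≤ k) {x y z : C.cell (k + 2) hk}
    (hx : C.Rel i (C.conn hk i true a) (C.deg hk i a) x)
    (hy : C.Rel i (C.deg hk (i + 1) a) (C.conn hk i true b) y) (hz : C.Rel (i + 1) x y z) :
    C.conn hk i true c = z := by
  obtain ⟨_, _, rfl⟩ := h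
  obtain ⟨_, _, rfl⟩ := hx
  obtain ⟨_, _, rfl⟩ := hy
  obtain ⟨_, _, rfl⟩ := hz
  exact C.conn_comp_upper ..

theorem conn_conn (hi : i ≤ k) (x : C.cell (k + 1) (Nat.le_of_succ_le hk)) :
    C.Rel i (C.conn hk i true x) (C.conn hk i false x) (C.deg hk (i + 1) x) := by
  have h : C.face i true (C.conn hk i true x) = C.face i false (C.conn hk i false x) := by
    rw [C.face_conn_same hk i i (by omega) hi, C.face_conn_same hk i i (by omega) hi]
  exact ⟨by omega, h, C.conn_comp_conn hk i hi x h⟩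

theorem conn_conn_succ (hi : i ≤ k) (x : C.cell (k + 1) (Nat.le_of_succ_le hk)) :
    C.Rel (i + 1) (C.conn hk i true x) (C.conn hk i false x) (C.deg hk i x) := by
  have h : C.face (i + 1) true (C.conn hk i true x) = C.face (i + 1) false (C.conn hk i false x) := by
    rw [C.face_conn_same hk (i + 1) i (by omega) hi, C.face_conn_same hk (i + 1) i (by omega) hi]
  exact ⟨by omega, h, C.conn_comp_conn_succ hk i hi x h⟩

end

end Rel

theorem rel_map {D : CubCat.{u} n} (F : C ⟶ D) {k : ℕ} {hk : k + 1 ≤ n} {i : ℕ}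
    {a b c : C.cell (k + 1) hk} (h : C.Rel i a b c) : D.Rel i (F.map a) (F.map b) (F.map c) := by
  obtain ⟨hi, h, rfl⟩ := h
  have h' : D.face i true (F.map a) = D.face i false (F.map b) := by
    rw [← F.map_face, h, F.map_face]
  exact ⟨hi, h', (F.map_comp i hi a b h h').symm⟩

end CubCat

/-! ### Shells -/

namespace CubCat

variable {n : ℕ} (C : CubCat.{u} n)

theorem degShell_of_lt {k : ℕ} {hk : k + 1 ≤ n} {i j : ℕ} (hij : i < j) (hi : i ≤ k + 1)
    (hj : j ≤ k + 1) (α : Bool) (c : C.cell (k + 1) hk) :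
    C.degShell i hi c j hj α = C.deg hk i (C.face (j - 1) α c) := by
  simp [CubData.degShell, hij]

theorem degShell_of_gt {k : ℕ} {hk : k + 1 ≤ n} {i j : ℕ} (hij : j < i) (hi : i ≤ k + 1)
    (hj : j ≤ k + 1) (α : Bool) (c : C.cell (k + 1) hk) :
    C.degShell i hi c j hj α = C.deg hk (i - 1) (C.face j α c) := by
  simp [CubData.degShell, hij, Nat.lt_asymm hij]

theorem degShell_self {k : ℕ} {hk : k ≤ n} {i j : ℕ} (hij : j = i) (hi : i ≤ k)
    (hj : j ≤ k) (α : Bool) (c : C.cell k hk) : C.degShell i hi c j hj α = c := by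
  subst hij
  cases k <;> simp [CubData.degShell]

theorem connShell_of_lt {k : ℕ} {hk : k + 2 ≤ n} {i j : ℕ} (hij : i + 1 < j) (hi : i < k + 2)
    (hj : j ≤ k + 2) (α β : Bool) (c : C.cell (k + 2) hk) :
    C.connShell i hi α c j hj β = C.conn hk i α (C.face (j - 1) β c) := by
  simp [CubData.connShell, hij]

theorem connShell_of_gt {k : ℕ} {hk : k + 2 ≤ n} {i j : ℕ} (hij : j < i) (hi : i < k + 2)
    (hj : j ≤ k + 2) (α β : Bool) (c : C.cell (k + 2) hk) :
    C.connShell i hi α c j hj β = C.conn hk (i - 1) α (C.face j β c) := by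
  simp [CubData.connShell, hij, show ¬ i + 1 < j by omega]

theorem connShell_mid {k : ℕ} {hk : k + 1 ≤ n} {i j : ℕ} (hij : i ≤ j) (hij' : j ≤ i + 1)
    (hi : i < k + 1) (hj : j ≤ k + 1) (α β : Bool) (c : C.cell (k + 1) hk) :
    C.connShell i hi α c j hj β = if α = β then c else C.deg hk i (C.face i β c) := by
  cases k with
  | zero => rfl
  | succ k => simp [CubData.connShell, show ¬ i + 1 < j by omega, show ¬ j < i by omega]

/-- `Rel` carries the bound on its index existentially, so the two clauses about the other
directions become plain relations to which the lemmas on `Rel` apply. -/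
theorem isCompShell_succ {k : ℕ} {hk : k + 1 ≤ n} {i : ℕ} (hi : i ≤ k + 1)
    {S T U : C.Shell (k + 1) hk} :
    C.IsCompShell i hi S T U ↔ U i hi false = S i hi false ∧ U i hi true = T i hi true ∧
      ∀ (j : ℕ) (hj : j ≤ k + 1) (α : Bool),
        (i < j → C.Rel i (S j hj α) (T j hj α) (U j hj α)) ∧
        (j < i → C.Rel (i - 1) (S j hj α) (T j hj α) (U j hj α)) := by
  refine and_congr_right fun _ => and_congr_right fun _ => forall₃_congr fun j hj α => ?_
  exact and_congr (forall_congr' fun _ => ⟨fun h => ⟨_, h⟩, fun h => h.2⟩)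
    (forall_congr' fun _ => ⟨fun h => ⟨_, h⟩, fun h => h.2⟩)

end CubCat

end Cub

/-! ### Composites of squares: associativity, interchange, units, existence -/

namespace Cub

namespace CubCat

variable {n : ℕ} {C : CubCat.{u} n}

theorem shell_ext {k : ℕ} {hk : k ≤ n} {S T : C.Shell k hk} (i : ℕ) (hi : i ≤ k)
    (h₁ : ∀ α, S i hi α = T i hi α)
    (h₂ : ∀ j hj α, i < j → S j hj α = T j hj α) (h₃ : ∀ j hj α, j < i → S j hj α = T j hj α) :
    S = T := by
  funext j hj α
  rcases lt_trichotomy i j with h | rfl | h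
  exacts [h₂ j hj α h, h₁ α, h₃ j hj α h]

theorem square_face {k : ℕ} {hk : k + 1 ≤ n} {S : C.Shell (k + 1) hk} (hS : C.IsSquare S)
    {i j : ℕ} (hij : i < j) (hj : j ≤ k + 1) (α β : Bool) :
    C.face i α (S j hj β) = C.face (j - 1) β (S i (by omega) α) := by
  obtain ⟨j, rfl⟩ : ∃ l, j = l + 1 := ⟨j - 1, by omega⟩
  exact hS i j (by omega) (by omega) α β

theorem square_face' {k : ℕ} {hk : k + 1 ≤ n} {S : C.Shell (k + 1) hk} (hS : C.IsSquare S)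
    {i j : ℕ} (hij : i < j) (hj : j ≤ k + 1) (α β : Bool) :
    C.face (j - 1) β (S i (by omega) α) = C.face i α (S j hj β) :=
  (square_face hS hij hj α β).symm

theorem square_of_face {k : ℕ} {hk : k + 1 ≤ n} {S : C.Shell (k + 1) hk}
    (h : ∀ (i j : ℕ) (_ : i < j) (hj : j ≤ k + 1) (α β : Bool),
      C.face i α (S j hj β) = C.face (j - 1) β (S i (by omega) α)) : C.IsSquare S :=
  fun i j hij hj α β => h i (j + 1) (by omega) (by omega) α β

section Comp

variable {k : ℕ} {hk : k ≤ n} {i j : ℕ} {hi : i ≤ k} {hj : j ≤ k} {S T U V : C.Shell k hk}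

theorem compShell_lower (h : C.IsCompShell i hi S T U) : U i hi false = S i hi false := by
  cases k <;> exact h.1

theorem compShell_upper (h : C.IsCompShell i hi S T U) : U i hi true = T i hi true := by
  cases k with
  | zero => exact h.2
  | succ k => exact h.2.1

/-- Since composites of shells are determined, a law in the layer of squares whose other side is an
explicit shell follows once that shell is shown to be a composite. -/
theorem compShell_unique {U' : C.Shell k hk} (h : C.IsCompShell i hi S T U)
    (h' : C.IsCompShell i hi S T U') : U = U' := by
  refine shell_ext i hi ?_ ?_ ?_
  · rintro (_ | _)
    · rw [compShell_lower h, compShell_lower h']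
    · rw [compShell_upper h, compShell_upper h']
  all_goals
    intro j hj α hij
    cases k with
    | zero => omega
    | succ k => ?_
    rw [isCompShell_succ] at h h'
  · exact ((h.2.2 j hj α).1 hij).unique ((h'.2.2 j hj α).1 hij)
  · exact ((h.2.2 j hj α).2 hij).unique ((h'.2.2 j hj α).2 hij)

theorem compShell_assoc {ST TV U' : C.Shell k hk} (h₁ : C.IsCompShell i hi S T ST)
    (h₂ : C.IsCompShell i hi T V TV) (h : C.IsCompShell i hi S TV U)
    (h' : C.IsCompShell i hi ST V U') : U = U' := by
  refine shell_ext i hi ?_ ?_ ?_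
  · rintro (_ | _)
    · rw [compShell_lower h, compShell_lower h', compShell_lower h₁]
    · rw [compShell_upper h, compShell_upper h', compShell_upper h₂]
  all_goals
    intro j hj α hij
    cases k with
    | zero => omega
    | succ k => ?_
    rw [isCompShell_succ] at h h' h₁ h₂
  · exact ((h₁.2.2 j hj α).1 hij).assoc ((h₂.2.2 j hj α).1 hij) ((h.2.2 j hj α).1 hij)
      ((h'.2.2 j hj α).1 hij)
  · exact ((h₁.2.2 j hj α).2 hij).assoc ((h₂.2.2 j hj α).2 hij) ((h.2.2 j hj α).2 hij)
      ((h'.2.2 j hj α).2 hij)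

/-- In directions other than `i` and `j` this is interchange in `C`. In direction `i` or `j` one of
the two composites only selects outer faces, so both sides are the same single composite in the
remaining direction. -/
theorem compShell_interchange (hij : i < j) {ST VW SV TW U' W : C.Shell k hk}
    (h₁ : C.IsCompShell i hi S T ST) (h₂ : C.IsCompShell i hi V W VW)
    (h₃ : C.IsCompShell j hj S V SV) (h₄ : C.IsCompShell j hj T W TW)
    (h : C.IsCompShell j hj ST VW U) (h' : C.IsCompShell i hi SV TW U') : U = U' := by
  cases k with
  | zero => omega
  | succ k => ?_
  rw [isCompShell_succ] at *
  funext l hl α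
  rcases lt_trichotomy l i with hli | rfl | hli
  · exact ((h₁.2.2 l hl α).2 hli).interchange (by omega) ((h₂.2.2 l hl α).2 hli)
      ((h₃.2.2 l hl α).2 (by omega)) ((h₄.2.2 l hl α).2 (by omega)) ((h.2.2 l hl α).2 (by omega))
      ((h'.2.2 l hl α).2 hli)
  · have := (h.2.2 l hl α).2 hij
    cases α
    · rw [h₁.1, h₂.1] at this
      rw [h'.1]
      exact this.unique ((h₃.2.2 l hl false).2 hij)
    · rw [h₁.2.1, h₂.2.1] at this
      rw [h'.2.1]
      exact this.unique ((h₄.2.2 l hl true).2 hij)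
  rcases lt_trichotomy l j with hlj | rfl | hlj
  · exact ((h₁.2.2 l hl α).1 hli).interchange (by omega) ((h₂.2.2 l hl α).1 hli)
      ((h₃.2.2 l hl α).2 (by omega)) ((h₄.2.2 l hl α).2 (by omega)) ((h.2.2 l hl α).2 (by omega))
      ((h'.2.2 l hl α).1 hli)
  · have := (h'.2.2 l hl α).1 hij
    cases α
    · rw [h₃.1, h₄.1] at this
      rw [h.1]
      exact ((h₁.2.2 l hl false).1 hij).unique this
    · rw [h₃.2.1, h₄.2.1] at this
      rw [h.2.1]
      exact ((h₂.2.2 l hl true).1 hij).unique this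
  · exact ((h₁.2.2 l hl α).1 hli).interchange (by omega) ((h₂.2.2 l hl α).1 hli)
      ((h₃.2.2 l hl α).1 (by omega)) ((h₄.2.2 l hl α).1 (by omega)) ((h.2.2 l hl α).1 (by omega))
      ((h'.2.2 l hl α).1 hli)

/-- The unit law is used on each face in another direction. The square condition identifies the
degenerate face there as the unit on the matching face of `S`. -/
theorem compShell_deg_left (hS : C.IsSquare S) :
    C.IsCompShell i hi (C.degShell i hi (S i hi false)) S S := by
  cases k with
  | zero => exact ⟨rfl, rfl⟩
  | succ k =>
    rw [isCompShell_succ]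
    refine ⟨(degShell_self C rfl ..).symm, rfl, fun j hj α => ⟨fun hij => ?_, fun hij => ?_⟩⟩
    · rw [degShell_of_lt _ hij]
      exact Rel.deg_left' (by omega) (square_face hS hij hj _ _)
    · rw [degShell_of_gt _ hij]
      exact Rel.deg_left' (by omega) (square_face' hS hij hi _ _)

theorem compShell_deg_right (hS : C.IsSquare S) :
    C.IsCompShell i hi S (C.degShell i hi (S i hi true)) S := by
  cases k with
  | zero => exact ⟨rfl, rfl⟩
  | succ k =>
    rw [isCompShell_succ]
    refine ⟨rfl, (degShell_self C rfl ..).symm, fun j hj α => ⟨fun hij => ?_, fun hij => ?_⟩⟩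
    · rw [degShell_of_lt _ hij]
      exact Rel.deg_right' (by omega) (square_face hS hij hj _ _)
    · rw [degShell_of_gt _ hij]
      exact Rel.deg_right' (by omega) (square_face' hS hij hi _ _)

/-- The composite of two shells. -/
theorem exists_compShell (hS : C.IsSquare S) (hT : C.IsSquare T)
    (h : S i hi true = T i hi false) : ∃ U, C.IsCompShell i hi S T U := by
  cases k with
  | zero => exact ⟨fun _ _ α => if α then T i hi true else S i hi false, rfl, rfl⟩
  | succ k =>
    have h₁ : ∀ j hj α, i < j → ∃ c, C.Rel i (S j hj α) (T j hj α) c := fun j hj α hij =>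
      ⟨_, .mk' (by omega) (by rw [square_face hS hij, square_face hT hij, h])⟩
    have h₂ : ∀ j hj α, j < i → ∃ c, C.Rel (i - 1) (S j hj α) (T j hj α) c := fun j hj α hij =>
      ⟨_, .mk' (by omega) (by rw [square_face' hS hij hi, square_face' hT hij hi, h])⟩
    refine ⟨fun j hj α => if h : i < j then (h₁ j hj α h).choose else
      if h : j < i then (h₂ j hj α h).choose else if α then T i hi true else S i hi false, ?_⟩
    rw [isCompShell_succ]
    refine ⟨by simp, by simp, fun j hj α => ⟨fun hij => ?_, fun hij => ?_⟩⟩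
    · rw [dif_pos hij]; exact (h₁ j hj α hij).choose_spec
    · rw [dif_neg (by omega), dif_pos hij]; exact (h₂ j hj α hij).choose_spec

/-- If neither of the two directions is `i`, both iterated faces are composites of the same cells,
by the square conditions on `S` and `T`. If one of them is `i`, both are outer faces of a composite.
-/
theorem compShell_square (hS : C.IsSquare S) (hT : C.IsSquare T)
    (h : C.IsCompShell i hi S T U) : C.IsSquare U := by
  cases k with
  | zero => trivial
  | succ k =>
    rw [isCompShell_succ] at h
    refine square_of_face fun a b hab hb α β => ?_
    cases k with
    | zero =>
      -- The iterated faces are `0`-cells, which have no composition; but `i` is then one of the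
      -- only two directions, so outer faces suffice.
      obtain rfl : a = 0 := by omega
      obtain rfl : b = 1 := by omega
      obtain rfl | rfl : i = 0 ∨ i = 1 := by omega
      · have h₁ := (h.2.2 1 hb β).1 (by omega)
        cases α
        · rw [h₁.lower, h.1, square_face hS hab]
        · rw [h₁.upper, h.2.1, square_face hT hab]
      · have h₁ := (h.2.2 0 (by omega) α).2 (by omega)
        cases β
        · rw [h₁.lower, h.1, square_face hS hab]
        · rw [h₁.upper, h.2.1, square_face hT hab]
    | succ k =>
      rcases lt_trichotomy i a with hia | rfl | hia
      · refine (((h.2.2 b hb β).1 (by omega)).face_gt hia (by omega) α).unique ?_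
        rw [square_face hS hab, square_face hT hab]
        exact ((h.2.2 a (by omega) α).1 hia).face_gt (by omega) (by omega) β
      · have h₁ := (h.2.2 b hb β).1 hab
        cases α
        · rw [h₁.lower, h.1, square_face hS hab]
        · rw [h₁.upper, h.2.1, square_face hT hab]
      rcases lt_trichotomy i b with hib | rfl | hib
      · refine (((h.2.2 b hb β).1 hib).face_lt hia (by omega) α).unique ?_
        rw [square_face hS hab, square_face hT hab]
        exact ((h.2.2 a (by omega) α).2 hia).face_gt (by omega) (by omega) β
      · have h₁ := (h.2.2 a (by omega) α).2 hab
        cases β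
        · rw [h₁.lower, h.1, square_face hS hab]
        · rw [h₁.upper, h.2.1, square_face hT hab]
      · refine (((h.2.2 b hb β).2 hib).face_lt (by omega) (by omega) α).unique ?_
        rw [square_face hS hab, square_face hT hab]
        exact ((h.2.2 a (by omega) α).2 hia).face_lt (by omega) (by omega) β

end Comp

end CubCat

end Cub

/-! ### Prescribed faces of degeneracies and connections form squares -/

namespace Cub

namespace CubCat

variable {n : ℕ} {C : CubCat.{u} n}

theorem face_deg_of_eq {k : ℕ} (hk : k + 1 ≤ n) {i j : ℕ} (h : i = j) (hj : j ≤ k) (α : Bool)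
    (x : C.cell k (Nat.le_of_succ_le hk)) : C.face i α (C.deg hk j x) = x := by
  subst h; exact C.face_deg_eq hk i hj α x

theorem square_deg {k : ℕ} {hk : k ≤ n} {i : ℕ} (hi : i ≤ k) (c : C.cell k hk) :
    C.IsSquare (C.degShell i hi c) := by
  rcases k with _ | k
  · trivial
  refine square_of_face fun a b hab hb α β => ?_
  -- For shells of `1`-cells the faces are degeneracies of `0`-cells, and the laws moving a face
  -- past a degeneracy in another direction are not available.
  rcases k with _ | k
  · obtain rfl : a = 0 := by omega
    obtain rfl : b = 1 := by omega
    have hi' : i = 0 ∨ i = 1 := by omega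
    rcases hi' with rfl | rfl <;>
    simp (disch := omega) only [degShell_of_lt, degShell_of_gt, degShell_self, face_deg_of_eq]
  rcases lt_trichotomy i a with hia | rfl | hia
  · simp (disch := omega) only [degShell_of_lt, face_deg_of_gt, face_face_of_lt]
  · simp (disch := omega) only [degShell_of_lt, face_deg_of_eq, degShell_self]
  rcases lt_trichotomy i b with hib | rfl | hib
  · simp (disch := omega) only [degShell_of_lt, degShell_of_gt, face_deg_of_gt, face_deg_of_lt, face_face_of_lt]
  · simp (disch := omega) only [degShell_of_gt, face_deg_of_eq, degShell_self]
  · simp (disch := omega) only [degShell_of_gt, face_deg_of_lt, face_face_of_lt]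

/-- The directions `i` and `i + 1` of the connection behave alike: depending on the sign, the face
is `c` or a degenerate cell. All other directions commute with the connection up to renumbering, so
only the position of the two faces relative to this pair matters. -/
theorem square_conn {k : ℕ} {hk : k ≤ n} {i : ℕ} (hi : i < k) (γ : Bool) (c : C.cell k hk) :
    C.IsSquare (C.connShell i hi γ c) := by
  rcases k with _ | k
  · trivial
  refine square_of_face fun a b hab hb α β => ?_
  rcases k with _ | k
  · obtain rfl : a = 0 := by omega
    obtain rfl : b = 1 := by omega
    obtain rfl : i = 0 := by omega
    simp (disch := omega) only [connShell_mid]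
    cases α <;> cases β <;> cases γ <;> simp (disch := omega) [face_deg_of_eq]
  by_cases hia : i < a
  · by_cases hia' : a = i + 1
    · simp (disch := omega) only [connShell_mid, connShell_of_lt, face_conn_mid]
      split_ifs <;> simp (disch := omega) only [face_face_of_lt, face_deg_of_gt]
    · obtain ⟨k, rfl⟩ : ∃ l, k = l + 1 := ⟨k - 1, by omega⟩
      simp (disch := omega) only [connShell_of_lt, face_conn_of_gt, face_face_of_lt]
  by_cases hai : a < i
  · by_cases hib : i + 1 < b
    · obtain ⟨k, rfl⟩ : ∃ l, k = l + 1 := ⟨k - 1, by omega⟩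
      simp (disch := omega) only [connShell_of_lt, connShell_of_gt, face_conn_of_gt,
        face_conn_of_lt, face_face_of_lt]
    by_cases hib' : b < i
    · obtain ⟨k, rfl⟩ : ∃ l, k = l + 1 := ⟨k - 1, by omega⟩
      simp (disch := omega) only [connShell_of_gt, face_conn_of_lt, face_face_of_lt]
    · simp (disch := omega) only [connShell_of_gt, face_conn_mid, connShell_mid]
      split_ifs <;> simp (disch := omega) only [face_face_of_lt, face_deg_of_lt]
  obtain rfl : a = i := by omega
  by_cases hib : b = a + 1
  · subst hib
    simp (disch := omega) only [connShell_mid]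
    cases α <;> cases β <;> cases γ <;> simp (disch := omega) [face_deg_of_eq]
  · simp (disch := omega) only [connShell_mid, connShell_of_lt, face_conn_mid]
    split_ifs <;> simp (disch := omega) only [face_face_of_lt, face_deg_of_gt]

end CubCat

end Cub

/-! ### The axioms for degeneracies and connections, verified on shells -/

namespace Cub

namespace CubCat

variable {n : ℕ} {C : CubCat.{u} n}

/-- In direction `i` both sides give `ε_j c`, in direction `j + 1` both give `ε_i c`; any other face
is an instance of the same law one dimension lower. -/
theorem degShell_deg {k : ℕ} {hk : k + 1 ≤ n} {i j : ℕ} (hij : i ≤ j) (hj : j ≤ k)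
    (c : C.cell k (Nat.le_of_succ_le hk)) :
    C.degShell i (by omega) (C.deg hk j c) = C.degShell (j + 1) (by omega) (C.deg hk i c) := by
  funext l hl α
  rcases lt_trichotomy l i with h | rfl | h
  · obtain ⟨k, rfl⟩ : ∃ l, k = l + 1 := ⟨k - 1, by omega⟩
    simp (disch := omega) only [degShell_of_gt, face_deg_of_lt, deg_deg_of_le]
    congr 1; omega
  · simp (disch := omega) only [degShell_of_gt, degShell_self, face_deg_of_eq]
    rfl
  rcases lt_trichotomy l (j + 1) with h' | rfl | h'
  · obtain ⟨k, rfl⟩ : ∃ l, k = l + 1 := ⟨k - 1, by omega⟩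
    simp (disch := omega) only [degShell_of_gt, degShell_of_lt, face_deg_of_gt, face_deg_of_lt, deg_deg_of_le]
    congr 1; omega
  · simp (disch := omega) only [degShell_of_lt, degShell_self, face_deg_of_eq]
  · obtain ⟨k, rfl⟩ : ∃ l, k = l + 1 := ⟨k - 1, by omega⟩
    simp (disch := omega) only [degShell_of_lt, face_deg_of_gt, deg_deg_of_le]

theorem conn_deg_of_lt {k : ℕ} (hk : k + 3 ≤ n) {i j : ℕ} (hij : i < j) (hj : j ≤ k + 1)
    (α : Bool) (x : C.cell (k + 1) (Nat.le_of_succ_le (Nat.le_of_succ_le hk))) :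
    C.conn hk i α (C.deg (Nat.le_of_succ_le hk) j x) =
      C.deg hk (j + 1) (C.conn (Nat.le_of_succ_le hk) i α x) :=
  C.conn_deg_lt hk i j hij hj α x

theorem conn_deg_of_eq {k : ℕ} (hk : k + 2 ≤ n) {i j : ℕ} (h : i = j) (hi : i ≤ k) (α : Bool)
    (x : C.cell k (Nat.le_of_succ_le (Nat.le_of_succ_le hk))) :
    C.conn hk i α (C.deg (Nat.le_of_succ_le hk) j x) =
      C.deg hk i (C.deg (Nat.le_of_succ_le hk) i x) := by
  subst h; exact C.conn_deg_eq hk i hi α x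

/-- In the directions `i` and `i + 1` of the connection the faces agree by the law for degeneracies
of degeneracies, in direction `j + 1` both are the connection of `c`, and elsewhere the same law is
used one dimension lower. -/
theorem connShell_deg_lt {k : ℕ} {hk : k + 2 ≤ n} {i j : ℕ} (hij : i < j) (hj : j ≤ k + 1)
    (α : Bool) (c : C.cell (k + 1) (Nat.le_of_succ_le hk)) :
    C.connShell i (by omega) α (C.deg hk j c) = C.degShell (j + 1) (by omega) (C.conn hk i α c) := by
  funext l hl β
  by_cases hli : l < i
  · obtain ⟨k, rfl⟩ : ∃ l, k = l + 1 := ⟨k - 1, by omega⟩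
    simp (disch := omega) only [connShell_of_gt, degShell_of_gt, face_deg_of_lt, face_conn_of_lt,
      conn_deg_of_lt, Nat.sub_add_cancel, Nat.add_sub_cancel]
  by_cases hli' : l ≤ i + 1
  · simp (disch := omega) only [connShell_mid, degShell_of_gt, face_deg_of_lt, face_conn_mid,
      Nat.add_sub_cancel]
    split_ifs
    · rfl
    · simp (disch := omega) only [deg_deg_of_le, Nat.sub_add_cancel]
  rcases lt_trichotomy l (j + 1) with h | rfl | h
  · obtain ⟨k, rfl⟩ : ∃ l, k = l + 1 := ⟨k - 1, by omega⟩
    simp (disch := omega) only [connShell_of_lt, degShell_of_gt, face_deg_of_lt, face_conn_of_gt,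
      conn_deg_of_lt, Nat.sub_add_cancel, Nat.add_sub_cancel]
  · simp (disch := omega) only [connShell_of_lt, degShell_self, face_deg_of_eq]
  · obtain ⟨k, rfl⟩ : ∃ l, k = l + 1 := ⟨k - 1, by omega⟩
    simp (disch := omega) only [connShell_of_lt, degShell_of_lt, face_deg_of_gt, face_conn_of_gt,
      conn_deg_of_lt]

/-- On the faces in directions `i` and `i + 1` the sign of the connection is irrelevant: since `∂_i
ε_i c = c`, both alternatives are `ε_i c`. -/
theorem connShell_deg_self {k : ℕ} {hk : k + 1 ≤ n} {i : ℕ} (hi : i ≤ k)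
    (α : Bool) (c : C.cell k (Nat.le_of_succ_le hk)) :
    C.connShell i (by omega) α (C.deg hk i c) = C.degShell i (by omega) (C.deg hk i c) := by
  funext l hl β
  by_cases hli : l < i
  · obtain ⟨k, rfl⟩ : ∃ l, k = l + 1 := ⟨k - 1, by omega⟩
    simp (disch := omega) only [connShell_of_gt, degShell_of_gt, face_deg_of_lt, conn_deg_of_eq]
  by_cases hli' : i + 1 < l
  · obtain ⟨k, rfl⟩ : ∃ l, k = l + 1 := ⟨k - 1, by omega⟩
    simp (disch := omega) only [connShell_of_lt, degShell_of_lt, face_deg_of_gt, conn_deg_of_eq]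
  rcases (show l = i ∨ l = i + 1 by omega) with rfl | rfl
  · simp (disch := omega) only [connShell_mid, degShell_self, face_deg_of_eq, ite_self]
  · simp (disch := omega) only [connShell_mid, degShell_of_lt, face_deg_of_eq, ite_self]

theorem connShell_deg_gt {k : ℕ} {hk : k + 2 ≤ n} {i j : ℕ} (hij : j < i) (hi : i ≤ k + 1)
    (α : Bool) (c : C.cell (k + 1) (Nat.le_of_succ_le hk)) :
    C.connShell i (by omega) α (C.deg hk j c) =
      C.degShell j (by omega) (C.conn hk (i - 1) α c) := by
  funext l hl β
  rcases lt_trichotomy l j with h | rfl | h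
  · obtain ⟨k, rfl⟩ : ∃ l, k = l + 1 := ⟨k - 1, by omega⟩
    simp (disch := omega) only [connShell_of_gt, degShell_of_gt, face_deg_of_lt, face_conn_of_lt,
      conn_deg_of_gt]
  · simp (disch := omega) only [connShell_of_gt, degShell_self, face_deg_of_eq]
  by_cases hli : l < i
  · obtain ⟨k, rfl⟩ : ∃ l, k = l + 1 := ⟨k - 1, by omega⟩
    simp (disch := omega) only [connShell_of_gt, degShell_of_lt, face_deg_of_gt, face_conn_of_lt,
      conn_deg_of_gt]
  by_cases hli' : l ≤ i + 1
  · simp (disch := omega) only [connShell_mid, degShell_of_lt, face_deg_of_gt, face_conn_mid]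
    split_ifs
    · rfl
    · simp (disch := omega) only [deg_deg_of_le, Nat.sub_add_cancel]
  · obtain ⟨k, rfl⟩ : ∃ l, k = l + 1 := ⟨k - 1, by omega⟩
    simp (disch := omega) only [connShell_of_lt, degShell_of_lt, face_deg_of_gt, face_conn_of_gt,
      conn_deg_of_gt]

theorem connShell_conn_lt {k : ℕ} {hk : k + 2 ≤ n} {i j : ℕ} (hij : i < j) (hj : j ≤ k)
    (α β : Bool) (c : C.cell (k + 1) (Nat.le_of_succ_le hk)) :
    C.connShell i (by omega) α (C.conn hk j β c) =
      C.connShell (j + 1) (by omega) β (C.conn hk i α c) := by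
  obtain ⟨k, rfl⟩ : ∃ l, k = l + 1 := ⟨k - 1, by omega⟩
  funext l hl γ
  by_cases hli : l < i
  · obtain ⟨k, rfl⟩ : ∃ l, k = l + 1 := ⟨k - 1, by omega⟩
    simp (disch := omega) only [connShell_of_gt, face_conn_of_lt, Nat.add_sub_cancel]
    rw [C.conn_conn_lt _ (i - 1) (j - 1) (by omega) (by omega)]
    simp (disch := omega) only [Nat.sub_add_cancel]
  by_cases hli' : l ≤ i + 1
  · simp (disch := omega) only [connShell_mid, connShell_of_gt, face_conn_of_lt, face_conn_mid,
      Nat.add_sub_cancel]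
    split_ifs
    · rfl
    · simp (disch := omega) only [conn_deg_of_gt]
  by_cases h : l < j + 1
  · obtain ⟨k, rfl⟩ : ∃ l, k = l + 1 := ⟨k - 1, by omega⟩
    simp (disch := omega) only [connShell_of_gt, connShell_of_lt, face_conn_of_lt, face_conn_of_gt,
      Nat.add_sub_cancel]
    rw [C.conn_conn_lt _ i (j - 1) (by omega) (by omega)]
    simp (disch := omega) only [Nat.sub_add_cancel]
  by_cases h' : l ≤ j + 2
  · simp (disch := omega) only [connShell_mid, connShell_of_lt, face_conn_of_gt, face_conn_mid,
      Nat.add_sub_cancel]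
    split_ifs
    · rfl
    · simp (disch := omega) only [conn_deg_of_lt]
  · obtain ⟨k, rfl⟩ : ∃ l, k = l + 1 := ⟨k - 1, by omega⟩
    simp (disch := omega) only [connShell_of_lt, face_conn_of_gt]
    rw [C.conn_conn_lt _ i j (by omega) (by omega)]

/-- The overlapping directions `i`, `i + 1`, `i + 2` are special. There the opposite sign produces a
degenerate cell on one side and a connection of a degenerate cell, or another iterated degeneracy,
on the other; these agree by `Γ_i ε_i = ε_i ε_i` and the law for degeneracies of degeneracies. -/
theorem connShell_conn_self {k : ℕ} {hk : k + 2 ≤ n} {i : ℕ} (hi : i ≤ k)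
    (α : Bool) (c : C.cell (k + 1) (Nat.le_of_succ_le hk)) :
    C.connShell i (by omega) α (C.conn hk i α c) =
      C.connShell (i + 1) (by omega) α (C.conn hk i α c) := by
  funext l hl γ
  by_cases hli : l < i
  · obtain ⟨k, rfl⟩ : ∃ l, k = l + 1 := ⟨k - 1, by omega⟩
    simp (disch := omega) only [connShell_of_gt, face_conn_of_lt, Nat.add_sub_cancel]
    rw [C.conn_conn_eq _ (i - 1) (by omega)]
    simp (disch := omega) only [Nat.sub_add_cancel]
  by_cases h : i + 2 < l
  · obtain ⟨k, rfl⟩ : ∃ l, k = l + 1 := ⟨k - 1, by omega⟩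
    simp (disch := omega) only [connShell_of_lt, face_conn_of_gt]
    rw [C.conn_conn_eq _ i (by omega)]
  rcases (show l = i ∨ l = i + 1 ∨ l = i + 2 by omega) with rfl | rfl | rfl
  · simp (disch := omega) only [connShell_mid, connShell_of_gt, face_conn_mid, Nat.add_sub_cancel]
    split_ifs
    · rfl
    · simp (disch := omega) only [conn_deg_of_eq]
  · simp (disch := omega) only [connShell_mid, face_conn_mid]
    split_ifs
    · rfl
    · simp (disch := omega) only [deg_deg_of_le]
  · simp (disch := omega) only [connShell_mid, connShell_of_lt, face_conn_mid]
    split_ifs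
    · rfl
    · simp (disch := omega) only [conn_deg_of_eq, deg_deg_of_le]

section Comp

variable {k : ℕ} {hk : k + 1 ≤ n} {i j : ℕ} {a b c : C.cell (k + 1) hk}

/-- The direction `i` of the degeneracy reproduces the given composite; the remaining transverse
directions are the same law for a face of it. -/
theorem compShell_deg_le (h : C.Rel j a b c) (hij : i ≤ j) (hj : j ≤ k) :
    C.IsCompShell (j + 1) (by omega) (C.degShell i (by omega) a) (C.degShell i (by omega) b)
      (C.degShell i (by omega) c) := by
  rw [isCompShell_succ]
  refine ⟨?_, ?_, fun l hl α => ⟨fun hl' => ?_, fun hl' => ?_⟩⟩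
  · simp (disch := omega) only [degShell_of_lt, Nat.add_sub_cancel, h.lower]
  · simp (disch := omega) only [degShell_of_lt, Nat.add_sub_cancel, h.upper]
  · obtain ⟨k, rfl⟩ : ∃ l, k = l + 1 := ⟨k - 1, by omega⟩
    simp (disch := omega) only [degShell_of_lt]
    exact (h.face_gt (by omega) (by omega) α).deg_le (by omega) (by omega)
  rcases lt_trichotomy l i with hli | rfl | hli
  · obtain ⟨k, rfl⟩ : ∃ l, k = l + 1 := ⟨k - 1, by omega⟩
    simp (disch := omega) only [degShell_of_gt]
    have := (h.face_lt (i := l) (by omega) (by omega) α).deg_le (hk := hk) (i := i - 1) (by omega) (by omega)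
    rwa [show j - 1 + 1 = j + 1 - 1 by omega] at this
  · simp (disch := omega) only [degShell_self]
    exact h
  · obtain ⟨k, rfl⟩ : ∃ l, k = l + 1 := ⟨k - 1, by omega⟩
    simp (disch := omega) only [degShell_of_lt]
    have := (h.face_lt (i := l - 1) (by omega) (by omega) α).deg_le (hk := hk) (i := i) (by omega) (by omega)
    rwa [show j - 1 + 1 = j + 1 - 1 by omega] at this

theorem compShell_deg_gt (h : C.Rel j a b c) (hij : j < i) (hi : i ≤ k + 1) :
    C.IsCompShell j (by omega) (C.degShell i (by omega) a) (C.degShell i (by omega) b)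
      (C.degShell i (by omega) c) := by
  rw [isCompShell_succ]
  refine ⟨?_, ?_, fun l hl α => ⟨fun hl' => ?_, fun hl' => ?_⟩⟩
  · simp (disch := omega) only [degShell_of_gt, h.lower]
  · simp (disch := omega) only [degShell_of_gt, h.upper]
  · rcases lt_trichotomy l i with hli | rfl | hli
    · obtain ⟨k, rfl⟩ : ∃ l, k = l + 1 := ⟨k - 1, by omega⟩
      simp (disch := omega) only [degShell_of_gt]
      exact (h.face_gt (by omega) (by omega) α).deg_gt (by omega) (by omega)
    · simp (disch := omega) only [degShell_self]
      exact h
    · obtain ⟨k, rfl⟩ : ∃ l, k = l + 1 := ⟨k - 1, by omega⟩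
      simp (disch := omega) only [degShell_of_lt]
      exact (h.face_gt (by omega) (by omega) α).deg_gt (by omega) (by omega)
  · obtain ⟨k, rfl⟩ : ∃ l, k = l + 1 := ⟨k - 1, by omega⟩
    simp (disch := omega) only [degShell_of_gt]
    exact (h.face_lt (by omega) (by omega) α).deg_gt (by omega) (by omega)

theorem compShell_conn_lt (h : C.Rel j a b c) (hij : i < j) (hj : j ≤ k) (γ : Bool) :
    C.IsCompShell (j + 1) (by omega) (C.connShell i (by omega) γ a)
      (C.connShell i (by omega) γ b) (C.connShell i (by omega) γ c) := by
  obtain ⟨k, rfl⟩ : ∃ l, k = l + 1 := ⟨k - 1, by omega⟩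
  rw [isCompShell_succ]
  refine ⟨?_, ?_, fun l hl α => ⟨fun hl' => ?_, fun hl' => ?_⟩⟩
  · simp (disch := omega) only [connShell_of_lt, Nat.add_sub_cancel, h.lower]
  · simp (disch := omega) only [connShell_of_lt, Nat.add_sub_cancel, h.upper]
  · simp (disch := omega) only [connShell_of_lt]
    exact (h.face_gt (by omega) (by omega) α).conn_lt (by omega) (by omega) γ
  rw [Nat.add_sub_cancel]
  by_cases hli : l < i
  · simp (disch := omega) only [connShell_of_gt]
    have := (h.face_lt (i := l) (by omega) (by omega) α).conn_lt (hk := hk) (i := i - 1) (by omega) (by omega) γ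
    rwa [show j - 1 + 1 = j by omega] at this
  by_cases hli' : i + 1 < l
  · simp (disch := omega) only [connShell_of_lt]
    have := (h.face_lt (i := l - 1) (by omega) (by omega) α).conn_lt (hk := hk) (i := i)
      (by omega) (by omega) γ
    rwa [show j - 1 + 1 = j by omega] at this
  · simp (disch := omega) only [connShell_mid]
    split_ifs
    · exact h
    · have := (h.face_lt hij (by omega) α).deg_le (hk := hk) (i := i) (by omega) (by omega)
      rwa [show j - 1 + 1 = j by omega] at this

theorem compShell_conn_gt (h : C.Rel j a b c) (hij : j < i) (hi : i ≤ k) (γ : Bool) :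
    C.IsCompShell j (by omega) (C.connShell i (by omega) γ a)
      (C.connShell i (by omega) γ b) (C.connShell i (by omega) γ c) := by
  obtain ⟨k, rfl⟩ : ∃ l, k = l + 1 := ⟨k - 1, by omega⟩
  rw [isCompShell_succ]
  refine ⟨?_, ?_, fun l hl α => ⟨fun hl' => ?_, fun hl' => ?_⟩⟩
  · simp (disch := omega) only [connShell_of_gt, h.lower]
  · simp (disch := omega) only [connShell_of_gt, h.upper]
  · by_cases hli : l < i
    · simp (disch := omega) only [connShell_of_gt]
      exact (h.face_gt (by omega) (by omega) α).conn_gt (by omega) (by omega) γ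
    by_cases hli' : i + 1 < l
    · simp (disch := omega) only [connShell_of_lt]
      exact (h.face_gt (by omega) (by omega) α).conn_gt (by omega) (by omega) γ
    · simp (disch := omega) only [connShell_mid]
      split_ifs
      · exact h
      · exact (h.face_gt (by omega) (by omega) α).deg_gt (by omega) (by omega)
  · simp (disch := omega) only [connShell_of_gt]
    exact (h.face_lt (by omega) (by omega) α).conn_gt (by omega) (by omega) γ

/-- Away from `i` and `i + 1` every face of the grid is such a grid one dimension lower. In these
two directions the lower faces give back `a ∘_i b`, and the upper ones are a composite of two copies
of the unit on `∂_i^+ b`. -/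
theorem compShell_conn_lower (h : C.Rel i a b c) (hi : i ≤ k) {X Y U : C.Shell (k + 1) hk}
    (hX : C.IsCompShell i (by omega) (C.connShell i (by omega) false a)
      (C.degShell (i + 1) (by omega) b) X)
    (hY : C.IsCompShell i (by omega) (C.degShell i (by omega) b)
      (C.connShell i (by omega) false b) Y) (hU : C.IsCompShell (i + 1) (by omega) X Y U) :
    C.connShell i (by omega) false c = U := by
  rw [isCompShell_succ] at hX hY hU
  funext l hl α
  by_cases hli : l < i
  · obtain ⟨k, rfl⟩ : ∃ l, k = l + 1 := ⟨k - 1, by omega⟩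
    have h₁ := (hX.2.2 l hl α).2 hli
    have h₂ := (hY.2.2 l hl α).2 hli
    have h₃ := (hU.2.2 l hl α).2 (by omega)
    simp (disch := omega) only [connShell_of_gt, degShell_of_gt] at h₁ h₂ h₃ ⊢
    -- Below `i` both directions of the grid drop by one, and the lower-dimensional law expects the
    -- second in the form `(i - 1) + 1`.
    simp only [show i + 1 - 1 = i - 1 + 1 by omega] at h₁ h₃
    exact (h.face_lt hli (by omega) α).conn_lower (by omega) h₁ h₂ h₃
  by_cases hli' : i + 1 < l
  · obtain ⟨k, rfl⟩ : ∃ l, k = l + 1 := ⟨k - 1, by omega⟩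
    have h₁ := (hX.2.2 l hl α).1 (by omega)
    have h₂ := (hY.2.2 l hl α).1 (by omega)
    have h₃ := (hU.2.2 l hl α).1 (by omega)
    simp (disch := omega) only [connShell_of_lt, degShell_of_lt] at h₁ h₂ h₃ ⊢
    exact (h.face_gt (i := l - 1) (by omega) (by omega) α).conn_lower (by omega) h₁ h₂ h₃
  rcases (show l = i ∨ l = i + 1 by omega) with rfl | rfl
  · have h₃ := (hU.2.2 l hl α).2 (by omega)
    cases α
    · rw [hX.1, hY.1] at h₃
      simp (disch := omega) only [connShell_mid, degShell_self, if_true] at h₃ ⊢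
      exact h.unique h₃
    · rw [hX.2.1, hY.2.1] at h₃
      simp (disch := omega) only [connShell_mid, degShell_of_gt, Bool.false_eq_true, if_false,
        Nat.add_sub_cancel] at h₃ ⊢
      rw [h.upper hi]
      exact (Rel.deg_left' hi (face_deg_of_eq hk rfl hi _ _)).unique h₃
  · cases α
    · have h₁ := (hX.2.2 (i + 1) hl false).1 (by omega)
      rw [hU.1]
      simp (disch := omega) only [connShell_mid, degShell_self, if_true] at h₁ ⊢
      exact h.unique h₁
    · have h₁ := (hY.2.2 (i + 1) hl true).1 (by omega)
      rw [hU.2.1]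
      simp (disch := omega) only [connShell_mid, degShell_of_lt, Bool.false_eq_true, if_false,
        Nat.add_sub_cancel] at h₁ ⊢
      rw [h.upper hi]
      exact (Rel.deg_left' hi (face_deg_of_eq hk rfl hi _ _)).unique h₁

/-- Dual to the lower sign: in the directions `i` and `i + 1` the upper faces give back `a ∘_i b`,
and the lower ones collapse to the unit on `∂_i^- a`. -/
theorem compShell_conn_upper (h : C.Rel i a b c) (hi : i ≤ k) {X Y U : C.Shell (k + 1) hk}
    (hX : C.IsCompShell i (by omega) (C.connShell i (by omega) true a)
      (C.degShell i (by omega) a) X)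
    (hY : C.IsCompShell i (by omega) (C.degShell (i + 1) (by omega) a)
      (C.connShell i (by omega) true b) Y) (hU : C.IsCompShell (i + 1) (by omega) X Y U) :
    C.connShell i (by omega) true c = U := by
  rw [isCompShell_succ] at hX hY hU
  funext l hl α
  by_cases hli : l < i
  · obtain ⟨k, rfl⟩ : ∃ l, k = l + 1 := ⟨k - 1, by omega⟩
    have h₁ := (hX.2.2 l hl α).2 hli
    have h₂ := (hY.2.2 l hl α).2 hli
    have h₃ := (hU.2.2 l hl α).2 (by omega)
    simp (disch := omega) only [connShell_of_gt, degShell_of_gt] at h₁ h₂ h₃ ⊢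
    simp only [show i + 1 - 1 = i - 1 + 1 by omega] at h₂ h₃
    exact (h.face_lt hli (by omega) α).conn_upper (by omega) h₁ h₂ h₃
  by_cases hli' : i + 1 < l
  · obtain ⟨k, rfl⟩ : ∃ l, k = l + 1 := ⟨k - 1, by omega⟩
    have h₁ := (hX.2.2 l hl α).1 (by omega)
    have h₂ := (hY.2.2 l hl α).1 (by omega)
    have h₃ := (hU.2.2 l hl α).1 (by omega)
    simp (disch := omega) only [connShell_of_lt, degShell_of_lt] at h₁ h₂ h₃ ⊢
    exact (h.face_gt (i := l - 1) (by omega) (by omega) α).conn_upper (by omega) h₁ h₂ h₃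
  rcases (show l = i ∨ l = i + 1 by omega) with rfl | rfl
  · have h₃ := (hU.2.2 l hl α).2 (by omega)
    cases α
    · rw [hX.1, hY.1] at h₃
      simp (disch := omega) only [connShell_mid, degShell_of_gt, Bool.true_eq_false, if_false,
        Nat.add_sub_cancel] at h₃ ⊢
      rw [h.lower hi]
      exact (Rel.deg_left' hi (face_deg_of_eq hk rfl hi _ _)).unique h₃
    · rw [hX.2.1, hY.2.1] at h₃
      simp (disch := omega) only [connShell_mid, degShell_self, if_true] at h₃ ⊢
      exact h.unique h₃
  · cases α
    · have h₁ := (hX.2.2 (i + 1) hl false).1 (by omega)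
      rw [hU.1]
      simp (disch := omega) only [connShell_mid, degShell_of_lt, Bool.true_eq_false, if_false,
        Nat.add_sub_cancel] at h₁ ⊢
      rw [h.lower hi]
      exact (Rel.deg_left' hi (face_deg_of_eq hk rfl hi _ _)).unique h₁
    · have h₁ := (hY.2.2 (i + 1) hl true).1 (by omega)
      rw [hU.2.1]
      simp (disch := omega) only [connShell_mid, degShell_self, if_true] at h₁ ⊢
      exact h.unique h₁

/-- In direction `i + 1` one of the two connections contributes `c` and the other a unit, so the
unit laws of `C` apply; the other transverse directions repeat the law one dimension lower. -/
theorem compShell_conn_conn (hi : i ≤ k) (c : C.cell (k + 1) hk) :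
    C.IsCompShell i (by omega) (C.connShell i (by omega) true c)
      (C.connShell i (by omega) false c) (C.degShell (i + 1) (by omega) c) := by
  rw [isCompShell_succ]
  refine ⟨?_, ?_, fun l hl α => ⟨fun hl' => ?_, fun hl' => ?_⟩⟩
  · simp (disch := omega) [degShell_of_gt, connShell_mid]
  · simp (disch := omega) [degShell_of_gt, connShell_mid]
  · by_cases hli : i + 1 < l
    · obtain ⟨k, rfl⟩ : ∃ l, k = l + 1 := ⟨k - 1, by omega⟩
      simp (disch := omega) only [degShell_of_lt, connShell_of_lt]
      exact Rel.conn_conn (by omega) _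
    · simp (disch := omega) only [degShell_self, connShell_mid]
      cases α
      · simpa using Rel.deg_left hi c
      · simpa using Rel.deg_right hi c
  · obtain ⟨k, rfl⟩ : ∃ l, k = l + 1 := ⟨k - 1, by omega⟩
    simp (disch := omega) only [degShell_of_gt, connShell_of_gt]
    simp only [show i + 1 - 1 = i - 1 + 1 by omega]
    exact Rel.conn_conn (by omega) _

theorem compShell_conn_conn_succ (hi : i ≤ k) (c : C.cell (k + 1) hk) :
    C.IsCompShell (i + 1) (by omega) (C.connShell i (by omega) true c)
      (C.connShell i (by omega) false c) (C.degShell i (by omega) c) := by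
  rw [isCompShell_succ]
  refine ⟨?_, ?_, fun l hl α => ⟨fun hl' => ?_, fun hl' => ?_⟩⟩
  · simp (disch := omega) [degShell_of_lt, connShell_mid]
  · simp (disch := omega) [degShell_of_lt, connShell_mid]
  · obtain ⟨k, rfl⟩ : ∃ l, k = l + 1 := ⟨k - 1, by omega⟩
    simp (disch := omega) only [degShell_of_lt, connShell_of_lt]
    exact Rel.conn_conn_succ (by omega) _
  · by_cases hli : l < i
    · obtain ⟨k, rfl⟩ : ∃ l, k = l + 1 := ⟨k - 1, by omega⟩
      simp (disch := omega) only [degShell_of_gt, connShell_of_gt]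
      have := Rel.conn_conn_succ (hk := hk) (i := i - 1) (by omega) (C.face l α c)
      rwa [show i - 1 + 1 = i + 1 - 1 by omega] at this
    · simp (disch := omega) only [degShell_self, connShell_mid]
      cases α
      · simpa using Rel.deg_left hi c
      · simpa using Rel.deg_right hi c

end Comp

end CubCat

end Cub

namespace Cub

namespace CubCat

variable {n : ℕ} {C : CubCat.{u} n}

/-! ### Inverses -/

variable (C) in
/-- The cell `b` is inverse to `a` in the direction `i`. -/
def Inverse {k : ℕ} {hk : k + 1 ≤ n} (i : ℕ) (hi : i ≤ k) (a b : C.cell (k + 1) hk) : Prop :=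
  C.Rel i a b (C.deg hk i (C.face i false a)) ∧ C.Rel i b a (C.deg hk i (C.face i true a))

theorem isRInvertible_iff {k : ℕ} {hk : k + 1 ≤ n} {i : ℕ} {hi : i ≤ k} {a : C.cell (k + 1) hk} :
    C.IsRInvertible i hi a ↔ ∃ b, C.Inverse i hi a b :=
  ⟨fun ⟨b, h, h', e, e'⟩ => ⟨b, ⟨hi, h, e⟩, ⟨hi, h', e'⟩⟩,
    fun ⟨b, ⟨_, h, e⟩, ⟨_, h', e'⟩⟩ => ⟨b, h, h', e, e'⟩⟩

namespace Inverse

/-- Both inverses equal the two bracketings of `b ∘_i a ∘_i b'`. -/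
theorem unique {k : ℕ} {hk : k + 1 ≤ n} {i : ℕ} {hi : i ≤ k} {a b b' : C.cell (k + 1) hk}
    (h : C.Inverse i hi a b) (h' : C.Inverse i hi a b') : b = b' :=
  h.2.assoc h'.1 (Rel.deg_right' hi (h.2.composable hi)) (Rel.deg_left' hi (h'.1.composable hi).symm)

theorem face_lt {k : ℕ} {hk : k + 2 ≤ n} {i j : ℕ} {hi : i ≤ k + 1} {a b : C.cell (k + 2) hk}
    (h : C.Inverse i hi a b) (hij : j < i) (α : Bool) :
    C.Inverse (i - 1) (by omega) (C.face j α a) (C.face j α b) := by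
  have h₁ := h.1.face_lt hij (by omega) α
  have h₂ := h.2.face_lt hij (by omega) α
  rw [face_deg_of_lt C hk hij hi, face_face_of_lt C hij hi] at h₁ h₂
  exact ⟨h₁, h₂⟩

theorem face_gt {k : ℕ} {hk : k + 2 ≤ n} {i j : ℕ} {hi : i ≤ k + 1} {a b : C.cell (k + 2) hk}
    (h : C.Inverse i hi a b) (hij : i < j) (hj : j ≤ k + 1) (α : Bool) :
    C.Inverse i (by omega) (C.face j α a) (C.face j α b) := by
  have h₁ := h.1.face_gt hij hj α
  have h₂ := h.2.face_gt hij hj α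
  rw [face_deg_of_gt C hk hij hj, ← face_face_of_lt C hij hj] at h₁ h₂
  exact ⟨h₁, h₂⟩

theorem map {D : CubCat.{u} n} (F : C ⟶ D) {k : ℕ} {hk : k + 1 ≤ n} {i : ℕ} {hi : i ≤ k}
    {a b : C.cell (k + 1) hk} (h : C.Inverse i hi a b) : D.Inverse i hi (F.map a) (F.map b) := by
  have h₁ := rel_map F h.1
  have h₂ := rel_map F h.2
  rw [F.map_deg _ _ hi, F.map_face _ hi] at h₁ h₂
  exact ⟨h₁, h₂⟩

end Inverse

theorem IsRInvertible.map {D : CubCat.{u} n} (F : C ⟶ D) {k : ℕ} {hk : k + 1 ≤ n} {i : ℕ}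
    {hi : i ≤ k} {a : C.cell (k + 1) hk} (h : C.IsRInvertible i hi a) :
    D.IsRInvertible i hi (F.map a) := by
  rw [isRInvertible_iff] at *
  obtain ⟨b, hb⟩ := h
  exact ⟨_, hb.map F⟩

variable (C) in
/-- Shells of cells with an `R_i`-invertible shell. -/
def IsRInvertibleShell : ∀ {k : ℕ} {hk : k ≤ n} (i : ℕ) (_ : i ≤ k) (_ : C.Shell k hk), Prop
  | 0, _, _, _, _ => True
  | k + 1, _, i, _, S => ∀ (j : ℕ) (hj : j ≤ k + 1) (α : Bool),
      (∀ _ : j < i, C.IsRInvertible (i - 1) (by omega) (S j hj α)) ∧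
      (∀ _ : i < j, C.IsRInvertible i (by omega) (S j hj α))

theorem hasRInvertibleShell_iff {k : ℕ} {hk : k + 1 ≤ n} {i : ℕ} {hi : i ≤ k}
    {a : C.cell (k + 1) hk} :
    C.HasRInvertibleShell i hi a ↔ C.IsRInvertibleShell i hi fun j hj α => C.face j α a hj := by
  cases k <;> rfl

theorem IsRInvertibleShell.map {D : CubCat.{u} n} (F : C ⟶ D) {k : ℕ} {hk : k ≤ n} {i : ℕ}
    {hi : i ≤ k} {S : C.Shell k hk} (h : C.IsRInvertibleShell i hi S) :
    D.IsRInvertibleShell i hi fun j hj α => F.map (S j hj α) := by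
  cases k with
  | zero => trivial
  | succ k =>
    exact fun j hj α => ⟨fun hij => IsRInvertible.map F ((h j hj α).1 hij),
      fun hij => IsRInvertible.map F ((h j hj α).2 hij)⟩

theorem HasRInvertibleShell.map {D : CubCat.{u} n} (F : C ⟶ D) {k : ℕ} {hk : k + 1 ≤ n} {i : ℕ}
    {hi : i ≤ k} {a : C.cell (k + 1) hk} (h : C.HasRInvertibleShell i hi a) :
    D.HasRInvertibleShell i hi (F.map a) := by
  rw [hasRInvertibleShell_iff] at *
  simpa only [F.map_face _ _ _ _] using h.map F

/-- The inverse shell exchanges the two faces in direction `i` and inverts those in the other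
directions. That the chosen inverses fit together into a square is forced by uniqueness of inverses,
as faces of inverses are inverses of faces. -/
theorem exists_inverse_shell {k : ℕ} {hk : k ≤ n} {i : ℕ} {hi : i ≤ k} {S : C.Shell k hk}
    (hS : C.IsSquare S) (h : C.IsRInvertibleShell i hi S) :
    ∃ T : C.Shell k hk, C.IsSquare T ∧ (∀ α, T i hi α = S i hi (!α)) ∧
      C.IsCompShell i hi S T (C.degShell i hi (S i hi false)) ∧
      C.IsCompShell i hi T S (C.degShell i hi (S i hi true)) := by
  cases k with
  | zero => exact ⟨fun _ _ α => S i hi (!α), trivial, fun _ => rfl, ⟨rfl, rfl⟩, ⟨rfl, rfl⟩⟩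
  | succ k =>
    have h₁ : ∀ j hj α (hij : j < i), ∃ b, C.Inverse (i - 1) (by omega) (S j hj α) b :=
      fun j hj α hij => isRInvertible_iff.1 ((h j hj α).1 hij)
    have h₂ : ∀ j hj α (hij : i < j), ∃ b, C.Inverse i (by omega) (S j hj α) b :=
      fun j hj α hij => isRInvertible_iff.1 ((h j hj α).2 hij)
    obtain ⟨T, hT, hT₁, hT₂⟩ : ∃ T : C.Shell (k + 1) hk, (∀ α, T i hi α = S i hi (!α)) ∧
        (∀ j hj α (_ : j < i), C.Inverse (i - 1) (by omega) (S j hj α) (T j hj α)) ∧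
        (∀ j hj α (_ : i < j), C.Inverse i (by omega) (S j hj α) (T j hj α)) := by
      refine ⟨fun j hj α => if h : j < i then (h₁ j hj α h).choose else
        if h : i < j then (h₂ j hj α h).choose else S i hi (!α), ?_, ?_, ?_⟩
      · intro α; simp
      · intro j hj α hij
        beta_reduce
        rw [dif_pos hij]
        exact (h₁ j hj α hij).choose_spec
      · intro j hj α hij
        beta_reduce
        rw [dif_neg (by omega), dif_pos hij]
        exact (h₂ j hj α hij).choose_spec
    refine ⟨T, ?_, hT, ?_, ?_⟩
    · refine square_of_face fun a b hab hb α β => ?_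
      -- When one direction is `i`, the required relation says that the outer faces of an inverse
      -- are exchanged, which is its composability with the original cell.
      by_cases hia : a = i
      · subst hia
        have := hT₂ b hb β hab
        rw [hT, square_face' hS hab hb]
        cases α
        · exact (this.1.composable _).symm
        · exact this.2.composable _
      by_cases hib : b = i
      · subst hib
        have := hT₁ a (by omega) α hab
        rw [hT, square_face hS hab hb]
        cases β
        · exact (this.1.composable _)
        · exact (this.2.composable _).symm
      -- With `a`, `b` and `i` distinct there are at least three directions, so the iterated faces
      -- still have a composition in which inverses make sense.
      obtain ⟨k, rfl⟩ : ∃ l, k = l + 1 := ⟨k - 1, by omega⟩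
      rcases lt_or_gt_of_ne hia with hia | hia
      · rcases lt_or_gt_of_ne hib with hib | hib
        · have h₃ := (hT₁ b hb β hib).face_lt (j := a) (by omega) α
          rw [square_face hS hab hb] at h₃
          exact h₃.unique ((hT₁ a (by omega) α hia).face_lt (by omega) β)
        · have h₃ := (hT₂ b hb β hib).face_lt (j := a) (by omega) α
          rw [square_face hS hab hb] at h₃
          exact h₃.unique ((hT₁ a (by omega) α hia).face_gt (by omega) (by omega) β)
      · have h₃ := (hT₂ b hb β (by omega)).face_gt (j := a) (by omega) (by omega) α
        rw [square_face hS hab hb] at h₃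
        exact h₃.unique ((hT₂ a (by omega) α hia).face_gt (by omega) (by omega) β)
    · rw [isCompShell_succ]
      refine ⟨degShell_self C rfl .., ?_, fun j hj α => ⟨fun hij => ?_, fun hij => ?_⟩⟩
      · rw [hT]; exact degShell_self C rfl ..
      · rw [degShell_of_lt C hij, square_face' hS hij]
        exact (hT₂ j hj α hij).1
      · rw [degShell_of_gt C hij, square_face hS hij hi]
        exact (hT₁ j hj α hij).1
    · rw [isCompShell_succ]
      refine ⟨?_, degShell_self C rfl .., fun j hj α => ⟨fun hij => ?_, fun hij => ?_⟩⟩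
      · rw [hT]; exact degShell_self C rfl ..
      · rw [degShell_of_lt C hij, square_face' hS hij]
        exact (hT₂ j hj α hij).2
      · rw [degShell_of_gt C hij, square_face hS hij hi]
        exact (hT₁ j hj α hij).2

/-! ### Images of shells under functors -/

section Map

variable {D : CubCat.{u} n} (F : C ⟶ D)

theorem map_degShell {k : ℕ} {hk : k ≤ n} {i : ℕ} (hi : i ≤ k) (c : C.cell k hk) (j : ℕ)
    (hj : j ≤ k) (α : Bool) :
    F.map (C.degShell i hi c j hj α) = D.degShell i hi (F.map c) j hj α := by
  cases k with
  | zero => rfl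
  | succ k =>
    rcases lt_trichotomy i j with h | rfl | h
    · rw [degShell_of_lt C h, degShell_of_lt D h, F.map_deg _ _ (by omega),
        F.map_face _ (by omega)]
    · rw [degShell_self C rfl, degShell_self D rfl]
    · rw [degShell_of_gt C h, degShell_of_gt D h, F.map_deg _ _ (by omega),
        F.map_face _ (by omega)]

theorem map_connShell {k : ℕ} {hk : k ≤ n} {i : ℕ} (hi : i < k) (γ : Bool) (c : C.cell k hk)
    (j : ℕ) (hj : j ≤ k) (α : Bool) :
    F.map (C.connShell i hi γ c j hj α) = D.connShell i hi γ (F.map c) j hj α := by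
  obtain ⟨k, rfl⟩ : ∃ l, k = l + 1 := ⟨k - 1, by omega⟩
  by_cases h : i + 1 < j
  · obtain ⟨k, rfl⟩ : ∃ l, k = l + 1 := ⟨k - 1, by omega⟩
    rw [connShell_of_lt C h, connShell_of_lt D h, F.map_conn _ _ (by omega),
      F.map_face _ (by omega)]
  by_cases h' : j < i
  · obtain ⟨k, rfl⟩ : ∃ l, k = l + 1 := ⟨k - 1, by omega⟩
    rw [connShell_of_gt C h', connShell_of_gt D h', F.map_conn _ _ (by omega),
      F.map_face _ (by omega)]
  · simp (disch := omega) only [connShell_mid]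
    split_ifs
    · rfl
    · rw [F.map_deg _ _ (by omega), F.map_face _ (by omega)]

theorem map_compShell {k : ℕ} {hk : k ≤ n} {i : ℕ} {hi : i ≤ k} {S T U : C.Shell k hk}
    (h : C.IsCompShell i hi S T U) :
    D.IsCompShell i hi (fun j hj α => F.map (S j hj α)) (fun j hj α => F.map (T j hj α))
      (fun j hj α => F.map (U j hj α)) := by
  cases k with
  | zero => exact ⟨congrArg F.map h.1, congrArg F.map h.2⟩
  | succ k =>
    rw [isCompShell_succ] at *
    exact ⟨congrArg F.map h.1, congrArg F.map h.2.1, fun j hj α =>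
      ⟨fun hij => rel_map F ((h.2.2 j hj α).1 hij), fun hij => rel_map F ((h.2.2 j hj α).2 hij)⟩⟩

theorem map_square {k : ℕ} {hk : k ≤ n} {S : C.Shell k hk} (h : C.IsSquare S) :
    D.IsSquare fun j hj α => F.map (S j hj α) := by
  cases k with
  | zero => trivial
  | succ k =>
    intro i j hij hj α β
    rw [← F.map_face _ (by omega), ← F.map_face _ (by omega), h i j hij hj α β]

end Map

end CubCat

end Cub

namespace Cub

variable {n : ℕ}

/-! ### Layers of `(n + 1)`-cells above a cubical `n`-category -/

/-- A set of `(n + 1)`-cells above a cubical `n`-category, with operations that have the prescribed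
faces. -/
structure PreLayer (C : CubCat.{u} n) where
  X : Type u
  bd : X → C.Shell n le_rfl
  deg : (i : ℕ) → i ≤ n → C.cell n le_rfl → X
  conn : (i : ℕ) → i < n → Bool → C.cell n le_rfl → X
  comp : (i : ℕ) → (hi : i ≤ n) → (a b : X) → bd a i hi true = bd b i hi false → X
  bd_square : ∀ x, C.IsSquare (bd x)
  bd_deg : ∀ i hi c, bd (deg i hi c) = C.degShell i hi c
  bd_conn : ∀ i hi α c, bd (conn i hi α c) = C.connShell i hi α c
  bd_comp : ∀ i hi a b h, C.IsCompShell i hi (bd a) (bd b) (bd (comp i hi a b h))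

/-- A layer of `(n + 1)`-cells: the operations satisfy the laws of cubical categories. -/
structure Layer (C : CubCat.{u} n) extends PreLayer C where
  assoc : ∀ i hi a b c hab hbc h h',
    comp i hi a (comp i hi b c hbc) h = comp i hi (comp i hi a b hab) c h'
  interchange : ∀ i j hi hj, i < j → ∀ a b c d hab hcd hac hbd h h',
    comp j hj (comp i hi a b hab) (comp i hi c d hcd) h =
      comp i hi (comp j hj a c hac) (comp j hj b d hbd) h'
  deg_comp_self : ∀ i hi a h, comp i hi (deg i hi (bd a i hi false)) a h = a
  comp_deg : ∀ i hi a h, comp i hi a (deg i hi (bd a i hi true)) h = a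
  deg_comp_le : ∀ (i j : ℕ) (_ : i ≤ j) {m : ℕ} (e : m + 1 = n) (hj : j ≤ m)
    (c d : C.cell (m + 1) e.le) (h : C.face j true c = C.face j false d) hi hj' h',
    deg i hi (C.cast e (C.comp j hj c d h)) =
      comp (j + 1) hj' (deg i hi (C.cast e c)) (deg i hi (C.cast e d)) h'
  deg_comp_gt : ∀ (i j : ℕ) (_ : j < i) {m : ℕ} (e : m + 1 = n) (hj : j ≤ m)
    (c d : C.cell (m + 1) e.le) (h : C.face j true c = C.face j false d) hi hj' h',
    deg i hi (C.cast e (C.comp j hj c d h)) =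
      comp j hj' (deg i hi (C.cast e c)) (deg i hi (C.cast e d)) h'
  deg_deg : ∀ (i j : ℕ) (_ : i ≤ j) {m : ℕ} (e : m + 1 = n) (hj : j ≤ m)
    (c : C.cell m (by omega)),
    deg i (by omega) (C.cast e (C.deg e.le j c)) =
      deg (j + 1) (by omega) (C.cast e (C.deg e.le i c))
  conn_comp_lt : ∀ (i j : ℕ) (_ : i < j) (α : Bool) {m : ℕ} (e : m + 1 = n) (hj : j ≤ m)
    (c d : C.cell (m + 1) e.le) (h : C.face j true c = C.face j false d) hi hj' h',
    conn i hi α (C.cast e (C.comp j hj c d h)) =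
      comp (j + 1) hj' (conn i hi α (C.cast e c)) (conn i hi α (C.cast e d)) h'
  conn_comp_lower : ∀ (i : ℕ) {m : ℕ} (e : m + 1 = n) (hi : i ≤ m)
    (c d : C.cell (m + 1) e.le) (h : C.face i true c = C.face i false d) hi₀ hi₁ hi₂ h₁ h₂ h₃,
    conn i hi₀ false (C.cast e (C.comp i hi c d h)) =
      comp (i + 1) hi₂ (comp i hi₁ (conn i hi₀ false (C.cast e c)) (deg (i + 1) hi₂ (C.cast e d)) h₁)
        (comp i hi₁ (deg i hi₁ (C.cast e d)) (conn i hi₀ false (C.cast e d)) h₂) h₃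
  conn_comp_upper : ∀ (i : ℕ) {m : ℕ} (e : m + 1 = n) (hi : i ≤ m)
    (c d : C.cell (m + 1) e.le) (h : C.face i true c = C.face i false d) hi₀ hi₁ hi₂ h₁ h₂ h₃,
    conn i hi₀ true (C.cast e (C.comp i hi c d h)) =
      comp (i + 1) hi₂ (comp i hi₁ (conn i hi₀ true (C.cast e c)) (deg i hi₁ (C.cast e c)) h₁)
        (comp i hi₁ (deg (i + 1) hi₂ (C.cast e c)) (conn i hi₀ true (C.cast e d)) h₂) h₃
  conn_comp_gt : ∀ (i j : ℕ) (_ : j < i) {m : ℕ} (e : m + 1 = n) (_ : i ≤ m) (α : Bool)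
    (c d : C.cell (m + 1) e.le) (hj : j ≤ m) (h : C.face j true c = C.face j false d) hi hj' h',
    conn i hi α (C.cast e (C.comp j hj c d h)) =
      comp j hj' (conn i hi α (C.cast e c)) (conn i hi α (C.cast e d)) h'
  conn_comp_conn : ∀ (i : ℕ) (hi : i < n) (c : C.cell n le_rfl) hi₁ hi₂ h,
    comp i hi₁ (conn i hi true c) (conn i hi false c) h = deg (i + 1) hi₂ c
  conn_comp_conn_succ : ∀ (i : ℕ) (hi : i < n) (c : C.cell n le_rfl) hi₁ hi₂ h,
    comp (i + 1) hi₂ (conn i hi true c) (conn i hi false c) h = deg i hi₁ c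
  conn_deg_lt : ∀ (i j : ℕ) (_ : i < j) (α : Bool) {m : ℕ} (e : m + 2 = n) (hj : j ≤ m + 1)
    (c : C.cell (m + 1) (by omega)),
    conn i (by omega) α (C.cast e (C.deg e.le j c)) =
      deg (j + 1) (by omega) (C.cast e (C.conn e.le i α c))
  conn_deg_eq : ∀ (i : ℕ) (α : Bool) {m : ℕ} (e : m + 1 = n) (hi : i ≤ m)
    (c : C.cell m (by omega)),
    conn i (by omega) α (C.cast e (C.deg e.le i c)) =
      deg i (by omega) (C.cast e (C.deg e.le i c))
  conn_deg_gt : ∀ (i j : ℕ) (_ : j < i) (α : Bool) {m : ℕ} (e : m + 2 = n) (hi : i ≤ m + 1)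
    (c : C.cell (m + 1) (by omega)),
    conn i (by omega) α (C.cast e (C.deg e.le j c)) =
      deg j (by omega) (C.cast e (C.conn e.le (i - 1) α c))
  conn_conn_lt : ∀ (i j : ℕ) (_ : i < j) (α β : Bool) {m : ℕ} (e : m + 2 = n) (hj : j ≤ m)
    (c : C.cell (m + 1) (by omega)),
    conn i (by omega) α (C.cast e (C.conn e.le j β c)) =
      conn (j + 1) (by omega) β (C.cast e (C.conn e.le i α c))
  conn_conn_eq : ∀ (i : ℕ) (α : Bool) {m : ℕ} (e : m + 2 = n) (hi : i ≤ m)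
    (c : C.cell (m + 1) (by omega)),
    conn i (by omega) α (C.cast e (C.conn e.le i α c)) =
      conn (i + 1) (by omega) α (C.cast e (C.conn e.le i α c))

/-- Morphisms of layers over a functor. -/
@[ext]
structure PreLayer.Hom {C D : CubCat.{u} n} (F : C ⟶ D) (T : PreLayer C) (T' : PreLayer D) where
  map : T.X → T'.X
  bd_map : ∀ x i hi α, T'.bd (map x) i hi α = F.map (T.bd x i hi α)
  map_deg : ∀ i hi c, map (T.deg i hi c) = T'.deg i hi (F.map c)
  map_conn : ∀ i hi α c, map (T.conn i hi α c) = T'.conn i hi α (F.map c)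
  map_comp : ∀ i hi a b h h', map (T.comp i hi a b h) = T'.comp i hi (map a) (map b) h'

namespace PreLayer

variable {C D : CubCat.{u} n} (T : PreLayer C)

/-- The cell `b` is inverse to `a` in the direction `i`. -/
def Inverse (i : ℕ) (hi : i ≤ n) (a b : T.X) : Prop :=
  ∃ h h', T.comp i hi a b h = T.deg i hi (T.bd a i hi false) ∧
    T.comp i hi b a h' = T.deg i hi (T.bd a i hi true)

/-- Every cell whose shell is invertible in some direction is invertible in that direction. -/
def InvertsShells : Prop :=
  ∀ (i : ℕ) (hi : i ≤ n) (a : T.X), C.IsRInvertibleShell i hi (T.bd a) → ∃ b, T.Inverse i hi a b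

variable {T}

theorem comp_congr {i : ℕ} {hi : i ≤ n} {a a' b b' : T.X} (ha : a = a') (hb : b = b')
    (h : T.bd a i hi true = T.bd b i hi false) (h' : T.bd a' i hi true = T.bd b' i hi false) :
    T.comp i hi a b h = T.comp i hi a' b' h' := by
  subst ha hb; rfl

theorem bd_comp_lower {i : ℕ} {hi : i ≤ n} {a b : T.X} (h) :
    T.bd (T.comp i hi a b h) i hi false = T.bd a i hi false :=
  CubCat.compShell_lower (T.bd_comp i hi a b h)

theorem bd_comp_upper {i : ℕ} {hi : i ≤ n} {a b : T.X} (h) :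
    T.bd (T.comp i hi a b h) i hi true = T.bd b i hi true :=
  CubCat.compShell_upper (T.bd_comp i hi a b h)

theorem bd_deg_self {i : ℕ} {hi : i ≤ n} {c : C.cell n le_rfl} (α : Bool) :
    T.bd (T.deg i hi c) i hi α = c := by
  rw [T.bd_deg, CubCat.degShell_self C rfl]

theorem Hom.composable {T' : PreLayer D} {F : C ⟶ D} (f : Hom F T T') {i : ℕ} {hi : i ≤ n}
    {a b : T.X} (h : T.bd a i hi true = T.bd b i hi false) :
    T'.bd (f.map a) i hi true = T'.bd (f.map b) i hi false := by
  rw [f.bd_map, f.bd_map, h]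

theorem Inverse.map {T' : PreLayer D} {F : C ⟶ D} (f : Hom F T T') {i : ℕ} {hi : i ≤ n}
    {a b : T.X} (h : T.Inverse i hi a b) : T'.Inverse i hi (f.map a) (f.map b) := by
  obtain ⟨h, h', e, e'⟩ := h
  refine ⟨f.composable h, f.composable h', ?_, ?_⟩
  · rw [← f.map_comp i hi a b h, e, f.map_deg, f.bd_map]
  · rw [← f.map_comp i hi b a h', e', f.map_deg, f.bd_map]

end PreLayer

/-- The two bracketings of `b ∘_i a ∘_i b'` are compared as in a cubical category. This is what
makes the value of a formal inverse well defined. -/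
theorem Layer.inverse_unique {C : CubCat.{u} n} (T : Layer C) {i : ℕ} {hi : i ≤ n} {a b b' : T.X}
    (h : T.Inverse i hi a b) (h' : T.Inverse i hi a b') : b = b' := by
  obtain ⟨h₁, h₂, -, e⟩ := h
  obtain ⟨h₁', h₂', e', -⟩ := h'
  have k₁ : T.bd b i hi true = T.bd (T.comp i hi a b' h₁') i hi false := by
    rw [PreLayer.bd_comp_lower, h₂]
  have k₂ : T.bd (T.comp i hi b a h₂) i hi true = T.bd b' i hi false := by
    rw [PreLayer.bd_comp_upper, h₁']
  have := T.assoc i hi b a b' h₂ h₁' k₁ k₂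
  have k₃ : T.bd b i hi true = T.bd (T.deg i hi (T.bd b i hi true)) i hi false :=
    (PreLayer.bd_deg_self _).symm
  have k₄ : T.bd (T.deg i hi (T.bd b' i hi false)) i hi true = T.bd b' i hi false :=
    PreLayer.bd_deg_self _
  rw [PreLayer.comp_congr rfl (e'.trans (by rw [h₂])) _ k₃,
    PreLayer.comp_congr (e.trans (by rw [h₁'])) rfl _ k₄, T.comp_deg, T.deg_comp_self] at this
  exact this

/-! ### The layer of all squares -/

open CubCat

/-- The layer of all `n`-squares. -/
noncomputable def coskPre (C : CubCat.{u} n) : PreLayer C where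
  X := {S : C.Shell n le_rfl // C.IsSquare S}
  bd S := S.1
  deg i hi c := ⟨C.degShell i hi c, square_deg hi c⟩
  conn i hi α c := ⟨C.connShell i hi α c, square_conn hi α c⟩
  comp _ _ S T h := ⟨(exists_compShell S.2 T.2 h).choose,
    compShell_square S.2 T.2 (exists_compShell S.2 T.2 h).choose_spec⟩
  bd_square S := S.2
  bd_deg _ _ _ := rfl
  bd_conn _ _ _ _ := rfl
  bd_comp _ _ S T h := (exists_compShell S.2 T.2 h).choose_spec

/-- The layer of all `n`-squares. -/
noncomputable def cosk (C : CubCat.{u} n) : Layer C where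
  __ := coskPre C
  assoc i hi a b c hab hbc h h' := Subtype.ext <|
    compShell_assoc ((coskPre C).bd_comp _ _ _ _ hab) ((coskPre C).bd_comp _ _ _ _ hbc)
      ((coskPre C).bd_comp _ _ _ _ h) ((coskPre C).bd_comp _ _ _ _ h')
  interchange i j hi hj hij a b c d hab hcd hac hbd h h' := Subtype.ext <|
    compShell_interchange hij ((coskPre C).bd_comp _ _ _ _ hab) ((coskPre C).bd_comp _ _ _ _ hcd)
      ((coskPre C).bd_comp _ _ _ _ hac) ((coskPre C).bd_comp _ _ _ _ hbd)
      ((coskPre C).bd_comp _ _ _ _ h) ((coskPre C).bd_comp _ _ _ _ h')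
  deg_comp_self i hi a h := Subtype.ext <|
    compShell_unique ((coskPre C).bd_comp _ _ _ _ h) (compShell_deg_left a.2)
  comp_deg i hi a h := Subtype.ext <|
    compShell_unique ((coskPre C).bd_comp _ _ _ _ h) (compShell_deg_right a.2)
  deg_comp_le := by
    rintro i j hij m rfl hj c d h hi hj' h'
    exact Subtype.ext <| compShell_unique (compShell_deg_le (.mk' hj h) hij hj)
      ((coskPre C).bd_comp _ _ _ _ h')
  deg_comp_gt := by
    rintro i j hij m rfl hj c d h hi hj' h'
    exact Subtype.ext <| compShell_unique (compShell_deg_gt (.mk' hj h) hij hi)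
      ((coskPre C).bd_comp _ _ _ _ h')
  deg_deg := by
    rintro i j hij m rfl hj c
    exact Subtype.ext <| degShell_deg hij hj c
  conn_comp_lt := by
    rintro i j hij α m rfl hj c d h hi hj' h'
    exact Subtype.ext <| compShell_unique (compShell_conn_lt (.mk' hj h) hij hj α)
      ((coskPre C).bd_comp _ _ _ _ h')
  conn_comp_lower := by
    rintro i m rfl hi c d h - - - h₁ h₂ h₃
    exact Subtype.ext <| compShell_conn_lower (.mk' hi h) hi ((coskPre C).bd_comp _ _ _ _ h₁)
      ((coskPre C).bd_comp _ _ _ _ h₂) ((coskPre C).bd_comp _ _ _ _ h₃)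
  conn_comp_upper := by
    rintro i m rfl hi c d h - - - h₁ h₂ h₃
    exact Subtype.ext <| compShell_conn_upper (.mk' hi h) hi ((coskPre C).bd_comp _ _ _ _ h₁)
      ((coskPre C).bd_comp _ _ _ _ h₂) ((coskPre C).bd_comp _ _ _ _ h₃)
  conn_comp_gt := by
    rintro i j hij m rfl hi α c d hj h hi' hj' h'
    exact Subtype.ext <| compShell_unique (compShell_conn_gt (.mk' (by omega) h) hij hi α)
      ((coskPre C).bd_comp _ _ _ _ h')
  conn_comp_conn := by
    intro i hi c _ _ h
    obtain ⟨m, rfl⟩ : ∃ m, n = m + 1 := ⟨n - 1, by omega⟩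
    exact Subtype.ext <| compShell_unique ((coskPre C).bd_comp _ _ _ _ h)
      (compShell_conn_conn (by omega) c)
  conn_comp_conn_succ := by
    intro i hi c _ _ h
    obtain ⟨m, rfl⟩ : ∃ m, n = m + 1 := ⟨n - 1, by omega⟩
    exact Subtype.ext <| compShell_unique ((coskPre C).bd_comp _ _ _ _ h)
      (compShell_conn_conn_succ (by omega) c)
  conn_deg_lt := by
    rintro i j hij α m rfl hj c
    exact Subtype.ext <| connShell_deg_lt hij hj α c
  conn_deg_eq := by
    rintro i α m rfl hi c
    exact Subtype.ext <| connShell_deg_self hi α c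
  conn_deg_gt := by
    rintro i j hij α m rfl hi c
    exact Subtype.ext <| connShell_deg_gt hij hi α c
  conn_conn_lt := by
    rintro i j hij α β m rfl hj c
    exact Subtype.ext <| connShell_conn_lt hij hj α β c
  conn_conn_eq := by
    rintro i α m rfl hi c
    exact Subtype.ext <| connShell_conn_self hi α c

/-- Squares are therefore admissible as values of terms with formal inverses, whatever `p` is;
boundaries of such terms are read off there. -/
theorem cosk_invertsShells (C : CubCat.{u} n) : (cosk C).InvertsShells := by
  rintro i hi ⟨S, hS⟩ h
  obtain ⟨T, hT, hT', h₁, h₂⟩ := exists_inverse_shell hS h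
  have k₁ : S i hi true = T i hi false := (hT' false).symm
  have k₂ : T i hi true = S i hi false := hT' true
  exact ⟨⟨T, hT⟩, k₁, k₂,
    Subtype.ext (compShell_unique ((coskPre C).bd_comp i hi ⟨S, hS⟩ ⟨T, hT⟩ k₁) h₁),
    Subtype.ext (compShell_unique ((coskPre C).bd_comp i hi ⟨T, hT⟩ ⟨S, hS⟩ k₂) h₂)⟩

/-- The morphism sending a cell to its shell, over a functor. -/
noncomputable def PreLayer.toCosk {C D : CubCat.{u} n} (F : C ⟶ D) (T : PreLayer C) :
    PreLayer.Hom F T (cosk D).toPreLayer where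
  map x := ⟨fun j hj α => F.map (T.bd x j hj α), map_square F (T.bd_square x)⟩
  bd_map _ _ _ _ := rfl
  map_deg i hi c := Subtype.ext <| by
    funext j hj α
    exact (congrArg (fun S : C.Shell n le_rfl => F.map (S j hj α)) (T.bd_deg i hi c)).trans (map_degShell F hi c j hj α)
  map_conn i hi γ c := Subtype.ext <| by
    funext j hj α
    exact (congrArg (fun S : C.Shell n le_rfl => F.map (S j hj α)) (T.bd_conn i hi γ c)).trans (map_connShell F hi γ c j hj α)
  map_comp i hi a b h h' := Subtype.ext <|
    compShell_unique (map_compShell F (T.bd_comp i hi a b h)) ((coskPre D).bd_comp _ _ _ _ h')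

end Cub

namespace Cub

open CubCat

variable {n : ℕ}

/-! ### The top layer of a cubical `(n + 1)`-category -/

/-- The connections of `n`-cells in a cubical `(n + 1)`-category. -/
def CubCat.topConn : ∀ {n : ℕ} (D : CubCat.{u} (n + 1)) (i : ℕ) (_ : i < n) (_ : Bool)
    (_ : D.cell n (Nat.le_succ n)), D.cell (n + 1) le_rfl
  | 0, _, _, hi, _, _ => absurd hi (Nat.not_lt_zero _)
  | _ + 1, D, i, _, α, c => D.conn le_rfl i α c

/-- The `(n + 1)`-cells of a cubical `(n + 1)`-category, as a layer above its truncation. -/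
def topLayer (D : CubCat.{u} (n + 1)) : Layer ((trunc n).obj D) where
  X := D.cell (n + 1) le_rfl
  bd x i hi α := D.face i α x hi
  deg i hi c := D.deg le_rfl i c hi
  conn i hi α c := D.topConn i hi α c
  comp i hi a b h := D.comp i hi a b h
  bd_square := ((W n).obj D).ext.bd_square
  bd_deg i hi c := by
    funext j hj α
    rcases n with _ | n
    · obtain rfl : i = j := by omega
      exact D.face_deg_eq le_rfl i hi α c
    · rcases lt_trichotomy i j with h | rfl | h
      · rw [degShell_of_lt _ h]
        exact D.face_deg_of_gt le_rfl h hj α c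
      · rw [degShell_self _ rfl]
        exact D.face_deg_eq le_rfl i hi α c
      · rw [degShell_of_gt _ h]
        exact D.face_deg_of_lt le_rfl h hi α c
  bd_conn i hi γ c := by
    funext j hj α
    obtain ⟨n, rfl⟩ : ∃ m, n = m + 1 := ⟨n - 1, by omega⟩
    by_cases h : i + 1 < j
    · obtain ⟨n, rfl⟩ : ∃ m, n = m + 1 := ⟨n - 1, by omega⟩
      rw [connShell_of_lt _ h]
      exact D.face_conn_of_gt le_rfl h hj α γ c
    by_cases h' : j < i
    · obtain ⟨n, rfl⟩ : ∃ m, n = m + 1 := ⟨n - 1, by omega⟩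
      rw [connShell_of_gt _ h']
      exact D.face_conn_of_lt le_rfl h' (by omega) α γ c
    · rw [connShell_mid _ (by omega) (by omega)]
      exact D.face_conn_mid le_rfl (by omega) (by omega) (by omega) α γ c
  bd_comp i hi a b h := by
    rcases n with _ | n
    · exact ⟨D.face_comp_lower i hi a b h, D.face_comp_upper i hi a b h⟩
    · rw [isCompShell_succ]
      exact ⟨D.face_comp_lower i hi a b h, D.face_comp_upper i hi a b h, fun j hj α =>
        ⟨fun hij => (Rel.mk' (C := D) hi h).face_gt hij hj α,
          fun hij => (Rel.mk' (C := D) hi h).face_lt hij hj α⟩⟩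
  assoc i hi a b c hab hbc h h' := D.comp_assoc i hi a b c hab hbc h h'
  interchange i j hi hj hij a b c d hab hcd hac hbd h h' :=
    D.interchange i j (by omega) hi hj a b c d hab hcd hac hbd h h'
  deg_comp_self i hi a h := D.deg_comp_self i hi a h
  comp_deg i hi a h := D.comp_deg i hi a h
  deg_comp_le := by
    rintro i j hij m rfl hj c d h hi hj' h'
    exact D.deg_comp_le le_rfl i j hij hj c d h h'
  deg_comp_gt := by
    rintro i j hij m rfl hj c d h hi hj' h'
    exact D.deg_comp_gt le_rfl i j hij hi c d h h'
  deg_deg := by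
    rintro i j hij m rfl hj c
    exact D.deg_deg le_rfl i j hij hj c
  conn_comp_lt := by
    rintro i j hij α m rfl hj c d h hi hj' h'
    exact D.conn_comp_lt le_rfl i j hij hj α c d h h'
  conn_comp_lower := by
    rintro i m rfl hi c d h - - - h₁ h₂ h₃
    exact D.conn_comp_lower le_rfl i hi c d h h₁ h₂ h₃
  conn_comp_upper := by
    rintro i m rfl hi c d h - - - h₁ h₂ h₃
    exact D.conn_comp_upper le_rfl i hi c d h h₁ h₂ h₃
  conn_comp_gt := by
    rintro i j hij m rfl hi α c d hj h hi' hj' h'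
    exact D.conn_comp_gt le_rfl i j hij hi α c d h h'
  conn_comp_conn := by
    intro i hi c _ _ h
    obtain ⟨m, rfl⟩ : ∃ m, n = m + 1 := ⟨n - 1, by omega⟩
    exact D.conn_comp_conn le_rfl i (by omega) c h
  conn_comp_conn_succ := by
    intro i hi c _ _ h
    obtain ⟨m, rfl⟩ : ∃ m, n = m + 1 := ⟨n - 1, by omega⟩
    exact D.conn_comp_conn_succ le_rfl i (by omega) c h
  conn_deg_lt := by
    rintro i j hij α m rfl hj c
    exact D.conn_deg_lt le_rfl i j hij hj α c
  conn_deg_eq := by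
    rintro i α m rfl hi c
    exact D.conn_deg_eq le_rfl i hi α c
  conn_deg_gt := by
    rintro i j hij α m rfl hi c
    exact D.conn_deg_of_gt le_rfl hij hi α c
  conn_conn_lt := by
    rintro i j hij α β m rfl hj c
    exact D.conn_conn_lt le_rfl i j hij hj α β c
  conn_conn_eq := by
    rintro i α m rfl hi c
    exact D.conn_conn_eq le_rfl i hi α c

/-! ### The cubical `(n + 1)`-category given by a layer -/

section

variable {C : CubCat.{u} n}

/-- The `k`-cells of the cubical category given by a layer. -/
inductive PreLayer.Cell (T : PreLayer C) (k : ℕ) : Type u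
  | low (h : k ≤ n) (c : C.cell k h) : Cell T k
  | top (e : k = n + 1) (x : T.X) : Cell T k

namespace PreLayer.Cell

variable {T : PreLayer C} {k : ℕ}

/-- For a top cell the equality `k = n` is only propositional, so the faces are transported by
`cast`. -/
def face (i : ℕ) (α : Bool) (x : T.Cell (k + 1)) (hi : i ≤ k) : T.Cell k :=
  match x with
  | low h c => low (by omega) (C.face i α c)
  | top e x => low (by omega) (C.cast (k := n) (by omega) (T.bd x i (by omega) α))

/-- A degeneracy stays in the base unless its argument has dimension exactly `n`, in which case it
is an operation of the layer. -/
def deg (hk : k + 1 ≤ n + 1) (i : ℕ) (x : T.Cell k) (hi : i ≤ k) : T.Cell (k + 1) :=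
  match x with
  | low h c => if h' : k + 1 ≤ n then low h' (C.deg h' i c) else
      top (by omega) (T.deg i (by omega) (C.cast (by omega) c))
  | top e x => absurd e (by omega)

def conn (hk : k + 2 ≤ n + 1) (i : ℕ) (α : Bool) (x : T.Cell (k + 1)) (hi : i ≤ k) :
    T.Cell (k + 2) :=
  match x with
  | low h c => if h' : k + 2 ≤ n then low h' (C.conn h' i α c) else
      top (by omega) (T.conn i (by omega) α (C.cast (by omega) c))
  | top e x => absurd e (by omega)

theorem top_composable {e : k + 1 = n + 1} {a b : T.X} {i : ℕ} {hi : i ≤ k}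
    (h : face i true (top (T := T) e a) hi = face i false (top e b) hi) :
    T.bd a i (by omega) true = T.bd b i (by omega) false := by
  obtain rfl : k = n := by omega
  exact low.inj h

def comp (i : ℕ) (hi : i ≤ k) (a b : T.Cell (k + 1)) (h : face i true a hi = face i false b hi) :
    T.Cell (k + 1) :=
  match a, b, h with
  | low h' a, low _ b, h => low h' (C.comp i hi a b (low.inj h))
  | top e a, top _ b, h => top e (T.comp i (by omega) a b (top_composable h))
  | low h' _, top e _, _ => absurd e (by omega)
  | top e _, low h' _, _ => absurd e (by omega)

theorem deg_low {i : ℕ} {hi : i ≤ k} (h : k ≤ n) (h' : k + 1 ≤ n) (c : C.cell k h) :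
    deg (T := T) (by omega) i (low h c) hi = low h' (C.deg h' i c) := dif_pos h'

theorem deg_top {i : ℕ} {hi : i ≤ n} (c : C.cell n le_rfl) :
    deg (T := T) le_rfl i (low le_rfl c) hi = top rfl (T.deg i hi c) := dif_neg (by omega)

theorem conn_low {i : ℕ} {hi : i ≤ k} {α : Bool} (h : k + 1 ≤ n) (h' : k + 2 ≤ n)
    (c : C.cell (k + 1) h) :
    conn (T := T) (by omega) i α (low h c) hi = low h' (C.conn h' i α c) := dif_pos h'

end PreLayer.Cell

theorem PreLayer.Cell.conn_top {n : ℕ} {C : CubCat.{u} (n + 1)} {T : PreLayer C} {i : ℕ}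
    {hi : i ≤ n} {α : Bool} (c : C.cell (n + 1) le_rfl) :
    conn (T := T) le_rfl i α (low le_rfl c) hi = top rfl (T.conn i (by omega) α c) :=
  dif_neg (by omega)

end

end Cub

namespace Cub

open CubCat

namespace PreLayer.Cell

section

variable {n : ℕ} {C : CubCat.{u} n} {T : PreLayer C} {k : ℕ}

theorem face_low {i : ℕ} {hi : i ≤ k} {α : Bool} (h : k + 1 ≤ n) (c : C.cell (k + 1) h) :
    face (T := T) i α (low h c) hi = low (by omega) (C.face i α c) := rfl

theorem face_top {i : ℕ} {hi : i ≤ n} {α : Bool} (x : T.X) :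
    face (T := T) i α (top rfl x) hi = low le_rfl (T.bd x i hi α) := rfl

theorem comp_low {i : ℕ} {hi : i ≤ k} (h : k + 1 ≤ n) (a b : C.cell (k + 1) h) (h') :
    comp (T := T) i hi (low h a) (low h b) h' = low h (C.comp i hi a b (low.inj h')) := rfl

theorem comp_top {i : ℕ} {hi : i ≤ n} (a b : T.X) (h') :
    comp (T := T) i hi (top rfl a) (top rfl b) h' = top rfl (T.comp i hi a b (low.inj h')) := rfl

end

end PreLayer.Cell

/-- The data of the cubical `(n + 1)`-category given by a layer. -/
@[reducible] def PreLayer.toCubData {n : ℕ} {C : CubCat.{u} n} (T : PreLayer C) :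
    CubData.{u} (n + 1) where
  cell k _ := T.Cell k
  face i α x hi := Cell.face i α x hi
  deg hk i x hi := Cell.deg hk i x hi
  comp i hi a b h := Cell.comp i hi a b h
  conn hk i α x hi := Cell.conn hk i α x hi

namespace Layer

open PreLayer PreLayer.Cell

variable {n : ℕ} {C : CubCat.{u} n} (T : Layer C)

/-- The cubical `(n + 1)`-category given by a layer. -/
def toCubCat : CubCat.{u} (n + 1) where
  __ := T.toCubData
  -- Each law splits by dimension: below the top it is a law of `C`, at the top it comes from the
  -- layer, either as one of its laws or through its prescribed boundaries. The remaining
  -- combinations are excluded by arithmetic.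
  face_face := by
    rintro k hk i j hij hj α β (⟨h, c⟩ | ⟨e, x⟩)
    · exact congrArg (low _) (C.face_face i j hij hj α β c)
    · obtain rfl : n = k + 1 := by omega
      exact congrArg (low _) (T.bd_square x i j hij hj α β)
  face_deg_lt := by
    rintro k hk i j hij hj α (⟨h, c⟩ | ⟨e, x⟩)
    · by_cases h' : k + 2 ≤ n
      · simp only [face_low, deg_low _ h', deg_low _ h, C.face_deg_lt h' i j hij hj]
      · obtain rfl : n = k + 1 := by omega
        simp only [deg_top, face_top, face_low, deg_low _ h, T.bd_deg]
        rw [degShell_of_gt _ (by omega)]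
        rfl
    · omega
  face_deg_eq := by
    rintro k hk i hi α (⟨h, c⟩ | ⟨e, x⟩)
    · by_cases h' : k + 1 ≤ n
      · simp only [face_low, deg_low _ h', C.face_deg_eq h' i hi]
      · obtain rfl : n = k := by omega
        simp only [deg_top, face_top, T.bd_deg]
        rw [degShell_self _ rfl]
    · omega
  face_deg_gt := by
    rintro k hk i j hij hj α (⟨h, c⟩ | ⟨e, x⟩)
    · by_cases h' : k + 2 ≤ n
      · simp only [face_low, deg_low _ h', deg_low _ h, C.face_deg_gt h' i j hij hj]
      · obtain rfl : n = k + 1 := by omega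
        simp only [deg_top, face_top, face_low, deg_low _ h, T.bd_deg]
        rw [degShell_of_lt _ (by omega)]
        rfl
    · omega
  deg_deg := by
    rintro k hk i j hij hj (⟨h, c⟩ | ⟨e, x⟩)
    · by_cases h' : k + 2 ≤ n
      · simp only [deg_low _ h', deg_low _ (show k + 1 ≤ n by omega), C.deg_deg h' i j hij hj]
      · obtain rfl : n = k + 1 := by omega
        simp only [deg_top, deg_low _ le_rfl]
        exact congrArg (top _) (T.deg_deg i j hij rfl hj c)
    · omega
  face_comp_lt := by
    rintro k hk i j hij hj α (⟨h, a⟩ | ⟨e, a⟩) (⟨h', b⟩ | ⟨e', b⟩) h₁ h₂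
    · exact congrArg (low _) (C.face_comp_lt i j hij hj α a b (low.inj h₁) (low.inj h₂))
    · omega
    · omega
    · obtain rfl : n = k + 1 := by omega
      have := (((isCompShell_succ _ _).1 (T.bd_comp (j + 1) (by omega) a b (low.inj h₁))).2.2
        i (by omega) α).2 (by omega)
      exact congrArg (low _) (this.unique (.mk' (by omega) (low.inj h₂)))
  face_comp_lower := by
    rintro k hk i hi (⟨h, a⟩ | ⟨e, a⟩) (⟨h', b⟩ | ⟨e', b⟩) h₁
    · exact congrArg (low _) (C.face_comp_lower i hi a b (low.inj h₁))
    · omega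
    · omega
    · obtain rfl : n = k := by omega
      exact congrArg (low _) (PreLayer.bd_comp_lower _)
  face_comp_upper := by
    rintro k hk i hi (⟨h, a⟩ | ⟨e, a⟩) (⟨h', b⟩ | ⟨e', b⟩) h₁
    · exact congrArg (low _) (C.face_comp_upper i hi a b (low.inj h₁))
    · omega
    · omega
    · obtain rfl : n = k := by omega
      exact congrArg (low _) (PreLayer.bd_comp_upper _)
  face_comp_gt := by
    rintro k hk i j hij hi α (⟨h, a⟩ | ⟨e, a⟩) (⟨h', b⟩ | ⟨e', b⟩) h₁ h₂
    · exact congrArg (low _) (C.face_comp_gt i j hij hi α a b (low.inj h₁) (low.inj h₂))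
    · omega
    · omega
    · obtain rfl : n = k + 1 := by omega
      have := (((isCompShell_succ _ _).1 (T.bd_comp j (by omega) a b (low.inj h₁))).2.2
        (i + 1) (by omega) α).1 (by omega)
      exact congrArg (low _) (this.unique (.mk' (by omega) (low.inj h₂)))
  comp_assoc := by
    rintro k hk i hi (⟨h, a⟩ | ⟨e, a⟩) (⟨h', b⟩ | ⟨e', b⟩) (⟨h'', c⟩ | ⟨e'', c⟩) h₁ h₂ h₃ h₄ <;>
      try omega
    · exact congrArg (low _) (C.comp_assoc i hi a b c _ _ (low.inj h₃) (low.inj h₄))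
    · obtain rfl : n = k := by omega
      exact congrArg (top _) (T.assoc i hi a b c _ _ (low.inj h₃) (low.inj h₄))
  interchange := by
    rintro k hk i j hij hi hj (⟨h, a⟩ | ⟨e, a⟩) (⟨h', b⟩ | ⟨e', b⟩) (⟨h'', c⟩ | ⟨e'', c⟩)
      (⟨h''', d⟩ | ⟨e''', d⟩) h₁ h₂ h₃ h₄ h₅ h₆ <;> try omega
    · exact congrArg (low _) (C.interchange i j hij hi hj a b c d _ _ _ _ (low.inj h₅) (low.inj h₆))
    · obtain rfl : n = k := by omega
      -- Layers state interchange for `i < j` only; the other order is the same equation read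
      -- backwards with `b` and `c` exchanged.
      rcases lt_or_gt_of_ne hij with hij | hij
      · exact congrArg (top _)
          (T.interchange i j hi hj hij a b c d _ _ _ _ (low.inj h₅) (low.inj h₆))
      · exact congrArg (top _)
          (T.interchange j i hj hi hij a c b d _ _ _ _ (low.inj h₆) (low.inj h₅)).symm
  comp_deg := by
    rintro k hk i hi (⟨h, a⟩ | ⟨e, a⟩) h₁
    · simp only [face_low, deg_low _ h, comp_low, C.comp_deg i hi]
    · obtain rfl : n = k := by omega
      simp only [face_top, deg_top, comp_top, T.comp_deg]
  deg_comp_self := by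
    rintro k hk i hi (⟨h, a⟩ | ⟨e, a⟩) h₁
    · simp only [face_low, deg_low _ h, comp_low, C.deg_comp_self i hi]
    · obtain rfl : n = k := by omega
      simp only [face_top, deg_top, comp_top, T.deg_comp_self]
  deg_comp_le := by
    rintro k hk i j hij hj (⟨h, a⟩ | ⟨e, a⟩) (⟨h', b⟩ | ⟨e', b⟩) h₁ h₂ <;> try omega
    by_cases h'' : k + 2 ≤ n
    · simp only [comp_low, deg_low _ h''] at h₂ ⊢
      exact congrArg (low _) (C.deg_comp_le h'' i j hij hj a b _ (low.inj h₂))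
    · obtain rfl : n = k + 1 := by omega
      simp only [comp_low, deg_top, comp_top] at h₂ ⊢
      exact congrArg (top _) (T.deg_comp_le i j hij rfl hj a b _ _ _ (low.inj h₂))
  deg_comp_gt := by
    rintro k hk i j hij hi (⟨h, a⟩ | ⟨e, a⟩) (⟨h', b⟩ | ⟨e', b⟩) h₁ h₂ <;> try omega
    by_cases h'' : k + 2 ≤ n
    · simp only [comp_low, deg_low _ h''] at h₂ ⊢
      exact congrArg (low _) (C.deg_comp_gt h'' i j hij hi a b _ (low.inj h₂))
    · obtain rfl : n = k + 1 := by omega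
      simp only [comp_low, deg_top, comp_top] at h₂ ⊢
      exact congrArg (top _) (T.deg_comp_gt i j hij rfl (by omega) a b _ _ _ (low.inj h₂))
  face_conn_lt := by
    rintro k hk i j hij hj α β (⟨h, c⟩ | ⟨e, x⟩)
    · by_cases h' : k + 3 ≤ n
      · simp only [face_low, conn_low _ h', conn_low _ h, C.face_conn_lt h' i j hij hj]
      · obtain rfl : n = k + 2 := by omega
        simp only [conn_top, face_top, face_low, conn_low _ h, T.bd_conn]
        rw [connShell_of_gt _ (by omega)]
        rfl
    · omega
  face_conn_same := by
    rintro k hk i j hij hj α (⟨h, c⟩ | ⟨e, x⟩)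
    · by_cases h' : k + 2 ≤ n
      · simp only [face_low, conn_low _ h', C.face_conn_same h' i j hij hj]
      · obtain rfl : n = k + 1 := by omega
        simp only [conn_top, face_top, T.bd_conn]
        rw [connShell_mid _ (by omega) (by omega), if_pos rfl]
    · omega
  face_conn_opp := by
    rintro k hk i j hij hj α (⟨h, c⟩ | ⟨e, x⟩)
    · by_cases h' : k + 2 ≤ n
      · simp only [face_low, deg_low _ h, conn_low _ h', C.face_conn_opp h' i j hij hj]
      · obtain rfl : n = k + 1 := by omega
        simp only [conn_top, face_top, face_low, deg_low _ h, T.bd_conn]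
        rw [connShell_mid _ (by omega) (by omega), if_neg (by simp)]
    · omega
  face_conn_gt := by
    rintro k hk i j hij hj α β (⟨h, c⟩ | ⟨e, x⟩)
    · by_cases h' : k + 3 ≤ n
      · simp only [face_low, conn_low _ h', conn_low _ h, C.face_conn_gt h' i j hij hj]
      · obtain rfl : n = k + 2 := by omega
        simp only [conn_top, face_top, face_low, conn_low _ h, T.bd_conn]
        rw [connShell_of_lt _ (by omega)]
        rfl
    · omega
  conn_deg_lt := by
    rintro k hk i j hij hj α (⟨h, c⟩ | ⟨e, x⟩)
    · by_cases h' : k + 3 ≤ n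
      · have h'' : k + 2 ≤ n := by omega
        simp only [deg_low _ h'', deg_low _ h', conn_low _ h', conn_low _ h'',
          C.conn_deg_lt h' i j hij hj]
      · obtain rfl : n = k + 2 := by omega
        simp only [deg_top, deg_low _ le_rfl, conn_top, conn_low _ le_rfl]
        exact congrArg (top _) (T.conn_deg_lt i j hij α rfl hj c)
    · omega
  conn_deg_eq := by
    rintro k hk i hi α (⟨h, c⟩ | ⟨e, x⟩)
    · by_cases h' : k + 2 ≤ n
      · have h'' : k + 1 ≤ n := by omega
        simp only [deg_low _ h'', deg_low _ h', conn_low _ h', C.conn_deg_eq h' i hi]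
      · obtain rfl : n = k + 1 := by omega
        simp only [deg_top, deg_low _ le_rfl, conn_top]
        exact congrArg (top _) (T.conn_deg_eq i α rfl hi c)
    · omega
  conn_deg_gt := by
    rintro k hk i j hij hi α (⟨h, c⟩ | ⟨e, x⟩)
    · by_cases h' : k + 3 ≤ n
      · have h'' : k + 2 ≤ n := by omega
        simp only [deg_low _ h'', deg_low _ h', conn_low _ h', conn_low _ h'',
          C.conn_deg_gt h' i j hij hi]
      · obtain rfl : n = k + 2 := by omega
        simp only [deg_top, deg_low _ le_rfl, conn_top, conn_low _ le_rfl]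
        exact congrArg (top _) (T.conn_deg_gt (i + 1) j (by omega) α rfl (by omega) c)
    · omega
  conn_conn_lt := by
    rintro k hk i j hij hj α β (⟨h, c⟩ | ⟨e, x⟩)
    · by_cases h' : k + 3 ≤ n
      · have h'' : k + 2 ≤ n := by omega
        simp only [conn_low _ h', conn_low _ h'', C.conn_conn_lt h' i j hij hj]
      · obtain rfl : n = k + 2 := by omega
        simp only [conn_top, conn_low _ le_rfl]
        exact congrArg (top _) (T.conn_conn_lt i j hij α β rfl hj c)
    · omega
  conn_conn_eq := by
    rintro k hk i hi α (⟨h, c⟩ | ⟨e, x⟩)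
    · by_cases h' : k + 3 ≤ n
      · have h'' : k + 2 ≤ n := by omega
        simp only [conn_low _ h', conn_low _ h'']
        exact congrArg (low _) (C.conn_conn_eq h' i hi α c)
      · obtain rfl : n = k + 2 := by omega
        simp only [conn_top, conn_low _ le_rfl]
        exact congrArg (top _) (T.conn_conn_eq i α rfl hi c)
    · omega
  conn_comp_conn := by
    rintro k hk i hi (⟨h, c⟩ | ⟨e, x⟩) h₁
    · by_cases h' : k + 2 ≤ n
      · simp only [conn_low _ h', deg_low _ h', comp_low] at h₁ ⊢
        exact congrArg (low _) (C.conn_comp_conn h' i hi c (low.inj h₁))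
      · obtain rfl : n = k + 1 := by omega
        simp only [conn_top, deg_top, comp_top] at h₁ ⊢
        exact congrArg (top _) (T.conn_comp_conn i (by omega) c (by omega) (by omega) (low.inj h₁))
    · omega
  conn_comp_conn_succ := by
    rintro k hk i hi (⟨h, c⟩ | ⟨e, x⟩) h₁
    · by_cases h' : k + 2 ≤ n
      · simp only [conn_low _ h', deg_low _ h', comp_low] at h₁ ⊢
        exact congrArg (low _) (C.conn_comp_conn_succ h' i hi c (low.inj h₁))
      · obtain rfl : n = k + 1 := by omega
        simp only [conn_top, deg_top, comp_top] at h₁ ⊢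
        exact congrArg (top _)
          (T.conn_comp_conn_succ i (by omega) c (by omega) (by omega) (low.inj h₁))
    · omega
  conn_comp_lt := by
    rintro k hk i j hij hj α (⟨h, a⟩ | ⟨e, a⟩) (⟨h', b⟩ | ⟨e', b⟩) h₁ h₂ <;> try omega
    by_cases h'' : k + 2 ≤ n
    · simp only [comp_low, conn_low _ h''] at h₂ ⊢
      exact congrArg (low _) (C.conn_comp_lt h'' i j hij hj α a b _ (low.inj h₂))
    · obtain rfl : n = k + 1 := by omega
      simp only [comp_low, conn_top, comp_top] at h₂ ⊢
      exact congrArg (top _) (T.conn_comp_lt i j hij α rfl hj a b _ _ _ (low.inj h₂))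
  conn_comp_lower := by
    rintro k hk i hi (⟨h, a⟩ | ⟨e, a⟩) (⟨h', b⟩ | ⟨e', b⟩) h₁ h₂ h₃ h₄ <;> try omega
    by_cases h'' : k + 2 ≤ n
    · simp only [comp_low, conn_low _ h'', deg_low _ h''] at h₂ h₃ h₄ ⊢
      exact congrArg (low _)
        (C.conn_comp_lower h'' i hi a b _ (low.inj h₂) (low.inj h₃) (low.inj h₄))
    · obtain rfl : n = k + 1 := by omega
      simp only [comp_low, conn_top, deg_top, comp_top] at h₂ h₃ h₄ ⊢
      exact congrArg (top _)
        (T.conn_comp_lower i rfl hi a b _ _ _ _ (low.inj h₂) (low.inj h₃) (low.inj h₄))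
  conn_comp_upper := by
    rintro k hk i hi (⟨h, a⟩ | ⟨e, a⟩) (⟨h', b⟩ | ⟨e', b⟩) h₁ h₂ h₃ h₄ <;> try omega
    by_cases h'' : k + 2 ≤ n
    · simp only [comp_low, conn_low _ h'', deg_low _ h''] at h₂ h₃ h₄ ⊢
      exact congrArg (low _)
        (C.conn_comp_upper h'' i hi a b _ (low.inj h₂) (low.inj h₃) (low.inj h₄))
    · obtain rfl : n = k + 1 := by omega
      simp only [comp_low, conn_top, deg_top, comp_top] at h₂ h₃ h₄ ⊢
      exact congrArg (top _)
        (T.conn_comp_upper i rfl hi a b _ _ _ _ (low.inj h₂) (low.inj h₃) (low.inj h₄))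
  conn_comp_gt := by
    rintro k hk i j hij hi α (⟨h, a⟩ | ⟨e, a⟩) (⟨h', b⟩ | ⟨e', b⟩) h₁ h₂ <;> try omega
    by_cases h'' : k + 2 ≤ n
    · simp only [comp_low, conn_low _ h''] at h₂ ⊢
      exact congrArg (low _) (C.conn_comp_gt h'' i j hij hi α a b _ (low.inj h₂))
    · obtain rfl : n = k + 1 := by omega
      simp only [comp_low, conn_top, comp_top] at h₂ ⊢
      exact congrArg (top _) (T.conn_comp_gt i j hij rfl hi α a b _ _ _ _ (low.inj h₂))

end Layer

end Cub

/-! ### Functors out of the cubical category given by a layer -/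

namespace Cub

open CubCat

namespace Layer

open PreLayer PreLayer.Cell

variable {n : ℕ} {C : CubCat.{u} n} (T : Layer C)

/-- The identification of the base of a layer with the truncation. -/
def incl : C ⟶ (trunc n).obj T.toCubCat where
  map c := low _ c
  map_face _ _ _ _ := rfl
  map_deg hk _ _ _ := (deg_low (Nat.le_of_succ_le hk) hk _).symm
  map_comp _ _ _ _ _ _ := rfl
  map_conn hk _ _ _ _ := (conn_low (Nat.le_of_succ_le hk) hk _).symm

/-- The inverse of `Layer.incl`. -/
def inclInv : (trunc n).obj T.toCubCat ⟶ C where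
  map {k hk} x := match (generalizing := false) (x : T.Cell k) with
    | low _ c => c
    | top e _ => absurd e (by omega)
  map_face {k hk} i hi α x := by
    rcases x with ⟨h, c⟩ | ⟨e, x⟩
    · rfl
    · omega
  map_deg {k} hk i hi x := by
    rcases x with ⟨h, c⟩ | ⟨e, x⟩
    · simp only [toCubCat, deg_low h hk]
    · omega
  map_comp {k hk} i hi a b h h' := by
    rcases a with ⟨h₁, a⟩ | ⟨e, a⟩
    · rcases b with ⟨h₂, b⟩ | ⟨e, b⟩
      · rfl
      · omega
    · omega
  map_conn {k} hk i hi α x := by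
    rcases x with ⟨h, c⟩ | ⟨e, x⟩
    · simp only [toCubCat, conn_low h hk]
    · omega

instance isIso_incl : IsIso T.incl := by
  refine ⟨T.inclInv, rfl, ?_⟩
  apply CubFunctor.ext
  funext k hk x
  rcases x with ⟨h, c⟩ | ⟨e, x⟩
  · rfl
  · omega

/-- The cells of a layer, as cells of the cubical category it gives. -/
def topHom : PreLayer.Hom T.incl T.toPreLayer (topLayer T.toCubCat).toPreLayer where
  map x := top rfl x
  bd_map _ _ _ _ := rfl
  map_deg _ _ c := (deg_top c).symm
  map_conn i hi α c := by
    obtain ⟨m, rfl⟩ : ∃ m, n = m + 1 := ⟨n - 1, by omega⟩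
    exact (conn_top c).symm
  map_comp _ _ _ _ _ _ := rfl

variable {T}

/-- The functor given by a functor on the base and a morphism of layers. -/
def desc {D : CubCat.{u} (n + 1)} (F : C ⟶ (trunc n).obj D)
    (f : PreLayer.Hom F T.toPreLayer (topLayer D).toPreLayer) : T.toCubCat ⟶ D where
  map {k hk} x := match (generalizing := false) (x : T.Cell k) with
    | low h c => F.map c
    | top e x => D.cast (k := n + 1) (hk := le_rfl) e.symm (f.map x)
  map_face {k hk} i hi α x := by
    rcases x with ⟨h, c⟩ | ⟨e, x⟩
    · exact F.map_face i hi α c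
    · obtain rfl : k = n := by omega
      exact (f.bd_map x i hi α).symm
  map_deg {k} hk i hi x := by
    rcases x with ⟨h, c⟩ | ⟨e, x⟩
    · by_cases h' : k + 1 ≤ n
      · simp only [toCubCat, deg_low h h']
        exact F.map_deg h' i hi c
      · obtain rfl : k = n := by omega
        simp only [toCubCat, deg_top]
        exact f.map_deg i hi c
    · omega
  map_comp {k hk} i hi a b h h' := by
    rcases a with ⟨h₁, a⟩ | ⟨e, a⟩
    · rcases b with ⟨h₂, b⟩ | ⟨e, b⟩
      · exact F.map_comp i hi a b (low.inj h) h'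
      · omega
    · rcases b with ⟨h₂, b⟩ | ⟨e', b⟩
      · omega
      · obtain rfl : k = n := by omega
        exact f.map_comp i hi a b (low.inj h) h'
  map_conn {k} hk i hi α x := by
    rcases x with ⟨h, c⟩ | ⟨e, x⟩
    · by_cases h' : k + 2 ≤ n
      · simp only [toCubCat, conn_low h h']
        exact F.map_conn h' i hi α c
      · obtain rfl : n = k + 1 := by omega
        simp only [toCubCat, conn_top]
        exact f.map_conn i (by omega) α c
    · omega

/-- A cell comes from the base or is a top cell, so the two hypotheses cover everything. This is the
uniqueness counterpart of `desc`. -/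
theorem hom_ext {D : CubCat.{u} (n + 1)} {f g : T.toCubCat ⟶ D}
    (h : T.incl ≫ (trunc n).map f = T.incl ≫ (trunc n).map g)
    (h' : ∀ x : T.X, f.map (hk := le_rfl) (top rfl x : T.Cell (n + 1)) =
      g.map (hk := le_rfl) (top rfl x : T.Cell (n + 1))) : f = g := by
  apply CubFunctor.ext
  funext k hk x
  rcases x with ⟨h₁, c⟩ | ⟨e, x⟩
  · exact congrArg (fun φ : C ⟶ (trunc n).obj D => φ.map (hk := h₁) c) h
  · subst e
    exact h' x

end Layer

/-- The morphism of layers given by a functor. -/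
def topLayerMap {n : ℕ} {D D' : CubCat.{u} (n + 1)} (f : D ⟶ D') :
    PreLayer.Hom ((trunc n).map f) (topLayer D).toPreLayer (topLayer D').toPreLayer where
  map x := f.map x
  bd_map x i hi α := (f.map_face i hi α x).symm
  map_deg i hi c := f.map_deg le_rfl i hi c
  map_conn i hi α c := by
    obtain ⟨m, rfl⟩ : ∃ m, n = m + 1 := ⟨n - 1, by omega⟩
    exact f.map_conn le_rfl i (by omega) α c
  map_comp i hi a b h h' := f.map_comp i hi a b h h'

/-- Composition of morphisms of layers. -/
def PreLayer.Hom.comp {n : ℕ} {C D D' : CubCat.{u} n} {F : C ⟶ D} {G : D ⟶ D'} {T : PreLayer C}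
    {T' : PreLayer D} {T'' : PreLayer D'} (f : Hom F T T') (g : Hom G T' T'') :
    Hom (F ≫ G) T T'' where
  map x := g.map (f.map x)
  bd_map x i hi α := by rw [g.bd_map, f.bd_map]; rfl
  map_deg i hi c := by rw [f.map_deg, g.map_deg]; rfl
  map_conn i hi α c := by rw [f.map_conn, g.map_conn]; rfl
  map_comp i hi a b h h' := by rw [f.map_comp i hi a b h (f.composable h), g.map_comp]

/-! ### Free layers -/

/-- The unit of the free cubical category on a cubical extension, given by a layer. -/
def layerUnit {n : ℕ} {E : CubExt.{u} n} (T : Layer E.base) (gen : E.ext.gen → T.X)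
    (bd_gen : ∀ x, T.bd (gen x) = E.ext.bd x) : E ⟶ (W n).obj T.toCubCat where
  base := T.incl
  gen x := T.topHom.map (gen x)
  bd_gen x i hi α := by
    rw [← bd_gen]; rfl

/-- Functors to `D` that restrict to `φ.base` on the base correspond to morphisms of layers over
`φ.base`, so freeness of the category reduces to freeness of the layer. -/
theorem isFreelyGenerated_of_layer {n : ℕ} {Q : ObjectProperty (CubCat.{u} (n + 1))}
    {E : CubExt.{u} n} (T : Layer E.base) (gen : E.ext.gen → T.X)
    (bd_gen : ∀ x, T.bd (gen x) = E.ext.bd x) (hQ : Q T.toCubCat)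
    (h : ∀ D : CubCat.{u} (n + 1), Q D → ∀ φ : E ⟶ (W n).obj D,
      ∃! f : PreLayer.Hom φ.base T.toPreLayer (topLayer D).toPreLayer,
        ∀ x, f.map (gen x) = φ.gen x) :
    IsFreelyGenerated Q E T.toCubCat (layerUnit T gen bd_gen) := by
  refine ⟨T.isIso_incl, hQ, fun D hD φ => ?_⟩
  obtain ⟨f, hf, hf'⟩ := h D hD φ
  refine ⟨Layer.desc φ.base f, CubExtHom.ext rfl (funext hf), fun g hg => ?_⟩
  have hb : T.incl ≫ (trunc n).map g = φ.base := congrArg CubExtHom.base hg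
  -- Morphisms of layers are typed over their base functor; the base of `φ` has to become literally
  -- that of `g` before the two can be compared.
  obtain ⟨b, γ, hγ⟩ := φ
  subst hb
  have := hf' (T.topHom.comp (topLayerMap g)) fun x => congrFun (congrArg CubExtHom.gen hg) x
  subst this
  exact Layer.hom_ext rfl fun x => rfl

end Cub

namespace Cub

open CubCat

variable {n : ℕ}

/-! ### Existence of the composites in the laws -/

/-- The cells `a` and `b` are `∘_i`-composable with composite `x`. -/
def PreLayer.Rel {n : ℕ} {C : CubCat.{u} n} (T : PreLayer C) (i : ℕ) (a b x : T.X) : Prop :=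
  ∃ (hi : i ≤ n) (h : T.bd a i hi true = T.bd b i hi false), T.comp i hi a b h = x

section

variable {m : ℕ} {C : CubCat.{u} (m + 1)} {i j : ℕ} {c d x : C.cell (m + 1) le_rfl}

theorem PreLayer.bd_conn_mid {n : ℕ} {C : CubCat.{u} n} {T : PreLayer C} {i j : ℕ} (h : i ≤ j)
    (h' : j ≤ i + 1) {hi : i < n} {hj : j ≤ n} {α : Bool} {c : C.cell n le_rfl} :
    T.bd (T.conn i hi α c) j hj α = c := by
  obtain ⟨m, rfl⟩ : ∃ m, n = m + 1 := ⟨n - 1, by omega⟩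
  rw [T.bd_conn, connShell_mid _ h h', if_pos rfl]

namespace Layer

variable (T : Layer C)

/-- The law in `Layer` presupposes that its right side is composable. Here this is derived from the
prescribed shells, so that the composite is available as a value. -/
theorem rel_deg_le (h : C.Rel j c d x) (hij : i ≤ j) (hj : j ≤ m) :
    T.Rel (j + 1) (T.deg i (by omega) c) (T.deg i (by omega) d) (T.deg i (by omega) x) := by
  have h' : T.bd (T.deg i (by omega) c) (j + 1) (by omega) true =
      T.bd (T.deg i (by omega) d) (j + 1) (by omega) false := by
    simp (disch := omega) only [T.bd_deg, degShell_of_lt, Nat.add_sub_cancel, h.composable]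
  obtain ⟨_, h, rfl⟩ := h
  exact ⟨_, h', (T.deg_comp_le i j hij rfl hj c d h _ _ h').symm⟩

theorem rel_deg_gt (h : C.Rel j c d x) (hij : j < i) (hi : i ≤ m + 1) :
    T.Rel j (T.deg i hi c) (T.deg i hi d) (T.deg i hi x) := by
  have h' : T.bd (T.deg i hi c) j (by omega) true = T.bd (T.deg i hi d) j (by omega) false := by
    simp (disch := omega) only [T.bd_deg, degShell_of_gt, h.composable]
  obtain ⟨_, h, rfl⟩ := h
  exact ⟨_, h', (T.deg_comp_gt i j hij rfl (by omega) c d h _ _ h').symm⟩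

theorem rel_conn_lt (h : C.Rel j c d x) (hij : i < j) (hj : j ≤ m) (α : Bool) :
    T.Rel (j + 1) (T.conn i (by omega) α c) (T.conn i (by omega) α d)
      (T.conn i (by omega) α x) := by
  obtain ⟨m, rfl⟩ : ∃ l, m = l + 1 := ⟨m - 1, by omega⟩
  have h' : T.bd (T.conn i (by omega) α c) (j + 1) (by omega) true =
      T.bd (T.conn i (by omega) α d) (j + 1) (by omega) false := by
    simp (disch := omega) only [T.bd_conn, connShell_of_lt, Nat.add_sub_cancel, h.composable]
  obtain ⟨_, h, rfl⟩ := h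
  exact ⟨_, h', (T.conn_comp_lt i j hij α rfl hj c d h _ _ h').symm⟩

theorem rel_conn_gt (h : C.Rel j c d x) (hij : j < i) (hi : i ≤ m) (α : Bool) :
    T.Rel j (T.conn i (by omega) α c) (T.conn i (by omega) α d) (T.conn i (by omega) α x) := by
  obtain ⟨m, rfl⟩ : ∃ l, m = l + 1 := ⟨m - 1, by omega⟩
  have h' : T.bd (T.conn i (by omega) α c) j (by omega) true =
      T.bd (T.conn i (by omega) α d) j (by omega) false := by
    simp (disch := omega) only [T.bd_conn, connShell_of_gt, h.composable]
  obtain ⟨_, h, rfl⟩ := h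
  exact ⟨_, h', (T.conn_comp_gt i j hij rfl hi α c d _ h _ _ h').symm⟩

theorem exists_conn_comp_lower (h : C.Rel i c d x) (hi : i ≤ m) :
    ∃ y z, T.Rel i (T.conn i (by omega) false c) (T.deg (i + 1) (by omega) d) y ∧
      T.Rel i (T.deg i (by omega) d) (T.conn i (by omega) false d) z ∧
      T.Rel (i + 1) y z (T.conn i (by omega) false x) := by
  have h₁ : T.bd (T.conn i (by omega) false c) i (by omega) true =
      T.bd (T.deg (i + 1) (by omega) d) i (by omega) false := by
    simp (disch := omega) [T.bd_conn, T.bd_deg, connShell_mid, degShell_of_gt, h.composable]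
  have h₂ : T.bd (T.deg i (by omega) d) i (by omega) true =
      T.bd (T.conn i (by omega) false d) i (by omega) false := by
    simp (disch := omega) [T.bd_conn, T.bd_deg, connShell_mid, degShell_self]
  -- The two rows of the grid meet along `d`: on either side the common face is a unit followed by
  -- `d`.
  have h₃ : T.bd (T.comp i (by omega) _ _ h₁) (i + 1) (by omega) true =
      T.bd (T.comp i (by omega) _ _ h₂) (i + 1) (by omega) false := by
    have k₁ := (((isCompShell_succ _ _).1 (T.bd_comp _ _ _ _ h₁)).2.2
      (i + 1) (by omega) true).1 (by omega)
    have k₂ := (((isCompShell_succ _ _).1 (T.bd_comp _ _ _ _ h₂)).2.2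
      (i + 1) (by omega) false).1 (by omega)
    simp (disch := omega) only [T.bd_conn, T.bd_deg, connShell_mid, degShell_self, degShell_of_lt,
      Bool.false_eq_true, if_false, if_true, h.composable, Nat.add_sub_cancel] at k₁ k₂
    exact (k₁.unique (Rel.deg_left hi d)).trans (k₂.unique (Rel.deg_left hi d)).symm
  obtain ⟨_, h, rfl⟩ := h
  exact ⟨_, _, ⟨_, h₁, rfl⟩, ⟨_, h₂, rfl⟩, ⟨_, h₃, (T.conn_comp_lower i rfl hi c d h _ _ _ h₁ h₂ h₃).symm⟩⟩

theorem exists_conn_comp_upper (h : C.Rel i c d x) (hi : i ≤ m) :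
    ∃ y z, T.Rel i (T.conn i (by omega) true c) (T.deg i (by omega) c) y ∧
      T.Rel i (T.deg (i + 1) (by omega) c) (T.conn i (by omega) true d) z ∧
      T.Rel (i + 1) y z (T.conn i (by omega) true x) := by
  have h₁ : T.bd (T.conn i (by omega) true c) i (by omega) true =
      T.bd (T.deg i (by omega) c) i (by omega) false := by
    simp (disch := omega) [T.bd_conn, T.bd_deg, connShell_mid, degShell_self]
  have h₂ : T.bd (T.deg (i + 1) (by omega) c) i (by omega) true =
      T.bd (T.conn i (by omega) true d) i (by omega) false := by
    simp (disch := omega) [T.bd_conn, T.bd_deg, connShell_mid, degShell_of_gt, h.composable]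
  -- Here the rows meet along `c`: on either side the common face is `c` followed by a unit.
  have h₃ : T.bd (T.comp i (by omega) _ _ h₁) (i + 1) (by omega) true =
      T.bd (T.comp i (by omega) _ _ h₂) (i + 1) (by omega) false := by
    have k₁ := (((isCompShell_succ _ _).1 (T.bd_comp _ _ _ _ h₁)).2.2
      (i + 1) (by omega) true).1 (by omega)
    have k₂ := (((isCompShell_succ _ _).1 (T.bd_comp _ _ _ _ h₂)).2.2
      (i + 1) (by omega) false).1 (by omega)
    simp (disch := omega) only [T.bd_conn, T.bd_deg, connShell_mid, degShell_self, degShell_of_lt,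
      Bool.true_eq_false, if_false, if_true, ← h.composable, Nat.add_sub_cancel] at k₁ k₂
    exact (k₁.unique (Rel.deg_right hi c)).trans (k₂.unique (Rel.deg_right hi c)).symm
  obtain ⟨_, h, rfl⟩ := h
  exact ⟨_, _, ⟨_, h₁, rfl⟩, ⟨_, h₂, rfl⟩, ⟨_, h₃, (T.conn_comp_upper i rfl hi c d h _ _ _ h₁ h₂ h₃).symm⟩⟩

end Layer

end

/-! ### Terms and their values -/

/-- A layer with a morphism from a cubical extension. -/
structure Model (E : CubExt.{u} n) where
  C : CubCat.{u} n
  T : Layer C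
  F : E.base ⟶ C
  gen : E.ext.gen → T.X
  bd_gen : ∀ x i hi α, T.bd (gen x) i hi α = F.map (E.ext.bd x i hi α)

/-- Formal terms, including formal inverses. -/
inductive Term (E : CubExt.{u} n) : Type u
  | gen (x : E.ext.gen) : Term E
  | deg (i : ℕ) (hi : i ≤ n) (c : E.base.cell n le_rfl) : Term E
  | conn (i : ℕ) (hi : i < n) (α : Bool) (c : E.base.cell n le_rfl) : Term E
  | comp (i : ℕ) (hi : i ≤ n) (A B : Term E) : Term E
  | inv (i : ℕ) (hi : i ≤ n) (A : Term E) : Term E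

variable {E : CubExt.{u} n}

/-- The values of a term in a model. -/
inductive Eval (M : Model E) : Term E → M.T.X → Prop
  | gen (x : E.ext.gen) : Eval M (.gen x) (M.gen x)
  | deg (i : ℕ) (hi : i ≤ n) (c : E.base.cell n le_rfl) :
      Eval M (.deg i hi c) (M.T.deg i hi (M.F.map c))
  | conn (i : ℕ) (hi : i < n) (α : Bool) (c : E.base.cell n le_rfl) :
      Eval M (.conn i hi α c) (M.T.conn i hi α (M.F.map c))
  | comp (i : ℕ) (hi : i ≤ n) {A B : Term E} {a b : M.T.X} (hA : Eval M A a) (hB : Eval M B b)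
      (h : M.T.bd a i hi true = M.T.bd b i hi false) :
      Eval M (.comp i hi A B) (M.T.comp i hi a b h)
  | inv (i : ℕ) (hi : i ≤ n) {A : Term E} {a b : M.T.X} (hA : Eval M A a)
      (h : M.T.Inverse i hi a b) : Eval M (.inv i hi A) b

namespace Eval

theorem of_eq {M : Model E} {A : Term E} {a b : M.T.X} (h : Eval M A a) (e : a = b) :
    Eval M A b := e ▸ h

theorem rel {M : Model E} {A B : Term E} {a b x : M.T.X} {i : ℕ} {hi : i ≤ n} (hA : Eval M A a)
    (hB : Eval M B b) (h : M.T.Rel i a b x) : Eval M (.comp i hi A B) x := by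
  obtain ⟨_, h, rfl⟩ := h
  exact .comp i hi hA hB h

/-- Evaluation is a partial function; the only clause that is not functional by its form is the one
for inverses, settled by `Layer.inverse_unique`. -/
theorem unique {M : Model E} {A : Term E} {a a' : M.T.X} (h : Eval M A a) (h' : Eval M A a') :
    a = a' := by
  induction h generalizing a' with
  | gen => cases h'; rfl
  | deg => cases h'; rfl
  | conn => cases h'; rfl
  | comp i hi hA hB h ihA ihB =>
    cases h' with
    | comp _ _ hA' hB' h' => exact PreLayer.comp_congr (ihA hA') (ihB hB') h h'
  | inv i hi hA h ih =>
    cases h' with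
    | inv _ _ hA' h' =>
      obtain rfl := ih hA'
      exact M.T.inverse_unique h h'

/-- Morphisms preserve composability and inverses, so a defined value remains defined and is carried
along. -/
theorem map {M M' : Model E} {G : M.C ⟶ M'.C}
    (f : PreLayer.Hom G M.T.toPreLayer M'.T.toPreLayer)
    (hF : ∀ c : E.base.cell n le_rfl, G.map (M.F.map c) = M'.F.map c)
    (hf : ∀ x, f.map (M.gen x) = M'.gen x) {A : Term E} {a : M.T.X} (h : Eval M A a) :
    Eval M' A (f.map a) := by
  induction h with
  | gen x => rw [hf]; exact .gen x
  | deg i hi c => rw [f.map_deg, hF]; exact .deg i hi c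
  | conn i hi α c => rw [f.map_conn, hF]; exact .conn i hi α c
  | comp i hi hA hB h ihA ihB =>
    rw [f.map_comp i hi _ _ h (f.composable h)]
    exact .comp i hi ihA ihB _
  | inv i hi hA h ih => exact .inv i hi ih (h.map f)

end Eval

/-- The model given by squares. -/
noncomputable def coskModel {C : CubCat.{u} n} (F : E.base ⟶ C) : Model E where
  C := C
  T := cosk C
  F := F
  gen x := ⟨_, map_square F (E.ext.bd_square x)⟩
  bd_gen _ _ _ _ := rfl

/-- The model given by a morphism to the cubical extension underlying a cubical category. -/
def Model.ofHom {D : CubCat.{u} (n + 1)} (φ : E ⟶ (W n).obj D) : Model E where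
  C := (trunc n).obj D
  T := topLayer D
  F := φ.base
  gen := φ.gen
  bd_gen := φ.bd_gen

/-- The boundary of `a` and the image of `S` are both values of `A` in the squares of `M.C`, the
former through `M`, the latter through the squares of the base; values are unique. -/
theorem Eval.bd_eq {M : Model E} {A : Term E} {a : M.T.X} {S} (h : Eval M A a)
    (h' : Eval (coskModel (𝟙 E.base)) A S) (i : ℕ) (hi : i ≤ n) (α : Bool) :
    M.T.bd a i hi α = M.F.map (S.1 i hi α) := by
  have h₁ : Eval (coskModel M.F) A _ := h.map (M' := coskModel M.F)
    (PreLayer.toCosk (𝟙 M.C) M.T.toPreLayer) (fun c => rfl) fun x => Subtype.ext (by funext i hi α; exact M.bd_gen x i hi α)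
  have h₂ : Eval (coskModel M.F) A _ := h'.map (M' := coskModel M.F) (PreLayer.toCosk M.F _)
    (fun c => rfl) fun x => rfl
  exact congrFun (congrFun (congrFun (congrArg Subtype.val (h₁.unique h₂)) i) hi) α

/-! ### Expressions -/

/-- Expressions, as terms. -/
def Expr.toTerm : Expr E → Term E
  | .gen x => .gen x
  | .deg i hi c => .deg i hi c
  | .conn i hi α c => .conn i hi α c
  | .comp i hi A B => .comp i hi A.toTerm B.toTerm

/-- The boundary of the value has to be carried through the induction: it is the image of the type,
so composability of types yields composability of values. -/
theorem HasType.exists_eval {A : Expr E} {S : E.base.Shell n le_rfl} (h : HasType A S)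
    (M : Model E) : ∃ a, Eval M A.toTerm a ∧
      ∀ i hi α, M.T.bd a i hi α = M.F.map (S i hi α) := by
  induction h with
  | gen x => exact ⟨_, .gen x, M.bd_gen x⟩
  | deg i hi c =>
    refine ⟨_, .deg i hi c, fun j hj α => ?_⟩
    rw [M.T.bd_deg, map_degShell]
  | conn i hi γ c =>
    refine ⟨_, .conn i hi γ c, fun j hj α => ?_⟩
    rw [M.T.bd_conn, map_connShell]
  | comp i hi hA hB hST hU ihA ihB =>
    obtain ⟨a, ha, ha'⟩ := ihA
    obtain ⟨b, hb, hb'⟩ := ihB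
    have h : M.T.bd a i hi true = M.T.bd b i hi false := by rw [ha', hb', hST]
    refine ⟨_, .comp i hi ha hb h, fun j hj α => ?_⟩
    have h₁ := M.T.bd_comp i hi a b h
    have h₂ := map_compShell M.F hU
    rw [show M.T.bd a = _ from funext fun i => funext fun hi => funext (ha' i hi),
      show M.T.bd b = _ from funext fun i => funext fun hi => funext (hb' i hi)] at h₁
    exact congrFun (congrFun (congrFun (compShell_unique h₁ h₂) j) hj) α

theorem HasType.unique {A : Expr E} {S T : E.base.Shell n le_rfl} (h : HasType A S)
    (h' : HasType A T) : S = T := by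
  obtain ⟨a, ha, ha'⟩ := h.exists_eval (coskModel (𝟙 E.base))
  obtain ⟨b, hb, hb'⟩ := h'.exists_eval (coskModel (𝟙 E.base))
  obtain rfl := ha.unique hb
  funext i hi α
  exact (ha' i hi α).symm.trans (hb' i hi α)

/-- Over the identity of the base, the clauses of evaluation in the squares are those of the typing
judgement. -/
theorem hasType_of_eval {A : Expr E} {S} (h : Eval (coskModel (𝟙 E.base)) A.toTerm S) :
    HasType A S.1 := by
  induction A generalizing S with
  | gen x => cases h; exact .gen x
  | deg i hi c => cases h; exact .deg i hi c
  | conn i hi α c => cases h; exact .conn i hi α c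
  | comp i hi A B ihA ihB =>
    cases h with
    | comp _ _ hA hB h => exact .comp i hi (ihA hA) (ihB hB) h ((coskPre _).bd_comp _ _ _ _ h)

theorem Composable.exists_eval {A B : Expr E} {i : ℕ} {hi : i ≤ n} (h : Composable i hi A B)
    (M : Model E) : ∃ a b, Eval M A.toTerm a ∧ Eval M B.toTerm b ∧
      M.T.bd a i hi true = M.T.bd b i hi false := by
  obtain ⟨S, T, hS, hT, e⟩ := h
  obtain ⟨a, ha, ha'⟩ := hS.exists_eval M
  obtain ⟨b, hb, hb'⟩ := hT.exists_eval M
  exact ⟨a, b, ha, hb, by rw [ha', hb', e]⟩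

/-- Soundness of the congruence, in the form of a common value: this includes that both sides are
defined, and by uniqueness it is stable under transitivity. In the model of squares it shows that
congruent expressions have the same type. -/
theorem Cong.exists_eval {A B : Expr E} (h : Cong A B) (M : Model E) :
    ∃ a, Eval M A.toTerm a ∧ Eval M B.toTerm a := by
  induction h with
  | refl hA =>
    obtain ⟨a, ha, -⟩ := hA.choose_spec.exists_eval M
    exact ⟨a, ha, ha⟩
  | symm h ih =>
    obtain ⟨a, ha, ha'⟩ := ih
    exact ⟨a, ha', ha⟩
  | trans h h' ih ih' =>
    obtain ⟨a, ha, ha'⟩ := ih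
    obtain ⟨b, hb, hb'⟩ := ih'
    obtain rfl := ha'.unique hb
    exact ⟨a, ha, hb'⟩
  | comp i hi hA hB h h' ihA ihB =>
    obtain ⟨a, ha, ha'⟩ := ihA
    obtain ⟨b, hb, hb'⟩ := ihB
    obtain ⟨a₁, b₁, ha₁, hb₁, e⟩ := h.exists_eval M
    obtain rfl := ha.unique ha₁
    obtain rfl := hb.unique hb₁
    exact ⟨_, .comp i hi ha hb e, .comp i hi ha' hb' e⟩
  | assoc i hi h h' =>
    obtain ⟨a, b, ha, hb, e⟩ := h.exists_eval M
    obtain ⟨b', c, hb', hc, e'⟩ := h'.exists_eval M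
    obtain rfl := hb.unique hb'
    have e₁ : M.T.bd a i hi true = M.T.bd (M.T.comp i hi b c e') i hi false := by
      rw [PreLayer.bd_comp_lower, e]
    have e₂ : M.T.bd (M.T.comp i hi a b e) i hi true = M.T.bd c i hi false := by
      rw [PreLayer.bd_comp_upper, e']
    exact ⟨_, .comp i hi ha (.comp i hi hb hc e') e₁,
      (Eval.comp i hi (.comp i hi ha hb e) hc e₂).of_eq (M.T.assoc i hi a b c e e' e₁ e₂).symm⟩
  | interchange i j hij hj hAB hCD hAC hBD =>
    obtain ⟨a, b, ha, hb, e₁⟩ := hAB.exists_eval M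
    obtain ⟨c, d, hc, hd, e₂⟩ := hCD.exists_eval M
    obtain ⟨a', c', ha', hc', e₃⟩ := hAC.exists_eval M
    obtain rfl := ha.unique ha'
    obtain rfl := hc.unique hc'
    obtain ⟨b', d', hb', hd', e₄⟩ := hBD.exists_eval M
    obtain rfl := hb.unique hb'
    obtain rfl := hd.unique hd'
    obtain ⟨m, rfl⟩ : ∃ m, n = m + 1 := ⟨n - 1, by omega⟩
    have hi : i ≤ m + 1 := by omega
    -- The outer composites exist because their common faces are composites of faces that agree
    -- pairwise by the four given composability conditions.
    have e₅ : M.T.bd (M.T.comp i hi a b e₁) j hj true =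
        M.T.bd (M.T.comp i hi c d e₂) j hj false := by
      have h₁ := (((isCompShell_succ _ _).1 (M.T.bd_comp i hi a b e₁)).2.2 j hj true).1 hij
      have h₂ := (((isCompShell_succ _ _).1 (M.T.bd_comp i hi c d e₂)).2.2 j hj false).1 hij
      rw [e₃, e₄] at h₁
      exact h₁.unique h₂
    have e₆ : M.T.bd (M.T.comp j hj a c e₃) i hi true =
        M.T.bd (M.T.comp j hj b d e₄) i hi false := by
      have h₁ := (((isCompShell_succ _ _).1 (M.T.bd_comp j hj a c e₃)).2.2 i hi true).2 hij
      have h₂ := (((isCompShell_succ _ _).1 (M.T.bd_comp j hj b d e₄)).2.2 i hi false).2 hij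
      rw [e₁, e₂] at h₁
      exact h₁.unique h₂
    exact ⟨_, .comp j hj (.comp i hi ha hb e₁) (.comp i hi hc hd e₂) e₅,
      (Eval.comp i hi (.comp j hj ha hc e₃) (.comp j hj hb hd e₄) e₆).of_eq
        (M.T.interchange i j hi hj hij a b c d e₁ e₂ e₃ e₄ e₅ e₆).symm⟩
  | deg_comp_self i hi hA =>
    obtain ⟨a, ha, ha'⟩ := hA.exists_eval M
    have h : M.T.bd (M.T.deg i hi (M.T.bd a i hi false)) i hi true = M.T.bd a i hi false :=
      PreLayer.bd_deg_self _
    refine ⟨_, .comp i hi (.deg i hi _) ha ?_, ha.of_eq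
      ((M.T.deg_comp_self i hi a h).symm.trans (PreLayer.comp_congr (by rw [ha']) rfl _ _))⟩
    rw [PreLayer.bd_deg_self, ha']
  | comp_deg i hi hA =>
    obtain ⟨a, ha, ha'⟩ := hA.exists_eval M
    have h : M.T.bd a i hi true = M.T.bd (M.T.deg i hi (M.T.bd a i hi true)) i hi false :=
      (PreLayer.bd_deg_self _).symm
    refine ⟨_, .comp i hi ha (.deg i hi _) ?_, ha.of_eq
      ((M.T.comp_deg i hi a h).symm.trans (PreLayer.comp_congr rfl (by rw [ha']) _ _))⟩
    rw [PreLayer.bd_deg_self, ha']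
  | deg_comp_le i j hij e hj c d h =>
    cases e
    exact ⟨_, .deg _ _ _, .rel (.deg _ _ _) (.deg _ _ _)
      (M.T.rel_deg_le (rel_map M.F (.mk' hj h)) hij hj)⟩
  | deg_comp_gt i j hij hi e hj c d h =>
    cases e
    exact ⟨_, .deg _ _ _, .rel (.deg _ _ _) (.deg _ _ _)
      (M.T.rel_deg_gt (rel_map M.F (.mk' hj h)) hij hi)⟩
  | deg_deg i j hij e hj c =>
    cases e
    refine ⟨_, .deg _ _ _, (Eval.deg _ _ _).of_eq ?_⟩
    refine (congrArg _ (M.F.map_deg _ i (by omega) c)).trans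
      (((M.T.deg_deg i j hij rfl hj _).symm).trans (congrArg _ (M.F.map_deg _ j hj c).symm))
  | conn_comp_lt i j hij α e hj c d h =>
    cases e
    exact ⟨_, .conn _ _ _ _, .rel (.conn _ _ _ _) (.conn _ _ _ _)
      (M.T.rel_conn_lt (rel_map M.F (.mk' hj h)) hij hj α)⟩
  | conn_comp_lower i e hi c d h =>
    cases e
    obtain ⟨_, _, h₁, h₂, h₃⟩ := M.T.exists_conn_comp_lower (rel_map M.F (.mk' hi h)) hi
    exact ⟨_, .conn _ _ _ _, .rel (.rel (.conn _ _ _ _) (.deg _ _ _) h₁)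
      (.rel (.deg _ _ _) (.conn _ _ _ _) h₂) h₃⟩
  | conn_comp_upper i e hi c d h =>
    cases e
    obtain ⟨_, _, h₁, h₂, h₃⟩ := M.T.exists_conn_comp_upper (rel_map M.F (.mk' hi h)) hi
    exact ⟨_, .conn _ _ _ _, .rel (.rel (.conn _ _ _ _) (.deg _ _ _) h₁)
      (.rel (.deg _ _ _) (.conn _ _ _ _) h₂) h₃⟩
  | conn_comp_gt i j hij e hi α c d h =>
    cases e
    exact ⟨_, .conn _ _ _ _, .rel (.conn _ _ _ _) (.conn _ _ _ _)
      (M.T.rel_conn_gt (rel_map M.F (.mk' (by omega) h)) hij hi α)⟩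
  | conn_comp_conn i hi c =>
    have h : M.T.bd (M.T.conn i hi true (M.F.map c)) i (by omega) true =
        M.T.bd (M.T.conn i hi false (M.F.map c)) i (by omega) false := by
      rw [PreLayer.bd_conn_mid (by omega) (by omega), PreLayer.bd_conn_mid (by omega) (by omega)]
    exact ⟨_, .comp _ _ (.conn _ _ _ _) (.conn _ _ _ _) h, (Eval.deg _ _ _).of_eq
      (M.T.conn_comp_conn i hi _ (by omega) (by omega) h).symm⟩
  | conn_comp_conn_succ i hi c =>
    have h : M.T.bd (M.T.conn i hi true (M.F.map c)) (i + 1) (by omega) true =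
        M.T.bd (M.T.conn i hi false (M.F.map c)) (i + 1) (by omega) false := by
      rw [PreLayer.bd_conn_mid (by omega) (by omega), PreLayer.bd_conn_mid (by omega) (by omega)]
    exact ⟨_, .comp _ _ (.conn _ _ _ _) (.conn _ _ _ _) h, (Eval.deg _ _ _).of_eq
      (M.T.conn_comp_conn_succ i hi _ (by omega) (by omega) h).symm⟩
  | conn_deg_lt i j hij α e hj c =>
    cases e
    refine ⟨_, .conn _ _ _ _, (Eval.deg _ _ _).of_eq ?_⟩
    exact (congrArg _ (M.F.map_conn _ i (by omega) α c)).trans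
      ((M.T.conn_deg_lt i j hij α rfl hj _).symm.trans (congrArg _ (M.F.map_deg _ j hj c).symm))
  | conn_deg_eq i α e hi c =>
    cases e
    refine ⟨_, .conn _ _ _ _, (Eval.deg _ _ _).of_eq ?_⟩
    exact (congrArg _ (M.F.map_deg _ i hi c)).trans
      ((M.T.conn_deg_eq i α rfl hi _).symm.trans (congrArg _ (M.F.map_deg _ i hi c).symm))
  | conn_deg_gt i j hij α e hi c =>
    cases e
    refine ⟨_, .conn _ _ _ _, (Eval.deg _ _ _).of_eq ?_⟩
    exact (congrArg _ (M.F.map_conn _ (i - 1) (by omega) α c)).trans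
      ((M.T.conn_deg_gt i j hij α rfl hi _).symm.trans
        (congrArg _ (M.F.map_deg _ j (by omega) c).symm))
  | conn_conn_lt i j hij α β e hj c =>
    cases e
    refine ⟨_, .conn _ _ _ _, (Eval.conn _ _ _ _).of_eq ?_⟩
    exact (congrArg _ (M.F.map_conn _ i (by omega) α c)).trans
      ((M.T.conn_conn_lt i j hij α β rfl hj _).symm.trans
        (congrArg _ (M.F.map_conn _ j hj β c).symm))
  | conn_conn_eq i α e hi c =>
    cases e
    refine ⟨_, .conn _ _ _ _, (Eval.conn _ _ _ _).of_eq ?_⟩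
    exact (congrArg _ (M.F.map_conn _ i hi α c)).trans
      ((M.T.conn_conn_eq i α rfl hi _).symm.trans (congrArg _ (M.F.map_conn _ i hi α c).symm))

end Cub

namespace Cub

open CubCat

variable {n : ℕ} {E : CubExt.{u} n}

/-! ### The layer of classes of expressions -/

namespace FreeCell

theorem exists_mk (a : FreeCell E) : ∃ A hA, a = mk A hA := by
  obtain ⟨⟨A, hA⟩, rfl⟩ := Quot.exists_rep a
  exact ⟨A, hA, rfl⟩

theorem mk_eq {A B : Expr E} (h : Cong A B) (hA : Typable A) (hB : Typable B) :
    mk A hA = mk B hB := Quot.sound h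

/-- `Quot` identifies along the generated equivalence relation, but on typable expressions the
congruence already is one; so equality of classes is congruence itself. -/
theorem mk_eq_mk {A B : Expr E} {hA : Typable A} {hB : Typable B} :
    mk A hA = mk B hB ↔ Cong A B := by
  refine ⟨fun h => ?_, fun h => mk_eq h _ _⟩
  have := Quot.eq.1 h
  rw [Equivalence.eqvGen_iff ⟨fun x => .refl x.2, .symm, .trans⟩] at this
  exact this

/-- Quantifying over all representatives makes the chosen value independent of them; soundness of
the congruence is what allows this. -/
theorem exists_value (M : Model E) (a : FreeCell E) :
    ∃ x, ∀ A hA, a = mk A hA → Eval M A.toTerm x := by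
  obtain ⟨A, hA, rfl⟩ := a.exists_mk
  obtain ⟨x, hx, -⟩ := hA.choose_spec.exists_eval M
  refine ⟨x, fun B hB h => ?_⟩
  obtain ⟨y, hy, hy'⟩ := (mk_eq_mk.1 h).exists_eval M
  obtain rfl := hx.unique hy
  exact hy'

/-- The value of a class of expressions in a model. -/
noncomputable def value (M : Model E) (a : FreeCell E) : M.T.X := (exists_value M a).choose

theorem eval_value (M : Model E) (A : Expr E) (hA : Typable A) :
    Eval M A.toTerm (value M (mk A hA)) := (exists_value M (mk A hA)).choose_spec A hA rfl

/-- The shell of a class of expressions. -/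
noncomputable def bd (a : FreeCell E) : E.base.Shell n le_rfl :=
  Subtype.val (p := E.base.IsSquare) (value (coskModel (𝟙 E.base)) a)

theorem hasType_bd (A : Expr E) (hA : Typable A) : HasType A (bd (mk A hA)) :=
  hasType_of_eval (eval_value _ A hA)

theorem bd_mk {A : Expr E} {S : E.base.Shell n le_rfl} (h : HasType A S) (hA : Typable A) :
    bd (mk A hA) = S := (hasType_bd A hA).unique h

theorem bd_value (M : Model E) (a : FreeCell E) (i : ℕ) (hi : i ≤ n) (α : Bool) :
    M.T.bd (value M a) i hi α = M.F.map (bd a i hi α) := by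
  obtain ⟨A, hA, rfl⟩ := a.exists_mk
  exact (eval_value M A hA).bd_eq (eval_value _ A hA) i hi α

theorem composable_iff {A B : Expr E} {i : ℕ} {hi : i ≤ n} (hA : Typable A) (hB : Typable B) :
    Composable i hi A B ↔ bd (mk A hA) i hi true = bd (mk B hB) i hi false := by
  refine ⟨fun ⟨S, T, hS, hT, e⟩ => ?_, fun h => ⟨_, _, hasType_bd A hA, hasType_bd B hB, h⟩⟩
  rw [bd_mk hS, bd_mk hT, e]

theorem bd_square (a : FreeCell E) : E.base.IsSquare (bd a) :=
  Subtype.property (p := E.base.IsSquare) (value (coskModel (𝟙 E.base)) a)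

theorem hasType_comp {A B : Expr E} {i : ℕ} {hi : i ≤ n} {hA : Typable A} {hB : Typable B}
    (h : bd (mk A hA) i hi true = bd (mk B hB) i hi false) :
    ∃ U, E.base.IsCompShell i hi (bd (mk A hA)) (bd (mk B hB)) U ∧
      HasType (.comp i hi A B) U := by
  obtain ⟨U, hU⟩ := exists_compShell (bd_square _) (bd_square _) h
  exact ⟨U, hU, .comp i hi (hasType_bd A hA) (hasType_bd B hB) h hU⟩

theorem typable_comp {A B : Expr E} {i : ℕ} {hi : i ≤ n} {hA : Typable A} {hB : Typable B}
    (h : bd (mk A hA) i hi true = bd (mk B hB) i hi false) : Typable (.comp i hi A B) :=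
  (hasType_comp h).imp fun _ => And.right

/-- Composability is a condition on classes, since it is read off from the types, and the congruence
rule for `∘_i` makes the class of the composite independent of the representatives. -/
theorem exists_comp (i : ℕ) (hi : i ≤ n) (a b : FreeCell E) (h : bd a i hi true = bd b i hi false) :
    ∃ x, ∀ A B hA hB hAB, a = mk A hA → b = mk B hB → x = mk (.comp i hi A B) hAB := by
  obtain ⟨A, hA, rfl⟩ := a.exists_mk
  obtain ⟨B, hB, rfl⟩ := b.exists_mk
  refine ⟨mk (.comp i hi A B) (typable_comp h), fun A' B' hA' hB' hAB' e e' => mk_eq ?_ _ _⟩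
  refine .comp i hi (mk_eq_mk.1 e) (mk_eq_mk.1 e') ((composable_iff hA hB).2 h) ?_
  rw [composable_iff hA' hB', ← e, ← e', h]

/-- Composition of classes of expressions. -/
noncomputable def comp (i : ℕ) (hi : i ≤ n) (a b : FreeCell E)
    (h : bd a i hi true = bd b i hi false) : FreeCell E := (exists_comp i hi a b h).choose

theorem comp_mk {A B : Expr E} {i : ℕ} {hi : i ≤ n} {hA : Typable A} {hB : Typable B}
    (h : bd (mk A hA) i hi true = bd (mk B hB) i hi false) :
    comp i hi (mk A hA) (mk B hB) h = mk (.comp i hi A B) (typable_comp h) :=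
  (exists_comp i hi _ _ h).choose_spec A B hA hB (typable_comp h) rfl rfl

/-- Meant for nested composites, whose operands are classes only up to a proved equality. -/
theorem comp_of_eq {a b : FreeCell E} {A B : Expr E} {i : ℕ} {hi : i ≤ n} {hA : Typable A}
    {hB : Typable B} (ha : a = mk A hA) (hb : b = mk B hB)
    (h : bd a i hi true = bd b i hi false) :
    ∃ hAB, comp i hi a b h = mk (.comp i hi A B) hAB := by
  subst ha hb
  exact ⟨typable_comp h, comp_mk h⟩

end FreeCell

open FreeCell in
/-- The data of the layer of classes of expressions. -/
noncomputable def freePreLayer (E : CubExt.{u} n) : PreLayer E.base where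
  X := FreeCell E
  bd := bd
  deg i hi c := mk _ ⟨_, .deg i hi c⟩
  conn i hi α c := mk _ ⟨_, .conn i hi α c⟩
  comp := comp
  bd_square := bd_square
  bd_deg i hi c := bd_mk (.deg i hi c) _
  bd_conn i hi α c := bd_mk (.conn i hi α c) _
  bd_comp i hi a b h := by
    obtain ⟨A, hA, rfl⟩ := a.exists_mk
    obtain ⟨B, hB, rfl⟩ := b.exists_mk
    obtain ⟨U, hU, hU'⟩ := hasType_comp h
    rw [comp_mk, bd_mk hU']
    exact hU

open FreeCell in
/-- The layer of classes of expressions. -/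
noncomputable def freeLayer (E : CubExt.{u} n) : Layer E.base where
  __ := freePreLayer E
  assoc i hi a b c hab hbc h h' := by
    obtain ⟨A, hA, rfl⟩ := FreeCell.exists_mk a
    obtain ⟨B, hB, rfl⟩ := FreeCell.exists_mk b
    obtain ⟨C, hC, rfl⟩ := FreeCell.exists_mk c
    obtain ⟨k₁, e₁⟩ := comp_of_eq rfl (comp_mk hbc) h
    obtain ⟨k₂, e₂⟩ := comp_of_eq (comp_mk hab) rfl h'
    refine e₁.trans (.trans ?_ e₂.symm)
    exact mk_eq (.assoc i hi ((composable_iff hA hB).2 hab) ((composable_iff hB hC).2 hbc)) _ _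
  interchange i j hi hj hij a b c d hab hcd hac hbd h h' := by
    obtain ⟨A, hA, rfl⟩ := FreeCell.exists_mk a
    obtain ⟨B, hB, rfl⟩ := FreeCell.exists_mk b
    obtain ⟨C, hC, rfl⟩ := FreeCell.exists_mk c
    obtain ⟨D, hD, rfl⟩ := FreeCell.exists_mk d
    obtain ⟨k₁, e₁⟩ := comp_of_eq (comp_mk hab) (comp_mk hcd) h
    obtain ⟨k₂, e₂⟩ := comp_of_eq (comp_mk hac) (comp_mk hbd) h'
    refine e₁.trans (.trans ?_ e₂.symm)
    exact mk_eq (.interchange i j hij hj ((composable_iff hA hB).2 hab)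
      ((composable_iff hC hD).2 hcd) ((composable_iff hA hC).2 hac)
      ((composable_iff hB hD).2 hbd)) _ _
  deg_comp_self i hi a h := by
    obtain ⟨A, hA, rfl⟩ := FreeCell.exists_mk a
    exact (comp_mk h).trans (mk_eq (.deg_comp_self i hi (hasType_bd A hA)) _ _)
  comp_deg i hi a h := by
    obtain ⟨A, hA, rfl⟩ := FreeCell.exists_mk a
    exact (comp_mk h).trans (mk_eq (.comp_deg i hi (hasType_bd A hA)) _ _)
  deg_comp_le i j hij _ e hj c d h hi hj' h' :=
    (mk_eq (.deg_comp_le i j hij e hj c d h) _ _).trans (comp_mk h').symm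
  deg_comp_gt i j hij _ e hj c d h hi hj' h' :=
    (mk_eq (.deg_comp_gt i j hij hi e hj c d h) _ _).trans (comp_mk h').symm
  deg_deg i j hij _ e hj c := mk_eq (.deg_deg i j hij e hj c) _ _
  conn_comp_lt i j hij α _ e hj c d h hi hj' h' :=
    (mk_eq (.conn_comp_lt i j hij α e hj c d h) _ _).trans (comp_mk h').symm
  conn_comp_lower i _ e hi c d h _ _ _ h₁ h₂ h₃ := by
    obtain ⟨k, e'⟩ := comp_of_eq (comp_mk h₁) (comp_mk h₂) h₃
    exact (mk_eq (.conn_comp_lower i e hi c d h) _ k).trans e'.symm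
  conn_comp_upper i _ e hi c d h _ _ _ h₁ h₂ h₃ := by
    obtain ⟨k, e'⟩ := comp_of_eq (comp_mk h₁) (comp_mk h₂) h₃
    exact (mk_eq (.conn_comp_upper i e hi c d h) _ k).trans e'.symm
  conn_comp_gt i j hij _ e hi α c d hj h hi' hj' h' :=
    (mk_eq (.conn_comp_gt i j hij e hi α c d h) _ _).trans (comp_mk h').symm
  conn_comp_conn i hi c _ _ h := by
    exact (comp_mk h).trans (mk_eq (.conn_comp_conn i hi c) _ _)
  conn_comp_conn_succ i hi c _ _ h := by
    exact (comp_mk h).trans (mk_eq (.conn_comp_conn_succ i hi c) _ _)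
  conn_deg_lt i j hij α _ e hj c := mk_eq (.conn_deg_lt i j hij α e hj c) _ _
  conn_deg_eq i α _ e hi c := mk_eq (.conn_deg_eq i α e hi c) _ _
  conn_deg_gt i j hij α _ e hi c := mk_eq (.conn_deg_gt i j hij α e hi c) _ _
  conn_conn_lt i j hij α β _ e hj c := mk_eq (.conn_conn_lt i j hij α β e hj c) _ _
  conn_conn_eq i α _ e hi c := mk_eq (.conn_conn_eq i α e hi c) _ _

open FreeCell

/-- The classes of the generators. -/
def freeGen (x : E.ext.gen) : FreeCell E := .mk _ ⟨_, .gen x⟩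

theorem bd_freeGen (x : E.ext.gen) : (freeLayer E).bd (freeGen x) = E.ext.bd x :=
  bd_mk (.gen x) _

/-- The morphism from the layer of classes of expressions to a model. -/
noncomputable def freeLayerMap (M : Model E) :
    PreLayer.Hom M.F (freeLayer E).toPreLayer M.T.toPreLayer where
  map := value M
  bd_map := bd_value M
  map_deg i hi c := (eval_value M _ ⟨_, .deg i hi c⟩).unique (.deg i hi c)
  map_conn i hi α c := (eval_value M _ ⟨_, .conn i hi α c⟩).unique (.conn i hi α c)
  map_comp i hi a b h h' := by
    obtain ⟨A, hA, rfl⟩ := FreeCell.exists_mk a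
    obtain ⟨B, hB, rfl⟩ := FreeCell.exists_mk b
    refine (congrArg (value M) (comp_mk h)).trans ?_
    exact (eval_value M _ (typable_comp h)).unique
      (.comp i hi (eval_value M A hA) (eval_value M B hB) h')

theorem freeLayerMap_gen (M : Model E) (x : E.ext.gen) :
    (freeLayerMap M).map (freeGen x) = M.gen x :=
  (eval_value M _ ⟨_, .gen x⟩).unique (.gen x)

/-- The layer of classes of expressions, as a model. -/
noncomputable def freeModel (E : CubExt.{u} n) : Model E where
  C := E.base
  T := freeLayer E
  F := 𝟙 _
  gen := freeGen
  bd_gen x i hi α := by rw [bd_freeGen]; rfl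

/-- This gives uniqueness in the universal property: a morphism that is right on the generators
preserves evaluation, hence sends a class to the value of its representative. -/
theorem eval_freeModel (A : Expr E) (hA : Typable A) :
    Eval (freeModel E) A.toTerm (FreeCell.mk A hA) := by
  obtain ⟨S, hS⟩ := id hA
  induction hS with
  | gen x => exact .gen (M := freeModel E) x
  | deg i hi c => exact .deg (M := freeModel E) i hi c
  | conn i hi α c => exact .conn (M := freeModel E) i hi α c
  | comp i hi hA' hB' hST hU ihA ihB =>
    have h := (composable_iff ⟨_, hA'⟩ ⟨_, hB'⟩).1 ⟨_, _, hA', hB', hST⟩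
    exact (Eval.comp (M := freeModel E) i hi (ihA ⟨_, hA'⟩) (ihB ⟨_, hB'⟩) h).of_eq (comp_mk h)

theorem isFreelyGenerated_freeLayer (E : CubExt.{u} n) :
    IsFreelyGenerated ⊤ E (freeLayer E).toCubCat (layerUnit (freeLayer E) freeGen bd_freeGen) := by
  refine isFreelyGenerated_of_layer _ _ _ trivial fun D _ φ =>
    ⟨freeLayerMap (Model.ofHom φ), freeLayerMap_gen (Model.ofHom φ), fun f hf => ?_⟩
  apply PreLayer.Hom.ext
  funext a
  obtain ⟨A, hA, rfl⟩ := FreeCell.exists_mk a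
  exact ((eval_freeModel A hA).map (M' := Model.ofHom φ) (G := φ.base) f (fun _ => rfl) hf).unique
    (eval_value (Model.ofHom φ) A hA)

theorem isSyntactic_freeLayer (E : CubExt.{u} n) :
    IsSyntactic E (freeLayer E).toCubCat (layerUnit (freeLayer E) freeGen bd_freeGen) := by
  refine ⟨(freeLayer E).isIso_incl,
    ⟨fun x => .top rfl x, fun x => match (generalizing := false) (x : (freeLayer E).Cell (n + 1)) with
      | .low h _ => absurd h (by omega)
      | .top _ x => x, fun x => rfl, ?_⟩, ?_, fun x => rfl, ?_, ?_, ?_⟩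
  · rintro (⟨h, c⟩ | ⟨e, x⟩)
    · omega
    · rfl
  · intro A S hA i hi α
    exact congrArg (fun S : E.base.Shell n le_rfl => PreLayer.Cell.low le_rfl (S i hi α))
      (bd_mk hA ⟨S, hA⟩)
  · intro i hi c
    exact (PreLayer.Cell.deg_top (T := (freeLayer E).toPreLayer) c).symm
  · intro i m e hi α c
    subst e
    exact (PreLayer.Cell.conn_top (T := (freeLayer E).toPreLayer) c).symm
  · intro i hi A B hA hB h
    have h' := (composable_iff hA hB).1 h
    exact ⟨typable_comp h', congrArg (PreLayer.Cell.low le_rfl) h',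
      congrArg (PreLayer.Cell.top rfl) (comp_mk h').symm⟩

end Cub

namespace Cub

open CubCat

variable {n : ℕ}

/-! ### Layers from jointly injective families of morphisms -/

namespace PreLayer.Hom

variable {C D : CubCat.{u} n} {F : C ⟶ D} {T : PreLayer C} {T' : PreLayer D} (f : Hom F T T')

theorem map_comp_eq (i : ℕ) (hi : i ≤ n) (a b : T.X) (h : T.bd a i hi true = T.bd b i hi false) :
    f.map (T.comp i hi a b h) = T'.comp i hi (f.map a) (f.map b) (f.composable h) :=
  f.map_comp i hi a b h (f.composable h)

end PreLayer.Hom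

theorem CubFunctor.map_composable {C D : CubCat.{u} n} (F : C ⟶ D) {k : ℕ} {hk : k + 1 ≤ n}
    {i : ℕ} {hi : i ≤ k} {a b : C.cell (k + 1) hk} (h : C.face i true a = C.face i false b) :
    D.face i true (F.map a) = D.face i false (F.map b) := by
  rw [← F.map_face _ hi, h, F.map_face _ hi]

/-- A layer whose laws are detected by morphisms to other layers. -/
def PreLayer.toLayer {C : CubCat.{u} n} (T₀ : PreLayer C)
    (ext : ∀ x y : T₀.X, (∀ (D : CubCat.{u} n) (F : C ⟶ D) (T : Layer D)
      (f : PreLayer.Hom F T₀ T.toPreLayer), f.map x = f.map y) → x = y) : Layer C where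
  __ := T₀
  assoc i hi a b c hab hbc h h' := ext _ _ fun D F T f => by
    simp only [f.map_comp_eq]
    exact T.assoc ..
  interchange i j hi hj hij a b c d hab hcd hac hbd h h' := ext _ _ fun D F T f => by
    simp only [f.map_comp_eq]
    exact T.interchange _ _ _ _ hij ..
  deg_comp_self i hi a h := ext _ _ fun D F T f => by
    simp only [f.map_comp_eq, f.map_deg, ← f.bd_map]
    exact T.deg_comp_self ..
  comp_deg i hi a h := ext _ _ fun D F T f => by
    simp only [f.map_comp_eq, f.map_deg, ← f.bd_map]
    exact T.comp_deg ..
  deg_comp_le i j hij _ e hj c d h hi hj' h' := ext _ _ fun D F T f => by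
    cases e
    simp only [f.map_comp_eq, f.map_deg]
    exact (congrArg _ (F.map_comp j hj c d h (F.map_composable h))).trans
      (T.deg_comp_le i j hij rfl hj _ _ _ _ _ _)
  deg_comp_gt i j hij _ e hj c d h hi hj' h' := ext _ _ fun D F T f => by
    cases e
    simp only [f.map_comp_eq, f.map_deg]
    exact (congrArg _ (F.map_comp j hj c d h (F.map_composable h))).trans
      (T.deg_comp_gt i j hij rfl hj _ _ _ _ _ _)
  deg_deg i j hij _ e hj c := ext _ _ fun D F T f => by
    cases e
    simp only [f.map_deg]
    exact (congrArg _ (F.map_deg _ j hj c)).trans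
      ((T.deg_deg i j hij rfl hj _).trans (congrArg _ (F.map_deg _ i (by omega) c).symm))
  conn_comp_lt i j hij α _ e hj c d h hi hj' h' := ext _ _ fun D F T f => by
    cases e
    simp only [f.map_comp_eq, f.map_conn]
    exact (congrArg _ (F.map_comp j hj c d h (F.map_composable h))).trans
      (T.conn_comp_lt i j hij α rfl hj _ _ _ _ _ _)
  conn_comp_lower i _ e hi c d h _ _ _ h₁ h₂ h₃ := ext _ _ fun D F T f => by
    cases e
    simp only [f.map_comp_eq, f.map_conn, f.map_deg]
    exact (congrArg _ (F.map_comp i hi c d h (F.map_composable h))).trans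
      (T.conn_comp_lower i rfl hi _ _ _ _ _ _ _ _ _)
  conn_comp_upper i _ e hi c d h _ _ _ h₁ h₂ h₃ := ext _ _ fun D F T f => by
    cases e
    simp only [f.map_comp_eq, f.map_conn, f.map_deg]
    exact (congrArg _ (F.map_comp i hi c d h (F.map_composable h))).trans
      (T.conn_comp_upper i rfl hi _ _ _ _ _ _ _ _ _)
  conn_comp_gt i j hij _ e hi α c d hj h hi' hj' h' := ext _ _ fun D F T f => by
    cases e
    simp only [f.map_comp_eq, f.map_conn]
    exact (congrArg _ (F.map_comp j hj c d h (F.map_composable h))).trans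
      (T.conn_comp_gt i j hij rfl hi α _ _ _ _ _ _ _)
  conn_comp_conn i hi c _ _ h := ext _ _ fun D F T f => by
    simp only [f.map_comp_eq, f.map_conn, f.map_deg]
    exact T.conn_comp_conn ..
  conn_comp_conn_succ i hi c _ _ h := ext _ _ fun D F T f => by
    simp only [f.map_comp_eq, f.map_conn, f.map_deg]
    exact T.conn_comp_conn_succ ..
  conn_deg_lt i j hij α _ e hj c := ext _ _ fun D F T f => by
    cases e
    simp only [f.map_deg, f.map_conn]
    exact (congrArg _ (F.map_deg _ j hj c)).trans
      ((T.conn_deg_lt i j hij α rfl hj _).trans (congrArg _ (F.map_conn _ i (by omega) α c).symm))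
  conn_deg_eq i α _ e hi c := ext _ _ fun D F T f => by
    cases e
    simp only [f.map_deg, f.map_conn]
    exact (congrArg _ (F.map_deg _ i hi c)).trans
      ((T.conn_deg_eq i α rfl hi _).trans (congrArg _ (F.map_deg _ i hi c).symm))
  conn_deg_gt i j hij α _ e hi c := ext _ _ fun D F T f => by
    cases e
    simp only [f.map_deg, f.map_conn]
    exact (congrArg _ (F.map_deg _ j (by omega) c)).trans
      ((T.conn_deg_gt i j hij α rfl hi _).trans
        (congrArg _ (F.map_conn _ (i - 1) (by omega) α c).symm))
  conn_conn_lt i j hij α β _ e hj c := ext _ _ fun D F T f => by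
    cases e
    simp only [f.map_conn]
    exact (congrArg _ (F.map_conn _ j hj β c)).trans
      ((T.conn_conn_lt i j hij α β rfl hj _).trans
        (congrArg _ (F.map_conn _ i (by omega) α c).symm))
  conn_conn_eq i α _ e hi c := ext _ _ fun D F T f => by
    cases e
    simp only [f.map_conn]
    exact (congrArg _ (F.map_conn _ i hi α c)).trans
      ((T.conn_conn_eq i α rfl hi _).trans (congrArg _ (F.map_conn _ i hi α c).symm))

/-! ### The free layer with inverses -/

/-- The models whose cells with an invertible shell are invertible, if `p < n + 1`. -/
def Model.IsNP (p : ℕ) {E : CubExt.{u} n} (M : Model E) : Prop := p < n + 1 → M.T.InvertsShells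

theorem isNP_coskModel (p : ℕ) {E : CubExt.{u} n} {C : CubCat.{u} n} (F : E.base ⟶ C) :
    (coskModel F).IsNP p := fun _ => cosk_invertsShells C

variable {E : CubExt.{u} n} {p : ℕ}

/-- Terms that have a value in all models. -/
def Term.IsTotal (p : ℕ) (A : Term E) : Prop := ∀ M : Model E, M.IsNP p → ∃ a, Eval M A a

variable (E p) in
/-- Terms, identified if they have the same value in all models. -/
def NPCell : Type u :=
  Quot fun A B : {A : Term E // A.IsTotal p} =>
    ∀ M : Model E, M.IsNP p → ∀ a, Eval M A.1 a ↔ Eval M B.1 a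

namespace NPCell

/-- The class of a term. -/
def mk (A : Term E) (hA : A.IsTotal p) : NPCell E p := Quot.mk _ ⟨A, hA⟩

theorem exists_mk (a : NPCell E p) : ∃ A hA, a = mk A hA := by
  obtain ⟨⟨A, hA⟩, rfl⟩ := Quot.exists_rep a
  exact ⟨A, hA, rfl⟩

/-- The value of a class of terms in a model. -/
noncomputable def value (M : Model E) (hM : M.IsNP p) (a : NPCell E p) : M.T.X :=
  Quot.lift (fun A : {A : Term E // A.IsTotal p} => (A.2 M hM).choose)
    (fun A B h => ((h M hM _).1 (A.2 M hM).choose_spec).unique (B.2 M hM).choose_spec) a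

theorem eval_value (M : Model E) (hM : M.IsNP p) (A : Term E) (hA : A.IsTotal p) :
    Eval M A (value M hM (mk A hA)) := (hA M hM).choose_spec

/-- The models separate classes of terms. All laws of the layer, and the equations for inverses, are
reduced to the models in this way. -/
theorem ext {a b : NPCell E p} (h : ∀ M hM, value M hM a = value M hM b) : a = b := by
  obtain ⟨A, hA, rfl⟩ := a.exists_mk
  obtain ⟨B, hB, rfl⟩ := b.exists_mk
  refine Quot.sound fun M hM x => ⟨fun hx => ?_, fun hx => ?_⟩
  · exact (eval_value M hM B hB).of_eq ((h M hM).symm.trans ((eval_value M hM A hA).unique hx))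
  · exact (eval_value M hM A hA).of_eq ((h M hM).trans ((eval_value M hM B hB).unique hx))

/-- The shell of a class of terms. -/
noncomputable def bd (a : NPCell E p) : E.base.Shell n le_rfl :=
  Subtype.val (p := E.base.IsSquare) (value (coskModel (𝟙 E.base)) (isNP_coskModel p _) a)

theorem bd_square (a : NPCell E p) : E.base.IsSquare (bd a) :=
  Subtype.property (p := E.base.IsSquare) (value (coskModel (𝟙 E.base)) (isNP_coskModel p _) a)

theorem bd_value (M : Model E) (hM : M.IsNP p) (a : NPCell E p) (i : ℕ) (hi : i ≤ n) (α : Bool) :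
    M.T.bd (value M hM a) i hi α = M.F.map (bd a i hi α) := by
  obtain ⟨A, hA, rfl⟩ := a.exists_mk
  exact (eval_value M hM A hA).bd_eq (eval_value _ _ A hA) i hi α

theorem composable_value (M : Model E) (hM : M.IsNP p) {a b : NPCell E p} {i : ℕ} {hi : i ≤ n}
    (h : bd a i hi true = bd b i hi false) :
    M.T.bd (value M hM a) i hi true = M.T.bd (value M hM b) i hi false := by
  rw [bd_value, bd_value, h]

theorem exists_comp (i : ℕ) (hi : i ≤ n) (a b : NPCell E p)
    (h : bd a i hi true = bd b i hi false) :
    ∃ x : NPCell E p, ∀ M hM, value M hM x =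
      M.T.comp i hi (value M hM a) (value M hM b) (composable_value M hM h) := by
  obtain ⟨A, hA, rfl⟩ := a.exists_mk
  obtain ⟨B, hB, rfl⟩ := b.exists_mk
  have h' : ∀ M hM, Eval M (.comp i hi A B) _ := fun M hM =>
    .comp i hi (eval_value M hM A hA) (eval_value M hM B hB) (composable_value M hM h)
  exact ⟨mk _ fun M hM => ⟨_, h' M hM⟩, fun M hM => (eval_value M hM _ _).unique (h' M hM)⟩

/-- Composition of classes of terms. -/
noncomputable def comp (i : ℕ) (hi : i ≤ n) (a b : NPCell E p)
    (h : bd a i hi true = bd b i hi false) : NPCell E p := (exists_comp i hi a b h).choose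

theorem value_comp (M : Model E) (hM : M.IsNP p) {i : ℕ} {hi : i ≤ n} {a b : NPCell E p}
    (h : bd a i hi true = bd b i hi false) :
    value M hM (comp i hi a b h) =
      M.T.comp i hi (value M hM a) (value M hM b) (composable_value M hM h) :=
  (exists_comp i hi a b h).choose_spec M hM

end NPCell

open NPCell

variable (E p) in
/-- The data of the layer of classes of terms. -/
noncomputable def npPreLayer : PreLayer E.base where
  X := NPCell E p
  bd := bd
  deg i hi c := mk (.deg i hi c) fun M _ => ⟨_, .deg i hi c⟩
  conn i hi α c := mk (.conn i hi α c) fun M _ => ⟨_, .conn i hi α c⟩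
  comp := comp
  bd_square := bd_square
  bd_deg i hi c := congrArg Subtype.val
    ((eval_value (coskModel (𝟙 E.base)) (isNP_coskModel p _) _ _).unique (.deg i hi c))
  bd_conn i hi α c := congrArg Subtype.val
    ((eval_value (coskModel (𝟙 E.base)) (isNP_coskModel p _) _ _).unique (.conn i hi α c))
  bd_comp i hi a b h := by
    have := (coskPre E.base).bd_comp i hi _ _
      (composable_value (coskModel (𝟙 E.base)) (isNP_coskModel p _) h)
    exact (congrArg (E.base.IsCompShell i hi (bd a) (bd b)) (congrArg Subtype.val
      (value_comp (coskModel (𝟙 E.base)) (isNP_coskModel p _) h))).mpr this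

/-- The morphism from the layer of classes of terms to a model. -/
noncomputable def npPreLayerMap (M : Model E) (hM : M.IsNP p) :
    PreLayer.Hom M.F (npPreLayer E p) M.T.toPreLayer where
  map := value M hM
  bd_map := bd_value M hM
  map_deg i hi c := (eval_value M hM _ _).unique (.deg i hi c)
  map_conn i hi α c := (eval_value M hM _ _).unique (.conn i hi α c)
  map_comp _ _ _ _ h _ := value_comp M hM h

variable (E p) in
/-- The layer of classes of terms. -/
noncomputable def npLayer : Layer E.base :=
  (npPreLayer E p).toLayer fun _ _ h => NPCell.ext fun M hM => h _ _ _ (npPreLayerMap M hM)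

/-- The classes of the generators. -/
def npGen (x : E.ext.gen) : NPCell E p := .mk (.gen x) fun _ _ => ⟨_, .gen x⟩

theorem bd_npGen (x : E.ext.gen) : (npLayer E p).bd (npGen x) = E.ext.bd x :=
  congrArg Subtype.val
    ((eval_value (coskModel (𝟙 E.base)) (isNP_coskModel p _) _ _).unique (.gen x))

theorem npPreLayerMap_gen (M : Model E) (hM : M.IsNP p) (x : E.ext.gen) :
    (npPreLayerMap M hM).map (npGen x) = M.gen x :=
  (eval_value M hM _ _).unique (.gen x)

variable (E p) in
/-- The layer of classes of terms, as a model. -/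
noncomputable def npModel : Model E where
  C := E.base
  T := npLayer E p
  F := 𝟙 _
  gen := npGen
  bd_gen x i hi α := by rw [bd_npGen]; rfl

/-- Composability is read off in the model of squares, which by definition supplies the boundaries;
the two equations are tested in all models. -/
theorem inverse_of_value {i : ℕ} {hi : i ≤ n} {a b : NPCell E p}
    (h : ∀ (M : Model E) (hM : M.IsNP p), M.T.Inverse i hi (value M hM a) (value M hM b)) :
    (npLayer E p).Inverse i hi a b := by
  obtain ⟨h₁, h₂, -⟩ := h (coskModel (𝟙 E.base)) (isNP_coskModel p _)
  refine ⟨h₁, h₂, NPCell.ext fun M hM => ?_, NPCell.ext fun M hM => ?_⟩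
  · obtain ⟨h₁', h₂', e₁, e₂⟩ := h M hM
    refine ((npPreLayerMap M hM).map_comp i hi a b h₁ h₁').trans (e₁.trans ?_)
    exact (congrArg _ (bd_value M hM a i hi false)).trans
      ((npPreLayerMap M hM).map_deg i hi _).symm
  · obtain ⟨h₁', h₂', e₁, e₂⟩ := h M hM
    refine ((npPreLayerMap M hM).map_comp i hi b a h₂ h₂').trans (e₂.trans ?_)
    exact (congrArg _ (bd_value M hM a i hi true)).trans
      ((npPreLayerMap M hM).map_deg i hi _).symm

/-- Functors preserve invertible shells, so the value of the term in any admissible model has an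
invertible shell and is invertible there. Its formal inverse thus has a value everywhere, and is the
required inverse. -/
theorem npLayer_invertsShells (hp : p < n + 1) : (npLayer E p).InvertsShells := by
  intro i hi a ha
  obtain ⟨A, hA, rfl⟩ := NPCell.exists_mk a
  have h : ∀ (M : Model E) (hM : M.IsNP p), ∃ b, M.T.Inverse i hi (value M hM (mk A hA)) b := by
    intro M hM
    refine hM hp i hi _ ?_
    rw [show M.T.bd _ = _ from funext fun i => funext fun hi => funext (bd_value M hM (mk A hA) i hi)]
    exact ha.map M.F
  have h' : (Term.inv i hi A).IsTotal p := fun M hM =>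
    ⟨_, .inv i hi (eval_value M hM A hA) (h M hM).choose_spec⟩
  refine ⟨mk _ h', inverse_of_value fun M hM => ?_⟩
  rw [(eval_value M hM _ h').unique (.inv i hi (eval_value M hM A hA) (h M hM).choose_spec)]
  exact (h M hM).choose_spec

/-- The induction works because subterms of a term with values in all models again have values in
all models. As for expressions, this yields uniqueness of morphisms out of the layer. -/
theorem eval_npModel (A : Term E) (hA : A.IsTotal p) : Eval (npModel E p) A (mk A hA) := by
  induction A with
  | gen x => exact .gen (M := npModel E p) x
  | deg i hi c => exact .deg (M := npModel E p) i hi c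
  | conn i hi α c => exact .conn (M := npModel E p) i hi α c
  | comp i hi A B ihA ihB =>
    have hA' : A.IsTotal p := fun M hM => by
      obtain ⟨_, h⟩ := hA M hM
      cases h with
      | comp _ _ hA hB h => exact ⟨_, hA⟩
    have hB' : B.IsTotal p := fun M hM => by
      obtain ⟨_, h⟩ := hA M hM
      cases h with
      | comp _ _ hA hB h => exact ⟨_, hB⟩
    -- A value of the composite in the squares contains a proof that the operands are composable
    -- there, which is composability of the classes.
    have h : bd (mk A hA') i hi true = bd (mk B hB') i hi false := by
      obtain ⟨_, h⟩ := hA (coskModel (𝟙 E.base)) (isNP_coskModel p _)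
      cases h with
      | comp _ _ hA hB h =>
        rwa [hA.unique (eval_value _ (isNP_coskModel p _) A hA'),
          hB.unique (eval_value _ (isNP_coskModel p _) B hB')] at h
    refine (Eval.comp (M := npModel E p) i hi (ihA hA') (ihB hB') h).of_eq
      (NPCell.ext fun M hM => ?_)
    exact (value_comp M hM h).trans ((eval_value M hM _ hA).unique
      (.comp i hi (eval_value M hM A hA') (eval_value M hM B hB') (composable_value M hM h))).symm
  | inv i hi A ih =>
    have hA' : A.IsTotal p := fun M hM => by
      obtain ⟨_, h⟩ := hA M hM
      cases h with
      | inv _ _ hA h => exact ⟨_, hA⟩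
    refine .inv (M := npModel E p) i hi (ih hA') (inverse_of_value fun M hM => ?_)
    have h := eval_value M hM _ hA
    cases h with
    | inv _ _ h h' => rwa [h.unique (eval_value M hM A hA')] at h'

end Cub

namespace Cub

open CubCat

variable {n p : ℕ}

/-! ### Cubical `(n, p)`-categories and layers -/

/-- Invertibility in dimensions up to `n` concerns the base alone and is moved along the isomorphism
`incl`; in dimension `n + 1` it is invertibility in the layer. -/
theorem Layer.isNP_toCubCat {C : CubCat.{u} n} (T : Layer C) (hC : isNP n p C)
    (hT : p < n + 1 → T.InvertsShells) : isNP (n + 1) p T.toCubCat := by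
  intro k hk hp i hi a ha
  rcases a with ⟨h, c⟩ | ⟨e, x⟩
  · have hc : ((trunc n).obj T.toCubCat).HasRInvertibleShell (hk := h) i hi (T.incl.map c) := by
      cases k with
      | zero => trivial
      | succ k => exact ha
    exact IsRInvertible.map T.incl (hC k h hp i hi c (HasRInvertibleShell.map T.inclInv hc))
  · obtain rfl : k = n := by omega
    have hx : C.IsRInvertibleShell i hi (T.bd x) := by
      have h₁ : ((trunc k).obj T.toCubCat).IsRInvertibleShell i hi
          fun j hj α => T.incl.map (T.bd x j hj α) := by
        cases k with
        | zero => trivial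
        | succ k => exact ha
      exact IsRInvertibleShell.map T.inclInv h₁
    obtain ⟨b, h, h', e₁, e₂⟩ := hT hp i hi x hx
    refine ⟨PreLayer.Cell.top rfl b, congrArg (PreLayer.Cell.low le_rfl) h,
      congrArg (PreLayer.Cell.low le_rfl) h', ?_, ?_⟩
    · exact (congrArg (PreLayer.Cell.top rfl) e₁).trans (PreLayer.Cell.deg_top _).symm
    · exact (congrArg (PreLayer.Cell.top rfl) e₂).trans (PreLayer.Cell.deg_top _).symm

theorem topLayer_invertsShells {D : CubCat.{u} (n + 1)} (hD : isNP (n + 1) p D) (hp : p < n + 1) :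
    (topLayer D).InvertsShells := by
  intro i hi a ha
  refine hD n le_rfl hp i hi a ?_
  cases n with
  | zero => trivial
  | succ n => exact ha

/-- The condition on the base makes the result a cubical `(n + 1, p)`-category; the condition on `D`
makes its top layer one of the models in which terms were required to have values. -/
theorem isFreelyGenerated_npLayer (E : CubExt.{u} n) (hE : isNP n p E.base) :
    IsFreelyGenerated (isNP (n + 1) p) E (npLayer E p).toCubCat
      (layerUnit (npLayer E p) npGen bd_npGen) := by
  refine isFreelyGenerated_of_layer _ _ _ ((npLayer E p).isNP_toCubCat hE npLayer_invertsShells)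
    fun D hD φ => ?_
  have hM : (Model.ofHom φ).IsNP p := topLayer_invertsShells hD
  refine ⟨npPreLayerMap _ hM, npPreLayerMap_gen _ hM, fun f hf => ?_⟩
  apply PreLayer.Hom.ext
  funext a
  obtain ⟨A, hA, rfl⟩ := NPCell.exists_mk a
  exact ((eval_npModel A hA).map (M' := Model.ofHom φ) (G := φ.base) f (fun _ => rfl) hf).unique
    (NPCell.eval_value (Model.ofHom φ) hM A hA)

end Cub

namespace Cub

/-! ### The adjunctions -/

/-- Universal arrows give a left adjoint; its unit has all the properties of the given arrows. -/
theorem exists_leftAdjoint_of_existsUnique {A B : Type*} [Category* A] [Category* B] (R : B ⥤ A)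
    (F : A → B) (η : ∀ X, X ⟶ R.obj (F X))
    (h : ∀ X Y (φ : X ⟶ R.obj Y), ∃! f : F X ⟶ Y, η X ≫ R.map f = φ) :
    ∃ (L : A ⥤ B) (adj : L ⊣ R), ∀ P : ∀ X Y, (X ⟶ R.obj Y) → Prop,
      (∀ X, P X (F X) (η X)) → ∀ X, P X (L.obj X) (adj.unit.app X) := by
  obtain ⟨e, he⟩ : ∃ e : ∀ X Y, (F X ⟶ Y) ≃ (X ⟶ R.obj Y), ∀ X Y f, e X Y f = η X ≫ R.map f :=
    ⟨fun X Y => Equiv.ofBijective (fun f => η X ≫ R.map f)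
      ⟨fun f g hfg => (h X Y _).unique rfl hfg.symm, fun φ => (h X Y φ).exists⟩,
      fun _ _ _ => rfl⟩
  have he' : ∀ X Y Y' g f, e X Y' (f ≫ g) = e X Y f ≫ R.map g := fun X Y Y' g f => by
    simp only [he, R.map_comp, Category.assoc]
  refine ⟨_, Adjunction.adjunctionOfEquivLeft e he', fun P hP X => ?_⟩
  -- The unit is the image of the identity under the hom bijection, which is the given universal
  -- arrow; so properties of the latter pass to the unit.
  have hη : (Adjunction.adjunctionOfEquivLeft e he').unit.app X = η X := by
    have : (Adjunction.adjunctionOfEquivLeft e he').unit.app X = e X (F X) (𝟙 (F X)) := by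
      simp [Adjunction.adjunctionOfEquivLeft]
    rw [this, he, R.map_id, Category.comp_id]
  exact hη ▸ hP X

theorem exists_leftAdjoint (n : ℕ) : ∃ (L : CubExt.{u} n ⥤ CubCat.{u} (n + 1)) (adj : L ⊣ W n),
    ∀ E, IsSyntactic E (L.obj E) (adj.unit.app E) ∧
      IsFreelyGenerated ⊤ E (L.obj E) (adj.unit.app E) := by
  obtain ⟨L, adj, h⟩ := exists_leftAdjoint_of_existsUnique (W n)
    (fun E => (freeLayer E).toCubCat) (fun E => layerUnit _ freeGen bd_freeGen)
    fun E D φ => (isFreelyGenerated_freeLayer E).2.2 D trivial φ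
  exact ⟨L, adj, h (fun E D η => IsSyntactic E D η ∧ IsFreelyGenerated ⊤ E D η)
    fun E => ⟨isSyntactic_freeLayer E, isFreelyGenerated_freeLayer E⟩⟩

theorem exists_leftAdjoint_np (n p : ℕ) :
    ∃ (L : CubNPExt.{u} n p ⥤ CubNPCat.{u} (n + 1) p) (adj : L ⊣ WNP n p),
      ∀ E, IsFreelyGenerated (isNP (n + 1) p) E.obj (L.obj E).obj (adj.unit.app E).hom := by
  have hF (E : CubNPExt.{u} n p) := isFreelyGenerated_npLayer (p := p) E.obj E.property
  obtain ⟨L, adj, h⟩ := exists_leftAdjoint_of_existsUnique (WNP n p)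
    (fun E => ⟨(npLayer E.obj p).toCubCat, (hF E).2.1⟩)
    (fun E => ⟨layerUnit _ npGen bd_npGen⟩) fun E D φ => by
      obtain ⟨f, hf, hf'⟩ := (hF E).2.2 D.obj D.property φ.hom
      exact ⟨⟨f⟩, InducedCategory.hom_ext hf,
        fun g hg => InducedCategory.hom_ext (hf' g.hom (congrArg (fun φ => φ.hom) hg))⟩
  exact ⟨L, adj, h (fun E D η => IsFreelyGenerated (isNP (n + 1) p) E.obj D.obj η.hom) hF⟩

end Cub

theorem lemmaL :
    -- the left adjoints `L n` of `W n`, and the free cubical categories on cubical polygraphs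
    (∃ (L : ∀ n : ℕ, Cub.CubExt.{u} n ⥤ Cub.CubCat.{u} (n + 1))
        (adj : ∀ n : ℕ, L n ⊣ Cub.W n),
      (∀ (n : ℕ) (E : Cub.CubExt.{u} n),
        Cub.IsSyntactic E ((L n).obj E) ((adj n).unit.app E)) ∧
      ∀ (n : ℕ) (X : (Cub.polygraphs L (n + 1)).P),
        Cub.IsFreelyGenerated ⊤ ((Cub.PolStep.toExt (Cub.polygraphs L n).F).obj X)
          ((Cub.polygraphs L (n + 1)).F.obj X)
          ((adj n).unit.app ((Cub.PolStep.toExt (Cub.polygraphs L n).F).obj X))) ∧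
    -- the same for cubical `(n, p)`-categories, hence for cubical groupoids if `p = 0`
    ∀ p : ℕ, ∃ (L : ∀ n : ℕ, Cub.CubNPExt.{u} n p ⥤ Cub.CubNPCat.{u} (n + 1) p)
        (adj : ∀ n : ℕ, L n ⊣ Cub.WNP n p),
      (∀ (n : ℕ) (E : Cub.CubNPExt.{u} n p), IsIso ((adj n).unit.app E).hom.base) ∧
      ∀ (n : ℕ) (X : (Cub.polygraphsNP p L (n + 1)).P),
        Cub.IsFreelyGenerated (Cub.isNP (n + 1) p)
          ((Cub.PolStep.toNPExt (Cub.polygraphsNP p L n).F).obj X).obj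
          ((Cub.polygraphsNP p L (n + 1)).F.obj X).obj
          ((adj n).unit.app ((Cub.PolStep.toNPExt (Cub.polygraphsNP p L n).F).obj X)).hom := by
  constructor
  · choose L adj h using Cub.exists_leftAdjoint.{u}
    -- By definition the category generated by an `(n + 1)`-polygraph is `L n` of its extension, so
    -- its freeness is an instance of that for arbitrary extensions.
    exact ⟨L, adj, fun n E => (h n E).1, fun n X => (h n _).2⟩
  · intro p
    choose L adj h using fun n => Cub.exists_leftAdjoint_np.{u} n p
    exact ⟨L, adj, fun n E => (h n E).1, fun n X => h n _⟩
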